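/- **Linearization theorem.** Let $\mathcal G=(\mathbb C,\mathbb D)-\{0\}$ be the multiplicative pseudo-group represented by the punctured discs $G_R=\{t\in\mathbb C : 0<|t|<R\}$, $R>1$. Let $\sigma$ be a connected Riemann surface (not necessarily compact) holomorphically embedded in a complex surface $S$ (a Hausdorff, second countable complex manifold of dimension two), and let $(S,\sigma)$ be the germ of $S$ along $\sigma$. Let $\psi$ be a transverse $\mathcal G$-action on $(S,\sigma)$. This means that for some $R>1$ and some open neighbourhood $U$ of $\sigma$ in $S$, $\psi: G_R\times U\to S$ is a holomorphic map with $\psi(1,a)=a$ for $a\in U$, with $\psi(st,a)=\psi(s,\psi(t,a))$ whenever $s,t,st\in G_R$ and $a,\psi(t,a)\in U$, and such that 1. $\psi(t,a)=a$ for all $a\in\sigma$ and $t\in G_R$; 2. there is a nonsingular holomorphic foliation $\mathcal F$ on $U$, transverse to $\sigma$, each leaf of which is the closure in $U$ of the orbit $\{\psi(t,a) : t\in G_R\}$ of some $a\in U\setminus\sigma$ (that is, the closure of that orbit intersected with $U$). Let $N=TS|_\sigma/T\sigma$ be the normal bundle of $\sigma$ in $S$, and identify $\sigma$ with its zero section.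 Then there are a natural number $q\ge 1$ and a biholomorphism of germs $h:(S,\sigma)\to(N,\sigma)$, that is, a biholomorphism from an open neighbourhood of $\sigma$ in $S$ onto an open neighbourhood of the zero section in $N$, which is the identity on $\sigma$, such that $$h(\psi(t,a))=t^q\,h(a)$$ for all $(t,a)$ with $t\neq 0$ in some neighbourhood of $\overline{\mathbb D}\times\sigma$ in $\mathbb C\times S$ (in particular $h$ is defined at $a$ and at $\psi(t,a)$ there). No hypothesis is made on the self-intersection number of $\sigma$. -/

import Mathlib

open Set Filter Topology Bundle Manifold
open scoped Manifold ContDiff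

noncomputable section

/-! ### Embedded Riemann surfaces in complex surfaces

A Riemann surface is a complex manifold modelled on `ℂ`, a complex surface is a complex manifold
modelled on `ℂ × ℂ`. -/

/-- A holomorphic embedding of the Riemann surface `σ` in the complex surface `S`. -/
structure HolEmbedding (σ S : Type*) [TopologicalSpace σ] [ChartedSpace ℂ σ]
    [TopologicalSpace S] [ChartedSpace (ℂ × ℂ) S] where
  /-- the underlying map -/
  toFun : σ → S
  isSmoothEmbedding : IsSmoothEmbedding 𝓘(ℂ, ℂ) 𝓘(ℂ, ℂ × ℂ) ω toFun

instance {σ S : Type*} [TopologicalSpace σ] [ChartedSpace ℂ σ]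
    [TopologicalSpace S] [ChartedSpace (ℂ × ℂ) S] :
    CoeFun (HolEmbedding σ S) (fun _ => σ → S) := ⟨HolEmbedding.toFun⟩

namespace HolEmbedding

variable {σ S : Type*} [TopologicalSpace σ] [ChartedSpace ℂ σ]
  [TopologicalSpace S] [ChartedSpace (ℂ × ℂ) S]

/-- The differential `T_x σ → T_{ι x} S` of the embedding. -/
def diff (ι : HolEmbedding σ S) (x : σ) :
    TangentSpace 𝓘(ℂ, ℂ) x →L[ℂ] TangentSpace 𝓘(ℂ, ℂ × ℂ) (ι x) :=
  mfderiv 𝓘(ℂ, ℂ) 𝓘(ℂ, ℂ × ℂ) ι x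

theorem diff_injective [IsManifold 𝓘(ℂ, ℂ) ω σ] [IsManifold 𝓘(ℂ, ℂ × ℂ) ω S]
    (ι : HolEmbedding σ S) (x : σ) : Function.Injective (ι.diff x) := by
  have h := ι.isSmoothEmbedding.isImmersion.isImmersionAt x
  have hx := h.mem_domChart_source
  have hw := h.writtenInCharts
  have hι : MDifferentiableAt 𝓘(ℂ, ℂ) 𝓘(ℂ, ℂ × ℂ) ι x :=
    (ι.isSmoothEmbedding.contMDiff x).mdifferentiableAt (by simp)
  have hc : MDifferentiableAt 𝓘(ℂ, ℂ × ℂ) 𝓘(ℂ, ℂ × ℂ) h.codChart (ι x) :=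
    mdifferentiableAt_of_mem_maximalAtlas
      (IsManifold.maximalAtlas_subset_of_le (by simp) h.codChart_mem_maximalAtlas)
      h.mem_codChart_source
  have hd : MDifferentiableAt 𝓘(ℂ, ℂ) 𝓘(ℂ, ℂ) h.domChart.symm (h.domChart x) :=
    mdifferentiableAt_symm_of_mem_maximalAtlas
      (IsManifold.maximalAtlas_subset_of_le (by simp) h.domChart_mem_maximalAtlas)
      (h.domChart.map_source hx)
  have key : ∀ y ∈ h.domChart.source,
      (h.equiv.symm (h.codChart (ι y))).1 = h.domChart y := by
    intro y hy
    have := hw (x := h.domChart y) (by simpa using h.domChart.map_source hy)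
    simp only [Function.comp_apply, OpenPartialHomeomorph.extend_coe,
      OpenPartialHomeomorph.extend_coe_symm, modelWithCornersSelf_coe,
      modelWithCornersSelf_coe_symm, id_eq, h.domChart.left_inv hy] at this
    rw [this]; simp
  let l : ℂ × ℂ →L[ℂ] ℂ :=
    (ContinuousLinearMap.fst ℂ ℂ h.complement).comp (h.equiv.symm : ℂ × ℂ →L[ℂ] ℂ × h.complement)
  have hl : MDifferentiableAt 𝓘(ℂ, ℂ × ℂ) 𝓘(ℂ, ℂ) l (h.codChart (ι x)) :=
    l.differentiableAt.mdifferentiableAt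
  have hlx : l (h.codChart (ι x)) = h.domChart x := key x hx
  have hr : MDifferentiableAt 𝓘(ℂ, ℂ × ℂ) 𝓘(ℂ, ℂ)
      (h.domChart.symm ∘ l ∘ h.codChart) (ι x) := by
    have h1 := hl.comp (ι x) hc
    refine MDifferentiableAt.comp (ι x) (g := h.domChart.symm) ?_ h1
    simpa only [Function.comp_apply, hlx] using hd
  have hid : (h.domChart.symm ∘ l ∘ h.codChart) ∘ ι =ᶠ[𝓝 x] id := by
    filter_upwards [h.domChart.open_source.mem_nhds hx] with y hy
    have : l (h.codChart (ι y)) = h.domChart y := key y hy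
    simp [this, h.domChart.left_inv hy]
  have hm := mfderiv_comp x hr hι
  rw [hid.mfderiv_eq, mfderiv_id] at hm
  intro v w hvw
  have hv := congrArg (fun L => L v) hm
  have hw := congrArg (fun L => L w) hm
  exact hv.trans ((congrArg _ hvw).trans hw.symm)

/-! ### The normal bundle

Its fibre at `x` is `T_{ι x} S / dι (T_x σ)`. The bundle is trivialised around a point `b` as
follows: the charts at `b` and `ι b` trivialise the tangent bundles of `σ` and `S`, a frame `e` of
`Tσ` is obtained, and the class of a vector `w` is sent to the number `det (dι e, w)`, computed in
the trivialisation of `TS`. -/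

/-- The fibre of the normal bundle. -/
def NormalSpace (ι : HolEmbedding σ S) (x : σ) : Type :=
  TangentSpace 𝓘(ℂ, ℂ × ℂ) (ι x) ⧸ (ι.diff x).range

instance (ι : HolEmbedding σ S) (x : σ) : AddCommGroup (ι.NormalSpace x) :=
  inferInstanceAs (AddCommGroup (TangentSpace 𝓘(ℂ, ℂ × ℂ) (ι x) ⧸ (ι.diff x).range))

instance (ι : HolEmbedding σ S) (x : σ) : Module ℂ (ι.NormalSpace x) :=
  inferInstanceAs (Module ℂ (TangentSpace 𝓘(ℂ, ℂ × ℂ) (ι x) ⧸ (ι.diff x).range))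

instance (ι : HolEmbedding σ S) (x : σ) : TopologicalSpace (ι.NormalSpace x) :=
  inferInstanceAs (TopologicalSpace (TangentSpace 𝓘(ℂ, ℂ × ℂ) (ι x) ⧸ (ι.diff x).range))

/-- The class of an ambient tangent vector in the normal space. -/
def normalMk (ι : HolEmbedding σ S) (x : σ) :
    TangentSpace 𝓘(ℂ, ℂ × ℂ) (ι x) →ₗ[ℂ] ι.NormalSpace x :=
  (ι.diff x).range.mkQ

theorem normalMk_surjective (ι : HolEmbedding σ S) (x : σ) :
    Function.Surjective (ι.normalMk x) := Submodule.mkQ_surjective _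

/-- The linear form `w ↦ det (v, w)` on `ℂ × ℂ`. -/
def detForm (v : ℂ × ℂ) : ℂ × ℂ →L[ℂ] ℂ :=
  v.1 • ContinuousLinearMap.snd ℂ ℂ ℂ - v.2 • ContinuousLinearMap.fst ℂ ℂ ℂ

theorem detForm_apply (v w : ℂ × ℂ) : detForm v w = v.1 * w.2 - v.2 * w.1 := by
  simp [detForm]

theorem detForm_self (v : ℂ × ℂ) : detForm v v = 0 := by
  rw [detForm_apply]; ring

theorem detForm_smul_left (c : ℂ) (v w : ℂ × ℂ) : detForm (c • v) w = c * detForm v w := by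
  simp only [detForm_apply, Prod.smul_fst, Prod.smul_snd, smul_eq_mul]; ring

theorem exists_of_detForm_eq_zero {v w : ℂ × ℂ} (hv : v ≠ 0) (h : detForm v w = 0) :
    ∃ c : ℂ, w = c • v := by
  rw [detForm_apply] at h
  by_cases h1 : v.1 = 0
  · have h2 : v.2 ≠ 0 := fun h2 => hv (Prod.ext h1 h2)
    refine ⟨w.2 / v.2, Prod.ext ?_ ?_⟩
    · have : v.2 * w.1 = 0 := by simpa [h1] using h
      simpa [h1, h2] using this
    · simp [h2]
  · refine ⟨w.1 / v.1, Prod.ext ?_ ?_⟩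
    · simp [h1]
    · simp only [Prod.smul_snd, smul_eq_mul]
      field_simp
      linear_combination h

theorem detForm_surjective {v : ℂ × ℂ} (hv : v ≠ 0) : Function.Surjective (detForm v) := by
  intro c
  by_cases h1 : v.1 = 0
  · have h2 : v.2 ≠ 0 := fun h2 => hv (Prod.ext h1 h2)
    exact ⟨(-(c / v.2), 0), by rw [detForm_apply]; simp; field_simp⟩
  · exact ⟨(0, c / v.1), by rw [detForm_apply]; simp; field_simp⟩

/-- The determinant of an endomorphism of `ℂ × ℂ`. -/
def det2 (A : ℂ × ℂ →L[ℂ] ℂ × ℂ) : ℂ := detForm (A (1, 0)) (A (0, 1))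

theorem detForm_map (A : ℂ × ℂ →L[ℂ] ℂ × ℂ) (v w : ℂ × ℂ) :
    detForm (A v) (A w) = det2 A * detForm v w := by
  have h : ∀ u : ℂ × ℂ, A u = u.1 • A (1, 0) + u.2 • A (0, 1) := by
    intro u
    rw [← map_smul, ← map_smul, ← map_add]
    simp
  rw [h v, h w, det2]
  simp only [detForm_apply, Prod.fst_add, Prod.snd_add, Prod.smul_fst, Prod.smul_snd, smul_eq_mul]
  ring

variable [IsManifold 𝓘(ℂ, ℂ) ω σ] [IsManifold 𝓘(ℂ, ℂ × ℂ) ω S]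

/-- The trivialisation of `Tσ` given by the chart at `b`. -/
abbrev trivσ (b : σ) : Trivialization ℂ (π ℂ (TangentSpace 𝓘(ℂ, ℂ) : σ → Type)) :=
  trivializationAt ℂ (TangentSpace 𝓘(ℂ, ℂ) : σ → Type) b

/-- The trivialisation of `TS` given by the chart at `p`. -/
abbrev trivS (p : S) : Trivialization (ℂ × ℂ) (π (ℂ × ℂ) (TangentSpace 𝓘(ℂ, ℂ × ℂ) : S → Type)) :=
  trivializationAt (ℂ × ℂ) (TangentSpace 𝓘(ℂ, ℂ × ℂ) : S → Type) p

/-- The neighbourhood of `b` over which the normal bundle is trivialised. -/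
def normalBase (ι : HolEmbedding σ S) (b : σ) : Set σ :=
  (trivσ b).baseSet ∩ ι ⁻¹' (trivS (ι b)).baseSet

/-- The image under `dι` of the frame of `Tσ` given by the chart at `b`, in the trivialisation
of `TS` given by the chart at `ι b`. -/
def tangentVec (ι : HolEmbedding σ S) (b x : σ) : ℂ × ℂ :=
  (trivS (ι b)).continuousLinearMapAt ℂ (ι x) (ι.diff x ((trivσ b).symmL ℂ x 1))

theorem detForm_comp_diff (ι : HolEmbedding σ S) (b x : σ) (hx : x ∈ ι.normalBase b)
    (v : TangentSpace 𝓘(ℂ, ℂ) x) :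
    detForm (ι.tangentVec b x) ((trivS (ι b)).continuousLinearMapAt ℂ (ι x) (ι.diff x v)) = 0 := by
  have hv : v = (trivσ b).continuousLinearMapAt ℂ x v • (trivσ b).symmL ℂ x 1 := by
    rw [← map_smul, smul_eq_mul, mul_one, Trivialization.symmL_continuousLinearMapAt _ hx.1]
  rw [hv, map_smul, map_smul, map_smul]
  change _ • detForm (ι.tangentVec b x) (ι.tangentVec b x) = 0
  rw [detForm_self, smul_zero]

/-- The coordinate on the normal space at `x` given by the charts at `b` and `ι b` (zero when `x`
is not in `ι.normalBase b`). -/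
def normalCoord (ι : HolEmbedding σ S) (b x : σ) : ι.NormalSpace x →ₗ[ℂ] ℂ :=
  open Classical in
  if hx : x ∈ ι.normalBase b then
    (ι.diff x).range.liftQ
      ((detForm (ι.tangentVec b x)).comp
        ((trivS (ι b)).continuousLinearMapAt ℂ (ι x))).toLinearMap
      (by rintro _ ⟨v, rfl⟩; exact ι.detForm_comp_diff b x hx v)
  else 0

theorem normalCoord_mk (ι : HolEmbedding σ S) (b x : σ) (hx : x ∈ ι.normalBase b)
    (w : TangentSpace 𝓘(ℂ, ℂ × ℂ) (ι x)) :
    ι.normalCoord b x (ι.normalMk x w) =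
      detForm (ι.tangentVec b x) ((trivS (ι b)).continuousLinearMapAt ℂ (ι x) w) := by
  have h : ι.normalCoord b x = (ι.diff x).range.liftQ
      ((detForm (ι.tangentVec b x)).comp
        ((trivS (ι b)).continuousLinearMapAt ℂ (ι x))).toLinearMap
      (by rintro _ ⟨v, rfl⟩; exact ι.detForm_comp_diff b x hx v) := dif_pos hx
  rw [h]; rfl

theorem tangentVec_ne_zero (ι : HolEmbedding σ S) (b x : σ) (hx : x ∈ ι.normalBase b) :
    ι.tangentVec b x ≠ 0 := by
  intro h
  have h1 : ι.diff x ((trivσ b).symmL ℂ x 1) = 0 := by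
    rw [← Trivialization.symmL_continuousLinearMapAt (R := ℂ) (trivS (ι b)) hx.2
      (ι.diff x ((trivσ b).symmL ℂ x 1))]
    change (trivS (ι b)).symmL ℂ (ι x) (ι.tangentVec b x) = 0
    rw [h, map_zero]
  have h2 : (trivσ b).symmL ℂ x 1 = 0 := ι.diff_injective x (h1.trans (map_zero _).symm)
  have h3 := Trivialization.continuousLinearMapAt_symmL (R := ℂ) (trivσ b) hx.1 1
  rw [h2, map_zero] at h3
  exact one_ne_zero h3.symm

theorem normalCoord_bijective (ι : HolEmbedding σ S) (b x : σ) (hx : x ∈ ι.normalBase b) :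
    Function.Bijective (ι.normalCoord b x) := by
  have hne := ι.tangentVec_ne_zero b x hx
  constructor
  · rw [← LinearMap.ker_eq_bot, LinearMap.ker_eq_bot']
    intro m hm
    obtain ⟨w, rfl⟩ := ι.normalMk_surjective x m
    rw [normalCoord_mk _ _ _ hx] at hm
    obtain ⟨c, hc⟩ := exists_of_detForm_eq_zero hne hm
    have hw : w = ι.diff x (c • (trivσ b).symmL ℂ x 1) := by
      rw [← Trivialization.symmL_continuousLinearMapAt (R := ℂ) (trivS (ι b)) hx.2 w, hc,
        map_smul, map_smul, tangentVec, Trivialization.symmL_continuousLinearMapAt _ hx.2]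
    exact (Submodule.Quotient.mk_eq_zero _).2 ⟨_, hw.symm⟩
  · intro c
    obtain ⟨u, hu⟩ := detForm_surjective hne c
    refine ⟨ι.normalMk x ((trivS (ι b)).symmL ℂ (ι x) u), ?_⟩
    rw [normalCoord_mk _ _ _ hx, Trivialization.continuousLinearMapAt_symmL _ hx.2, hu]

theorem isInducing_normalCoord (ι : HolEmbedding σ S) (b x : σ) (hx : x ∈ ι.normalBase b) :
    IsInducing (ι.normalCoord b x) := by
  have hbij := ι.normalCoord_bijective b x hx
  have hq : IsQuotientMap (ι.normalMk x) := isQuotientMap_quotient_mk'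
  have hcont : Continuous (ι.normalCoord b x) := by
    rw [hq.continuous_iff]
    have : ι.normalCoord b x ∘ ι.normalMk x = fun w =>
        detForm (ι.tangentVec b x) ((trivS (ι b)).continuousLinearMapAt ℂ (ι x) w) :=
      funext fun w => ι.normalCoord_mk b x hx w
    rw [this]
    exact (detForm (ι.tangentVec b x)).continuous.comp
      ((trivS (ι b)).continuousLinearMapAt ℂ (ι x)).continuous
  obtain ⟨m, hm⟩ := hbij.2 1
  obtain ⟨w, rfl⟩ := ι.normalMk_surjective x m
  have hinv : ∀ n, ι.normalMk x (ι.normalCoord b x n • w) = n := by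
    intro n
    apply hbij.1
    rw [map_smul, map_smul, hm, smul_eq_mul, mul_one]
  have hc : Continuous (fun c : ℂ => ι.normalMk x (c • w)) :=
    hq.continuous.comp (continuous_id.smul continuous_const)
  refine ⟨le_antisymm hcont.le_induced ?_⟩
  intro U hU
  refine ⟨(fun c : ℂ => ι.normalMk x (c • w)) ⁻¹' U, hU.preimage hc, ?_⟩
  ext n
  simp only [mem_preimage, hinv]

/-- The factor by which the coordinates of the normal bundle change. -/
def normalChange (ι : HolEmbedding σ S) (b b' x : σ) : ℂ :=
  det2 ((trivS (ι b)).coordChangeL ℂ (trivS (ι b')) (ι x) : ℂ × ℂ →L[ℂ] ℂ × ℂ) *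
    ((trivσ b').coordChangeL ℂ (trivσ b) x : ℂ →L[ℂ] ℂ) 1

theorem normalCoord_change (ι : HolEmbedding σ S) (b b' x : σ) (hx : x ∈ ι.normalBase b)
    (hx' : x ∈ ι.normalBase b') (m : ι.NormalSpace x) :
    ι.normalCoord b' x m = ι.normalChange b b' x * ι.normalCoord b x m := by
  obtain ⟨w, rfl⟩ := ι.normalMk_surjective x m
  rw [normalCoord_mk _ _ _ hx, normalCoord_mk _ _ _ hx']
  set A := ((trivS (ι b)).coordChangeL ℂ (trivS (ι b')) (ι x) : ℂ × ℂ →L[ℂ] ℂ × ℂ) with hA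
  set τ := ((trivσ b').coordChangeL ℂ (trivσ b) x : ℂ →L[ℂ] ℂ) 1 with hτ
  have hAw : ∀ w, (trivS (ι b')).continuousLinearMapAt ℂ (ι x) w =
      A ((trivS (ι b)).continuousLinearMapAt ℂ (ι x) w) := by
    intro w
    rw [hA, ContinuousLinearEquiv.coe_coe, Trivialization.coordChangeL_apply _ _ ⟨hx.2, hx'.2⟩,
      ← Trivialization.symmL_apply (R := ℂ) _ hx.2,
      Trivialization.symmL_continuousLinearMapAt _ hx.2,
      Trivialization.continuousLinearMapAt_apply_of_mem _ _ hx'.2]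
  have hτe : (trivσ b').symmL ℂ x 1 = τ • (trivσ b).symmL ℂ x 1 := by
    rw [← map_smul, smul_eq_mul, mul_one, hτ, ContinuousLinearEquiv.coe_coe,
      Trivialization.coordChangeL_apply _ _ ⟨hx'.1, hx.1⟩,
      ← Trivialization.symmL_apply (R := ℂ) _ hx'.1,
      ← Trivialization.continuousLinearMapAt_apply_of_mem ℂ _ hx.1,
      Trivialization.symmL_continuousLinearMapAt _ hx.1]
  have hv : ι.tangentVec b' x = τ • A (ι.tangentVec b x) := by
    rw [tangentVec, hτe, map_smul, map_smul, hAw]; rfl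
  rw [hv, hAw, detForm_smul_left, detForm_map, normalChange]
  ring

theorem contMDiffOn_normalChange (ι : HolEmbedding σ S) (b b' : σ) :
    ContMDiffOn 𝓘(ℂ, ℂ) 𝓘(ℂ, ℂ) ω (ι.normalChange b b')
      (ι.normalBase b ∩ ι.normalBase b') := by
  have hA : ContMDiffOn 𝓘(ℂ, ℂ) 𝓘(ℂ, ℂ × ℂ →L[ℂ] ℂ × ℂ) ω
      (fun x => ((trivS (ι b)).coordChangeL ℂ (trivS (ι b')) (ι x) : ℂ × ℂ →L[ℂ] ℂ × ℂ))
      (ι.normalBase b ∩ ι.normalBase b') :=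
    (contMDiffOn_coordChangeL (n := ω) (IB := 𝓘(ℂ, ℂ × ℂ)) (trivS (ι b)) (trivS (ι b'))).comp
      ι.isSmoothEmbedding.contMDiff.contMDiffOn (fun x hx => ⟨hx.1.2, hx.2.2⟩)
  have hτ : ContMDiffOn 𝓘(ℂ, ℂ) 𝓘(ℂ, ℂ →L[ℂ] ℂ) ω
      (fun x => ((trivσ b').coordChangeL ℂ (trivσ b) x : ℂ →L[ℂ] ℂ))
      (ι.normalBase b ∩ ι.normalBase b') :=
    (contMDiffOn_coordChangeL (n := ω) (IB := 𝓘(ℂ, ℂ)) (trivσ b') (trivσ b)).mono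
      (fun x hx => ⟨hx.2.1, hx.1.1⟩)
  have hdet : ContDiff ℂ ω det2 := by
    unfold det2
    simp only [detForm_apply]
    fun_prop
  have hev : ContDiff ℂ ω (fun L : ℂ →L[ℂ] ℂ => L 1) := by fun_prop
  exact (hdet.contMDiff.comp_contMDiffOn hA).mul (hev.contMDiff.comp_contMDiffOn hτ)

theorem isOpen_normalBase (ι : HolEmbedding σ S) (b : σ) : IsOpen (ι.normalBase b) :=
  (trivσ b).open_baseSet.inter
    ((trivS (ι b)).open_baseSet.preimage ι.isSmoothEmbedding.contMDiff.continuous)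

theorem mem_normalBase (ι : HolEmbedding σ S) (b : σ) : b ∈ ι.normalBase b :=
  ⟨mem_baseSet_trivializationAt ℂ (TangentSpace 𝓘(ℂ, ℂ) : σ → Type) b,
    mem_baseSet_trivializationAt (ℂ × ℂ) (TangentSpace 𝓘(ℂ, ℂ × ℂ) : S → Type) (ι b)⟩

/-- The local trivialisation of the normal bundle around `b`. -/
def normalTriv (ι : HolEmbedding σ S) (b : σ) :
    Pretrivialization ℂ (π ℂ ι.NormalSpace) where
  toFun z := (z.1, ι.normalCoord b z.1 z.2)
  invFun z := ⟨z.1, Function.invFun (ι.normalCoord b z.1) z.2⟩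
  source := π ℂ ι.NormalSpace ⁻¹' ι.normalBase b
  target := ι.normalBase b ×ˢ univ
  map_source' z hz := ⟨hz, mem_univ _⟩
  map_target' z hz := hz.1
  left_inv' := by
    rintro ⟨x, m⟩ hz
    simp only
    rw [Function.leftInverse_invFun (ι.normalCoord_bijective b x hz).1]
  right_inv' := by
    rintro ⟨x, c⟩ hz
    simp only
    rw [Function.rightInverse_invFun (ι.normalCoord_bijective b x hz.1).2]
  open_target := (ι.isOpen_normalBase b).prod isOpen_univ
  baseSet := ι.normalBase b
  open_baseSet := ι.isOpen_normalBase b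
  source_eq := rfl
  target_eq := rfl
  proj_toFun _ _ := rfl

theorem normalTriv_change (ι : HolEmbedding σ S) (b b' x : σ)
    (hx : x ∈ ι.normalBase b ∩ ι.normalBase b') (c : ℂ) :
    (ι.normalChange b b' x • ContinuousLinearMap.id ℂ ℂ) c =
      (ι.normalTriv b' ⟨x, (ι.normalTriv b).symm x c⟩).2 := by
  have h1 : (ι.normalTriv b ⟨x, (ι.normalTriv b).symm x c⟩).2 = c := by
    rw [Pretrivialization.apply_mk_symm _ hx.1]
  have h2 := ι.normalCoord_change b b' x hx.1 hx.2 ((ι.normalTriv b).symm x c)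
  change _ = ι.normalCoord b' x _
  rw [h2]
  change ι.normalCoord b x _ = c at h1
  rw [h1]
  simp

/-- The normal bundle, as a family of vector spaces with local trivialisations. -/
def normalPrebundle (ι : HolEmbedding σ S) : VectorPrebundle ℂ ℂ ι.NormalSpace where
  pretrivializationAtlas := range ι.normalTriv
  pretrivialization_linear' := by
    rintro _ ⟨b, rfl⟩
    exact ⟨fun x _ => (ι.normalCoord b x).isLinear⟩
  pretrivializationAt := ι.normalTriv
  mem_base_pretrivializationAt x := ι.mem_normalBase x
  pretrivialization_mem_atlas x := mem_range_self x
  exists_coordChange := by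
    rintro _ ⟨b, rfl⟩ _ ⟨b', rfl⟩
    exact ⟨fun x => ι.normalChange b b' x • ContinuousLinearMap.id ℂ ℂ,
      (ι.contMDiffOn_normalChange b b').continuousOn.smul continuousOn_const,
      fun x hx c => ι.normalTriv_change b b' x hx c⟩
  totalSpaceMk_isInducing b := by
    have h : IsInducing (ι.normalCoord b b) := ι.isInducing_normalCoord b b (ι.mem_normalBase b)
    exact (isInducing_prodMkRight b).comp h

instance (ι : HolEmbedding σ S) : ι.normalPrebundle.IsContMDiff 𝓘(ℂ, ℂ) ω := by
  refine ⟨?_⟩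
  rintro _ ⟨b, rfl⟩ _ ⟨b', rfl⟩
  exact ⟨fun x => ι.normalChange b b' x • ContinuousLinearMap.id ℂ ℂ,
    (ι.contMDiffOn_normalChange b b').smul contMDiffOn_const,
    fun x hx c => ι.normalTriv_change b b' x hx c⟩

instance (ι : HolEmbedding σ S) : TopologicalSpace (TotalSpace ℂ ι.NormalSpace) :=
  ι.normalPrebundle.totalSpaceTopology

instance (ι : HolEmbedding σ S) : FiberBundle ℂ ι.NormalSpace :=
  ι.normalPrebundle.toFiberBundle

instance (ι : HolEmbedding σ S) : VectorBundle ℂ ℂ ι.NormalSpace :=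
  ι.normalPrebundle.toVectorBundle

instance (ι : HolEmbedding σ S) : ContMDiffVectorBundle ω ℂ ι.NormalSpace 𝓘(ℂ, ℂ) :=
  ι.normalPrebundle.contMDiffVectorBundle 𝓘(ℂ, ℂ)

/-- The multiplication by a scalar in the fibres of the normal bundle. -/
def normalSMul (ι : HolEmbedding σ S) (c : ℂ) (z : TotalSpace ℂ ι.NormalSpace) :
    TotalSpace ℂ ι.NormalSpace :=
  ⟨z.1, c • z.2⟩

/-- The zero section of the normal bundle. -/
def normalZero (ι : HolEmbedding σ S) (x : σ) : TotalSpace ℂ ι.NormalSpace := ⟨x, 0⟩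

end HolEmbedding

/-! ### Foliations -/

/-- A (nonsingular, holomorphic, one-dimensional) foliation on the subset `U` of the complex surface
`S`, given by a foliated atlas: holomorphic charts `(x, y)` onto products of two discs, whose
domains cover `U`, and such that locally the coordinate `x` of a chart is a function of the
coordinate `x` of any other one. The plaques are the sets `x = const` in the charts. -/
structure HolFoliation (S : Type*) [TopologicalSpace S] [ChartedSpace (ℂ × ℂ) S]
    (U : Set S) where
  /-- the foliated charts -/
  charts : Set (OpenPartialHomeomorph S (ℂ × ℂ))
  mem_maximalAtlas : ∀ φ ∈ charts, φ ∈ IsManifold.maximalAtlas 𝓘(ℂ, ℂ × ℂ) ω S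
  target_eq : ∀ φ ∈ charts, ∃ (c c' : ℂ) (r r' : ℝ),
    φ.target = Metric.ball c r ×ˢ Metric.ball c' r'
  iUnion_source : ⋃ φ ∈ charts, φ.source = U
  compatible : ∀ φ ∈ charts, ∀ φ' ∈ charts, ∀ p ∈ φ.source ∩ φ'.source, ∃ V ∈ 𝓝 p,
    ∀ a ∈ V, ∀ b ∈ V, (φ a).1 = (φ b).1 → (φ' a).1 = (φ' b).1

namespace HolFoliation

variable {σ S : Type*} [TopologicalSpace σ] [ChartedSpace ℂ σ]
  [TopologicalSpace S] [ChartedSpace (ℂ × ℂ) S] {U : Set S}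

/-- Two points lie on a common plaque. -/
def SamePlaque (F : HolFoliation S U) (a b : S) : Prop :=
  ∃ φ ∈ F.charts, a ∈ φ.source ∧ b ∈ φ.source ∧ (φ a).1 = (φ b).1

/-- The leaf through `a`: the points which a chain of plaques joins to `a`. -/
def leaf (F : HolFoliation S U) (a : S) : Set S :=
  {b | Relation.ReflTransGen F.SamePlaque a b}

/-- The foliation is transverse to the embedded Riemann surface: the derivative of the coordinate
`x` of the foliated charts does not vanish on the tangent lines of the Riemann surface. -/
def IsTransverse (F : HolFoliation S U) (ι : HolEmbedding σ S) : Prop :=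
  ∀ φ ∈ F.charts, ∀ p : σ, ι p ∈ φ.source →
    mfderiv 𝓘(ℂ, ℂ) 𝓘(ℂ, ℂ) (fun z => (φ (ι z)).1) p ≠ 0

end HolFoliation

/-! ### Transverse actions

The multiplicative pseudo-group `(ℂ, 𝔻) - {0}` is the germ along the closed unit disc of `ℂ`, with
`0` removed; it is represented by the punctured discs `0 < |t| < R` with `R > 1`. The germ `(S, σ)`
is represented by the open neighbourhoods `U` of `σ` in `S`. -/

/-- The representative `0 < |t| < R` of the pseudo-group `(ℂ, 𝔻) - {0}`. -/
def puncturedDisc (R : ℝ) : Set ℂ := {t | t ≠ 0 ∧ ‖t‖ < R}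

section Action

variable {σ S : Type*} [TopologicalSpace σ] [ChartedSpace ℂ σ]
  [TopologicalSpace S] [ChartedSpace (ℂ × ℂ) S]

/-- The map `ψ`, restricted to `0 < |t| < R` and `a ∈ U`, is a holomorphic action of the
pseudo-group, which fixes `σ` pointwise and is transverse to `σ`. The values of `ψ` outside of this
set play no role. -/
structure IsTransverseActionOn (ι : HolEmbedding σ S) (ψ : ℂ → S → S) (R : ℝ) (U : Set S) :
    Prop where
  one_lt : 1 < R
  isOpen : IsOpen U
  range_subset : range ι ⊆ U
  holomorphic : ContMDiffOn (𝓘(ℂ, ℂ).prod 𝓘(ℂ, ℂ × ℂ)) 𝓘(ℂ, ℂ × ℂ) ω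
    (fun z : ℂ × S => ψ z.1 z.2) (puncturedDisc R ×ˢ U)
  map_one : ∀ a ∈ U, ψ 1 a = a
  map_mul : ∀ s ∈ puncturedDisc R, ∀ t ∈ puncturedDisc R, s * t ∈ puncturedDisc R →
    ∀ a ∈ U, ψ t a ∈ U → ψ (s * t) a = ψ s (ψ t a)
  map_fixed : ∀ t ∈ puncturedDisc R, ∀ p : σ, ψ t (ι p) = ι p
  exists_foliation : ∃ F : HolFoliation S U, F.IsTransverse ι ∧
    ∀ b ∈ U, ∃ a ∈ U \ range ι,
      F.leaf b = closure {c | ∃ t ∈ puncturedDisc R, c = ψ t a} ∩ U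

/-- `ψ` represents a transverse action of the pseudo-group `(ℂ, 𝔻) - {0}` on the germ `(S, σ)`. -/
def IsTransverseAction (ι : HolEmbedding σ S) (ψ : ℂ → S → S) : Prop :=
  ∃ (R : ℝ) (U : Set S), IsTransverseActionOn ι ψ R U

end Action

end

/-! ### Leaves of a foliation have countably many plaques in each chart -/

/-! Near `σ` the action is a circle action together with an attraction towards `σ`, and the action
of a compact group is linearized by averaging.

A leaf is the closure in `U` of an orbit, so times of modulus at most one move its points inside the
leaf as long as they stay in `U` (`mem_leaf`). A leaf has only countably many plaques in a foliated
chart (`countable_image_leaf`), and a continuous map from the circle to a countable metric set is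
constant. Hence the circle preserves the transverse coordinate of the foliated charts
(`exists_transverse_coord`). Transversality turns this coordinate into a local invariant projection
`X` to `σ` (`exists_retraction`), which a coordinate `Y` modelled on the normal bundle completes to
a chart (`exists_adapted_chart`).

On the fibres of `X` the circle acts with a fixed point, where the derivative is a character `t ^
q`. The average of `t ^ (-q) * Y (ψ t a)` is a new fibre coordinate in which the circle acts by `t ^
q` (`exists_linearizer`). The identity theorem extends this to an annulus (`exists_annulus_linear`),
and iteration extends it to `0 < |t| ≤ 1` once `q > 0` is known (`exists_isLinearChart`). For the
sign, some point off `σ` is attracted to `ι p` along times tending to `0` (`exists_tendsto`); with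
`q ≤ 0` the linear form of the action would put that point on `σ` (`exponent_pos`).

The local linearizations glue because they compute an intrinsic object: the leading term of the
orbit as `t → 0`, that is, the class of the limit of `t ^ (-q) * (ψ t a - ι x)` in the normal space
at the limit point `ι x` (`IsLeadingTerm`). By the mean value property the averaged coordinate is
exactly the coordinate of this normal vector (`exists_isLeadingTerm`). Therefore `q` is locally
constant, hence constant on the connected `σ` (`exists_order`), and sending `a` to its leading term
defines `h`. It is equivariant by construction, it is a linear chart when read in the charts of the
normal bundle, and it is injective because orbits with the same leading term coincide for small `t`.
-/

theorem Set.countable_image_of_locally_constant {X Y : Type*} [TopologicalSpace X]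
    [SecondCountableTopology X] {s : Set X} {g : X → Y}
    (h : ∀ p ∈ s, ∀ᶠ q in 𝓝[s] p, g q = g p) : (g '' s).Countable := by
  obtain ⟨t, -, ht, hst⟩ := TopologicalSpace.countable_cover_nhdsWithin
    (f := fun p => {q | g q = g p}) (s := s) h
  refine (ht.image g).mono ?_
  rintro _ ⟨q, hq, rfl⟩
  obtain ⟨p, hp, hqp⟩ := mem_iUnion₂.1 (hst hq)
  exact ⟨p, hp, (hqp : g q = g p).symm⟩

theorem IsPreconnected.eqOn_of_countable_image {X Y : Type*} [TopologicalSpace X] [MetricSpace Y]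
    {s : Set X} (hs : IsPreconnected s) {g : X → Y} (hg : ContinuousOn g s)
    (hc : (g '' s).Countable) {x y : X} (hx : x ∈ s) (hy : y ∈ s) : g x = g y :=
  hc.isTotallyDisconnected _ subset_rfl (hs.image g hg) (mem_image_of_mem g hx)
    (mem_image_of_mem g hy)

namespace HolFoliation

variable {S : Type*} [TopologicalSpace S] [ChartedSpace (ℂ × ℂ) S] {U : Set S}

/-- The points of a foliated chart with a given value of the transverse coordinate. -/
def plaque (φ : OpenPartialHomeomorph S (ℂ × ℂ)) (c : ℂ) : Set S :=
  {p | p ∈ φ.source ∧ (φ p).1 = c}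

theorem isPreconnected_plaque (F : HolFoliation S U) {φ : OpenPartialHomeomorph S (ℂ × ℂ)}
    (hφ : φ ∈ F.charts) (c : ℂ) : IsPreconnected (plaque φ c) := by
  obtain ⟨c₁, c₂, r₁, r₂, ht⟩ := F.target_eq φ hφ
  by_cases hc : c ∈ Metric.ball c₁ r₁
  · have h : plaque φ c = φ.symm '' ({c} ×ˢ Metric.ball c₂ r₂) := by
      ext p
      constructor
      · rintro ⟨hp, hpc⟩
        refine ⟨φ p, ⟨hpc, ?_⟩, φ.left_inv hp⟩
        have := φ.map_source hp
        rw [ht] at this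
        exact this.2
      · rintro ⟨w, ⟨hw1, hw2⟩, rfl⟩
        have hw : w ∈ φ.target := by
          rw [ht]; exact ⟨by rw [hw1]; exact hc, hw2⟩
        exact ⟨φ.map_target hw, by rw [φ.right_inv hw]; exact hw1⟩
    rw [h]
    refine (isPreconnected_singleton.prod
      (convex_ball c₂ r₂).isPreconnected).image _ (φ.continuousOn_symm.mono ?_)
    rintro w ⟨hw1, hw2⟩
    rw [ht]
    exact ⟨by rw [hw1]; exact hc, hw2⟩
  · have : plaque φ c = ∅ := by
      ext p
      simp only [plaque, mem_ofPred_eq, mem_empty_iff_false, iff_false, not_and]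
      rintro hp rfl
      have := φ.map_source hp
      rw [ht] at this
      exact hc this.1
    rw [this]
    exact isPreconnected_empty

/-- Along a plaque of `φ` the transverse coordinate of `φ'` is locally constant by compatibility.
The intersection with the domain of `φ'` may have many components, so only countability survives, by
the Lindelöf property. -/
theorem countable_image_plaque [SecondCountableTopology S] (F : HolFoliation S U)
    {φ φ' : OpenPartialHomeomorph S (ℂ × ℂ)} (hφ : φ ∈ F.charts) (hφ' : φ' ∈ F.charts) (c : ℂ) :
    ((fun p => (φ' p).1) '' (plaque φ c ∩ φ'.source)).Countable := by
  refine Set.countable_image_of_locally_constant fun p hp => ?_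
  obtain ⟨V, hV, h⟩ := F.compatible φ hφ φ' hφ' p ⟨hp.1.1, hp.2⟩
  filter_upwards [mem_nhdsWithin_of_mem_nhds hV, self_mem_nhdsWithin] with q hq hq'
  exact h q hq p (mem_of_mem_nhds hV) (hq'.1.2.trans hp.1.2.symm)

/-- The union of the plaques, in the charts of `C`, which meet `L`. -/
def plaqueStep (C : Set (OpenPartialHomeomorph S (ℂ × ℂ))) (L : Set S) : Set S :=
  {b | ∃ φ ∈ C, ∃ a ∈ L, a ∈ φ.source ∧ b ∈ φ.source ∧ (φ a).1 = (φ b).1}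

theorem countable_image_plaqueStep [SecondCountableTopology S] (F : HolFoliation S U)
    {C : Set (OpenPartialHomeomorph S (ℂ × ℂ))} (hC : C ⊆ F.charts) (hCc : C.Countable)
    {L : Set S} (hL : ∀ φ ∈ F.charts, ((fun p => (φ p).1) '' (L ∩ φ.source)).Countable)
    {φ : OpenPartialHomeomorph S (ℂ × ℂ)} (hφ : φ ∈ F.charts) :
    ((fun p => (φ p).1) '' (plaqueStep C L ∩ φ.source)).Countable := by
  have h : ((fun p => (φ p).1) '' (plaqueStep C L ∩ φ.source)) ⊆
      ⋃ φ' ∈ C, ⋃ c ∈ (fun p => (φ' p).1) '' (L ∩ φ'.source),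
        (fun p => (φ p).1) '' (plaque φ' c ∩ φ.source) := by
    rintro _ ⟨b, ⟨⟨φ', hφ', a, ha, has, hbs, hab⟩, hb⟩, rfl⟩
    simp only [mem_iUnion]
    exact ⟨φ', hφ', (φ' a).1, ⟨a, ⟨ha, has⟩, rfl⟩, b, ⟨⟨hbs, hab.symm⟩, hb⟩, rfl⟩
  refine Countable.mono h (hCc.biUnion fun φ' hφ' => ?_)
  exact (hL φ' (hC hφ')).biUnion fun c _ => F.countable_image_plaque (hC hφ') hφ c

/-- Countably many charts cover `U`, and chains of plaques taken from these charts already reach the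
whole leaf; each further plaque adds only countably many values. -/
theorem countable_image_leaf [SecondCountableTopology S] (F : HolFoliation S U) (a : S)
    {φ : OpenPartialHomeomorph S (ℂ × ℂ)} (hφ : φ ∈ F.charts) :
    ((fun p => (φ p).1) '' (F.leaf a ∩ φ.source)).Countable := by
  obtain ⟨C, hC, hCc, hCU⟩ := TopologicalSpace.isOpen_biUnion_countable F.charts
    (fun φ : OpenPartialHomeomorph S (ℂ × ℂ) => φ.source) (fun φ _ => φ.open_source)
  rw [F.iUnion_source] at hCU
  let L : ℕ → Set S := fun n => (plaqueStep C)^[n] {a}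
  have hstep : ∀ n, L (n + 1) = plaqueStep C (L n) := fun n =>
    Function.iterate_succ_apply' _ _ _
  have hL : ∀ n, ∀ φ ∈ F.charts, ((fun p => (φ p).1) '' (L n ∩ φ.source)).Countable := by
    intro n
    induction n with
    | zero =>
      intro φ _
      exact ((countable_singleton a).mono inter_subset_left).image _
    | succ n ih =>
      intro φ hφ
      rw [hstep]
      exact F.countable_image_plaqueStep hC hCc ih hφ
  have hchain : ∀ φ ∈ C, ∀ p q, p ∈ φ.source → q ∈ φ.source → (φ p).1 = (φ q).1 →
      p ∈ ⋃ n, L n → q ∈ ⋃ n, L n := by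
    intro φ hφ p q hp hq hpq hpL
    obtain ⟨n, hn⟩ := mem_iUnion.1 hpL
    refine mem_iUnion.2 ⟨n + 1, ?_⟩
    rw [hstep]
    exact ⟨φ, hφ, p, hn, hp, hq, hpq⟩
  -- A plaque of an arbitrary chart need not lie in a chart of `C`. Near each of its points it lies
  -- in one plaque of a chart of `C`, so membership in the union of the `L n` is locally constant on
  -- it, and the plaque is connected.
  have hsame : ∀ p q, F.SamePlaque p q → p ∈ ⋃ n, L n → q ∈ ⋃ n, L n := by
    rintro p q ⟨φ, hφ, hp, hq, hpq⟩
    refine (F.isPreconnected_plaque hφ (φ p).1).induction₂'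
      (fun x y => x ∈ ⋃ n, L n → y ∈ ⋃ n, L n) ?_ (fun x y z _ _ _ h1 h2 h => h2 (h1 h))
      ⟨hp, rfl⟩ ⟨hq, hpq.symm⟩
    rintro x ⟨hx, hxp⟩
    have hxU : x ∈ ⋃ φ ∈ C, φ.source := by
      rw [hCU, ← F.iUnion_source]
      exact mem_iUnion₂.2 ⟨φ, hφ, hx⟩
    obtain ⟨φ', hφ', hx'⟩ := mem_iUnion₂.1 hxU
    obtain ⟨V, hV, h⟩ := F.compatible φ hφ φ' (hC hφ') x ⟨hx, hx'⟩
    filter_upwards [mem_nhdsWithin_of_mem_nhds hV, self_mem_nhdsWithin,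
      mem_nhdsWithin_of_mem_nhds (φ'.open_source.mem_nhds hx')] with y hyV hy hy'
    have hxy := h x (mem_of_mem_nhds hV) y hyV (hxp.trans hy.2.symm)
    exact ⟨hchain φ' hφ' x y hx' hy' hxy, hchain φ' hφ' y x hy' hx' hxy.symm⟩
  have hleaf : F.leaf a ⊆ ⋃ n, L n := by
    intro b hb
    change Relation.ReflTransGen F.SamePlaque a b at hb
    induction hb with
    | refl => exact mem_iUnion.2 ⟨0, rfl⟩
    | tail _ h ih => exact hsame _ _ h ih
  refine (countable_iUnion fun n => hL n φ hφ).mono ?_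
  rw [← image_iUnion, ← iUnion_inter]
  exact image_mono (inter_subset_inter_left _ hleaf)

end HolFoliation

/-! ### The identity theorem for curves in a complex surface -/

section Identity

variable {S : Type*} [TopologicalSpace S] [ChartedSpace (ℂ × ℂ) S]

theorem analyticAt_chart_comp_curve {f : ℂ → S} {z : ℂ} {c : OpenPartialHomeomorph S (ℂ × ℂ)}
    (hc : c ∈ IsManifold.maximalAtlas 𝓘(ℂ, ℂ × ℂ) ω S)
    (hf : ∀ᶠ w in 𝓝 z, MDifferentiableAt 𝓘(ℂ, ℂ) 𝓘(ℂ, ℂ × ℂ) f w) (hz : f z ∈ c.source) :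
    AnalyticAt ℂ (fun w => c (f w)) z := by
  have h : ∀ᶠ w in 𝓝 z, DifferentiableAt ℂ (fun w => c (f w)) w := by
    filter_upwards [hf, hf.self_of_nhds.continuousAt (c.open_source.mem_nhds hz)] with w hw hw'
    have h1 : MDifferentiableAt 𝓘(ℂ, ℂ × ℂ) 𝓘(ℂ, ℂ × ℂ) c (f w) :=
      mdifferentiableAt_of_mem_maximalAtlas
        (IsManifold.maximalAtlas_subset_of_le (by simp) hc) hw'
    exact (h1.comp w hw).differentiableAt
  exact Complex.analyticAt_iff_eventually_differentiableAt.2 h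

/-- The set of points where the germs of `f` and `g` agree is open and closed in `D`. At a point
where the values agree but the germs do not, analyticity in a chart isolates the coincidence; where
the values differ, the Hausdorff property separates them nearby. -/
theorem eqOn_of_eventuallyEq_curve [T2Space S] [IsManifold 𝓘(ℂ, ℂ × ℂ) ω S] {f g : ℂ → S} {D : Set ℂ} (hD : IsOpen D)
    (hD' : IsPreconnected D)
    (hf : ∀ z ∈ D, MDifferentiableAt 𝓘(ℂ, ℂ) 𝓘(ℂ, ℂ × ℂ) f z)
    (hg : ∀ z ∈ D, MDifferentiableAt 𝓘(ℂ, ℂ) 𝓘(ℂ, ℂ × ℂ) g z) {z : ℂ} (hz : z ∈ D)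
    (hfg : f =ᶠ[𝓝 z] g) : EqOn f g D := by
  intro w hw
  refine Eventually.self_of_nhds (x := w) (p := fun y => f y = g y) ?_
  refine hD'.induction₂' (fun x y => f =ᶠ[𝓝 x] g → f =ᶠ[𝓝 y] g) ?_
    (fun x y z _ _ _ h1 h2 h => h2 (h1 h)) hz hw hfg
  intro x hx
  by_cases hfgx : f =ᶠ[𝓝 x] g
  · filter_upwards [mem_nhdsWithin_of_mem_nhds hfgx.eventuallyEq_nhds] with y hy
    exact ⟨fun _ => hy, fun _ => hfgx⟩
  suffices h : ∀ᶠ y in 𝓝 x, ¬ f =ᶠ[𝓝 y] g by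
    filter_upwards [mem_nhdsWithin_of_mem_nhds h] with y hy
    exact ⟨fun h => absurd h hfgx, fun h => absurd h hy⟩
  by_cases hx' : f x = g x
  · have hDx := hD.mem_nhds hx
    have hmem := mem_chart_source (ℂ × ℂ) (f x)
    have hmem' : g x ∈ (chartAt (ℂ × ℂ) (f x)).source := by rw [← hx']; exact hmem
    have hfa := analyticAt_chart_comp_curve (c := chartAt (ℂ × ℂ) (f x))
      (IsManifold.chart_mem_maximalAtlas _) (by filter_upwards [hDx] with y hy using hf y hy) hmem
    have hga := analyticAt_chart_comp_curve (c := chartAt (ℂ × ℂ) (f x))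
      (IsManifold.chart_mem_maximalAtlas _) (by filter_upwards [hDx] with y hy using hg y hy)
      hmem'
    rcases hfa.eventually_eq_or_eventually_ne hga with h | h
    · refine absurd ?_ hfgx
      filter_upwards [h, (hf x hx).continuousAt ((chartAt (ℂ × ℂ) (f x)).open_source.mem_nhds hmem),
        (hg x hx).continuousAt ((chartAt (ℂ × ℂ) (f x)).open_source.mem_nhds hmem')]
        with y hy h1 h2
      exact (chartAt (ℂ × ℂ) (f x)).injOn h1 h2 hy
    · rw [eventually_nhdsWithin_iff] at h
      filter_upwards [h] with y hy
      by_cases hyx : y = x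
      · rwa [hyx]
      · exact fun h' => hy hyx (by rw [h'.self_of_nhds])
  · have := ((hf x hx).continuousAt.prodMk (hg x hx).continuousAt).eventually
      (isClosed_diagonal.isOpen_compl.mem_nhds hx')
    filter_upwards [this] with y hy h
    exact hy h.self_of_nhds

end Identity

/-! ### The pseudo-group -/

theorem isOpen_puncturedDisc (R : ℝ) : IsOpen (puncturedDisc R) :=
  isOpen_ne.inter (isOpen_lt continuous_norm continuous_const)

theorem isPreconnected_puncturedDisc (R : ℝ) : IsPreconnected (puncturedDisc R) := by
  by_cases hR : 0 < R
  · have h : puncturedDisc R = Complex.exp '' {z | z.re < Real.log R} := by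
      ext t
      constructor
      · rintro ⟨h0, ht⟩
        refine ⟨Complex.log t, ?_, Complex.exp_log h0⟩
        rw [mem_ofPred_eq, Complex.log_re]
        exact Real.log_lt_log (norm_pos_iff.2 h0) ht
      · rintro ⟨z, hz, rfl⟩
        refine ⟨Complex.exp_ne_zero z, ?_⟩
        rw [Complex.norm_exp]
        exact (Real.lt_log_iff_exp_lt hR).1 hz
    rw [h]
    exact (convex_halfSpace_re_lt _).isPreconnected.image _ Complex.continuous_exp.continuousOn
  · have h : puncturedDisc R = ∅ := by
      ext t
      simp only [puncturedDisc, mem_ofPred_eq, mem_empty_iff_false, iff_false, not_and, not_lt]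
      exact fun _ => (not_lt.1 hR).trans (norm_nonneg _)
    rw [h]
    exact isPreconnected_empty

/-! ### Attraction to the Riemann surface and invariance of the leaves under the circle -/

namespace IsTransverseActionOn

variable {σ S : Type*} [TopologicalSpace σ] [ChartedSpace ℂ σ]
  [TopologicalSpace S] [ChartedSpace (ℂ × ℂ) S]
  {ι : HolEmbedding σ S} {ψ : ℂ → S → S} {R : ℝ} {U : Set S}

theorem mem_of_norm_le_one (hψ : IsTransverseActionOn ι ψ R U) {t : ℂ} (h0 : t ≠ 0)
    (ht : ‖t‖ ≤ 1) : t ∈ puncturedDisc R := ⟨h0, ht.trans_lt hψ.one_lt⟩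

theorem mem_mul {s t : ℂ} (hs0 : s ≠ 0) (hs : ‖s‖ ≤ 1) (ht : t ∈ puncturedDisc R) :
    s * t ∈ puncturedDisc R := by
  refine ⟨mul_ne_zero hs0 ht.1, ?_⟩
  rw [norm_mul]
  exact (mul_le_of_le_one_left (norm_nonneg _) hs).trans_lt ht.2

theorem mem_nhds (hψ : IsTransverseActionOn ι ψ R U) (p : σ) : U ∈ 𝓝 (ι p) :=
  hψ.isOpen.mem_nhds (hψ.range_subset (mem_range_self p))

theorem contMDiffAt (hψ : IsTransverseActionOn ι ψ R U) {t : ℂ} {a : S}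
    (ht : t ∈ puncturedDisc R) (ha : a ∈ U) :
    ContMDiffAt (𝓘(ℂ, ℂ).prod 𝓘(ℂ, ℂ × ℂ)) 𝓘(ℂ, ℂ × ℂ) ω (fun z : ℂ × S => ψ z.1 z.2) (t, a) :=
  hψ.holomorphic.contMDiffAt (((isOpen_puncturedDisc R).prod hψ.isOpen).mem_nhds ⟨ht, ha⟩)

theorem continuousAt (hψ : IsTransverseActionOn ι ψ R U) {t : ℂ} {a : S}
    (ht : t ∈ puncturedDisc R) (ha : a ∈ U) :
    ContinuousAt (fun z : ℂ × S => ψ z.1 z.2) (t, a) := (hψ.contMDiffAt ht ha).continuousAt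

theorem mdifferentiableAt_orbit (hψ : IsTransverseActionOn ι ψ R U) {t : ℂ} {a : S}
    (ht : t ∈ puncturedDisc R) (ha : a ∈ U) :
    MDifferentiableAt 𝓘(ℂ, ℂ) 𝓘(ℂ, ℂ × ℂ) (fun t => ψ t a) t := by
  have h1 := (hψ.contMDiffAt ht ha).mdifferentiableAt (by simp)
  have h2 : MDifferentiableAt 𝓘(ℂ, ℂ) (𝓘(ℂ, ℂ).prod 𝓘(ℂ, ℂ × ℂ)) (fun t : ℂ => (t, a)) t :=
    mdifferentiableAt_id.prodMk mdifferentiableAt_const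
  exact h1.comp t h2

/-- Every time in `K` fixes `ι p`, so continuity and compactness of `K` give one neighbourhood that
serves all these times. -/
theorem eventually_forall_mem (hψ : IsTransverseActionOn ι ψ R U) {K : Set ℂ} (hK : IsCompact K)
    (hKR : K ⊆ puncturedDisc R) {p : σ} {V : Set S} (hV : V ∈ 𝓝 (ι p)) :
    ∀ᶠ a in 𝓝 (ι p), ∀ t ∈ K, ψ t a ∈ V := by
  refine hK.eventually_forall_of_forall_eventually fun t ht => ?_
  have h := (hψ.continuousAt (hKR ht) (hψ.range_subset (mem_range_self p))).comp
    (x := (ι p, t)) (f := Prod.swap) continuous_swap.continuousAt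
  have h' : Tendsto (fun z : S × ℂ => ψ z.2 z.1) (𝓝 (ι p, t)) (𝓝 (ι p)) := by
    have := h.tendsto
    simpa only [Function.comp_def, Prod.swap, hψ.map_fixed t (hKR ht) p] using this
  exact h'.eventually hV

/-- The identity theorem carries the coincidence over the connected punctured disc to the time `1`,
where the orbits are at `a` and `b`. -/
theorem eq_of_eventuallyEq [T2Space S] [IsManifold 𝓘(ℂ, ℂ × ℂ) ω S]
    (hψ : IsTransverseActionOn ι ψ R U) {a b : S} (ha : a ∈ U) (hb : b ∈ U) {t : ℂ}
    (ht : t ∈ puncturedDisc R) (h : ∀ᶠ s in 𝓝 t, ψ s a = ψ s b) : a = b := by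
  have := eqOn_of_eventuallyEq_curve (isOpen_puncturedDisc R) (isPreconnected_puncturedDisc R)
    (fun z hz => hψ.mdifferentiableAt_orbit hz ha) (fun z hz => hψ.mdifferentiableAt_orbit hz hb)
    ht h (hψ.mem_of_norm_le_one one_ne_zero norm_one.le)
  simpa only [hψ.map_one a ha, hψ.map_one b hb] using this

/-- Some point off the Riemann surface is attracted to `ι p` along a filter tending to `0`. -/
theorem exists_tendsto [T2Space S] [IsManifold 𝓘(ℂ, ℂ × ℂ) ω S]
    (hψ : IsTransverseActionOn ι ψ R U) (p : σ) :
    ∃ a ∈ U \ range ι, ∃ u : Ultrafilter ℂ, ↑u ≤ 𝓝[≠] (0 : ℂ) ∧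
      Tendsto (fun t => ψ t a) u (𝓝 (ι p)) := by
  obtain ⟨F, -, hF⟩ := hψ.exists_foliation
  have hpU : ι p ∈ U := hψ.range_subset (mem_range_self p)
  obtain ⟨a, ha, hleaf⟩ := hF (ι p) hpU
  have hmem : ι p ∈ closure {c | ∃ t ∈ puncturedDisc R, c = ψ t a} ∩ U := by
    rw [← hleaf]; exact Relation.ReflTransGen.refl
  have him : {c | ∃ t ∈ puncturedDisc R, c = ψ t a} = (fun t => ψ t a) '' puncturedDisc R := by
    ext c; simp only [mem_ofPred_eq, mem_image, eq_comm]
  have hcl : MapClusterPt (ι p) (𝓟 (puncturedDisc R)) (fun t => ψ t a) := by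
    have := mem_closure_iff_clusterPt.1 hmem.1
    rwa [him, ← map_principal] at this
  obtain ⟨u, hu, hut⟩ := mapClusterPt_iff_ultrafilter.1 hcl
  have huR : puncturedDisc R ∈ u := le_principal_iff.1 hu
  have hne : ∀ᶠ t in (u : Filter ℂ), t ∈ puncturedDisc R := huR
  refine ⟨a, ha, u, ?_, hut⟩
  -- The times at which the orbit approaches `ι p` converge to some `τ` along the ultrafilter. The
  -- claim is that `τ = 0`.
  obtain ⟨τ, -, hτ⟩ := (isCompact_closedBall (0 : ℂ) R).ultrafilter_le_nhds u
    (le_principal_iff.2 (mem_of_superset huR fun t ht => by simpa using ht.2.le))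
  by_cases hτ0 : τ = 0
  · subst hτ0
    exact le_inf hτ (le_principal_iff.2 (mem_of_superset huR fun t ht => ht.1))
  exfalso
  -- If `τ ≠ 0`, then `ψ t a = ψ (t / s) (ψ s a)` tends to `ψ (t / τ) (ι p) = ι p` as `s` tends to
  -- `τ`; the bound `|t| < |τ|` keeps `t / τ` in the punctured disc. The orbit is then constant for
  -- small `t`, which forces `a = ι p`.
  have hconst : ∀ t : ℂ, t ≠ 0 → ‖t‖ < ‖τ‖ → ‖t‖ < R → ψ t a = ι p := by
    intro t h0 ht htR
    have hq : ‖t / τ‖ < 1 := by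
      rw [norm_div]; exact (div_lt_one (norm_pos_iff.2 hτ0)).2 ht
    have hs : t / τ ∈ puncturedDisc R :=
      hψ.mem_of_norm_le_one (div_ne_zero h0 hτ0) hq.le
    have hlim : Tendsto (fun s => t / s) u (𝓝 (t / τ)) :=
      (tendsto_const_nhds.div tendsto_id hτ0).mono_left hτ
    have h1 : Tendsto (fun s => ψ (t / s) (ψ s a)) u (𝓝 (ψ (t / τ) (ι p))) :=
      (hψ.continuousAt hs hpU).tendsto.comp (hlim.prodMk_nhds hut)
    rw [hψ.map_fixed _ hs] at h1
    have h2 : (fun s => ψ (t / s) (ψ s a)) =ᶠ[u] fun _ => ψ t a := by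
      filter_upwards [hne, hut.eventually (hψ.mem_nhds p),
        hlim.eventually ((isOpen_puncturedDisc R).mem_nhds hs)] with s hs hsU hts
      have hst : t / s * s = t := div_mul_cancel₀ _ hs.1
      rw [← hψ.map_mul (t / s) hts s hs (by rw [hst]; exact ⟨h0, htR⟩) a ha.1 hsU, hst]
    exact tendsto_nhds_unique (tendsto_const_nhds.congr' h2.symm) h1
  have hτR : 0 < min ‖τ‖ R :=
    lt_min (norm_pos_iff.2 hτ0) (zero_lt_one.trans hψ.one_lt)
  set t₀ : ℂ := ((min ‖τ‖ R / 2 : ℝ) : ℂ) with ht₀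
  have hnt₀ : ‖t₀‖ = min ‖τ‖ R / 2 := by
    rw [ht₀, Complex.norm_real, Real.norm_of_nonneg (by positivity)]
  have ht₀0 : t₀ ≠ 0 := by
    rw [← norm_pos_iff, hnt₀]; positivity
  have hlt : ‖t₀‖ < min ‖τ‖ R := by rw [hnt₀]; linarith
  have ht₀R : t₀ ∈ puncturedDisc R := ⟨ht₀0, hlt.trans_le (min_le_right _ _)⟩
  refine ha.2 ⟨p, (hψ.eq_of_eventuallyEq ha.1 hpU ht₀R ?_).symm⟩
  have hev : ∀ᶠ s : ℂ in 𝓝 t₀, s ≠ 0 ∧ ‖s‖ < min ‖τ‖ R :=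
    (isOpen_puncturedDisc (min ‖τ‖ R)).mem_nhds ⟨ht₀0, hlt⟩
  filter_upwards [hev] with s hs
  rw [hconst s hs.1 (hs.2.trans_le (min_le_left _ _)) (hs.2.trans_le (min_le_right _ _)),
    hψ.map_fixed s ⟨hs.1, hs.2.trans_le (min_le_right _ _)⟩]

/-- The circle maps a point to points of its leaf. -/
theorem mem_leaf (hψ : IsTransverseActionOn ι ψ R U) {F : HolFoliation S U}
    (hF : ∀ b ∈ U, ∃ a ∈ U \ range ι,
      F.leaf b = closure {c | ∃ t ∈ puncturedDisc R, c = ψ t a} ∩ U)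
    {b : S} (hb : b ∈ U) {s : ℂ} (hs0 : s ≠ 0) (hs : ‖s‖ ≤ 1) (hsb : ψ s b ∈ U) :
    ψ s b ∈ F.leaf b := by
  obtain ⟨a, ha, hleaf⟩ := hF b hb
  have hmem : b ∈ closure {c | ∃ t ∈ puncturedDisc R, c = ψ t a} ∩ U := by
    rw [← hleaf]; exact Relation.ReflTransGen.refl
  rw [hleaf]
  refine ⟨?_, hsb⟩
  have hsR := hψ.mem_of_norm_le_one hs0 hs
  have hc : ContinuousAt (ψ s) b :=
    (hψ.continuousAt hsR hb).comp (f := fun c => (s, c)) (by fun_prop)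
  rw [mem_closure_iff_frequently]
  -- Orbit points accumulating at `b` are moved by `ψ s` to orbit points accumulating at `ψ s b`.
  refine (hc.tendsto.frequently (p := fun c => c ∈ {c | ∃ t ∈ puncturedDisc R, c = ψ t a}) ?_)
  refine ((mem_closure_iff_frequently.1 hmem.1).and_eventually (hψ.isOpen.mem_nhds hb)).mono ?_
  rintro _ ⟨⟨t, ht, rfl⟩, hU⟩
  exact ⟨s * t, mem_mul hs0 hs ht, (hψ.map_mul s hsR t ht (mem_mul hs0 hs ht) a ha.1 hU).symm⟩

/-- Near a point of the Riemann surface there is a submersion, transverse to the Riemann surface,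
which the circle preserves. -/
theorem exists_transverse_coord [SecondCountableTopology S] (hψ : IsTransverseActionOn ι ψ R U)
    (p : σ) :
    ∃ φ ∈ IsManifold.maximalAtlas 𝓘(ℂ, ℂ × ℂ) ω S, ι p ∈ φ.source ∧
      mfderiv 𝓘(ℂ, ℂ) 𝓘(ℂ, ℂ) (fun z => (φ (ι z)).1) p ≠ 0 ∧
      ∀ᶠ a in 𝓝 (ι p), ∀ t : ℂ, ‖t‖ = 1 → (φ (ψ t a)).1 = (φ a).1 := by
  obtain ⟨F, hFt, hF⟩ := hψ.exists_foliation
  have hpU : ι p ∈ U := hψ.range_subset (mem_range_self p)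
  have hp := hpU
  rw [← F.iUnion_source] at hp
  obtain ⟨φ, hφ, hpφ⟩ := mem_iUnion₂.1 hp
  refine ⟨φ, F.mem_maximalAtlas φ hφ, hpφ, hFt φ hφ p hpφ, ?_⟩
  have hK : IsCompact (Metric.sphere (0 : ℂ) 1) := isCompact_sphere _ _
  have hK0 : ∀ t ∈ Metric.sphere (0 : ℂ) 1, t ≠ 0 ∧ ‖t‖ ≤ 1 := by
    intro t ht
    have : ‖t‖ = 1 := by simpa using ht
    exact ⟨by rw [← norm_pos_iff, this]; exact one_pos, this.le⟩
  have hKR : Metric.sphere (0 : ℂ) 1 ⊆ puncturedDisc R := fun t ht =>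
    hψ.mem_of_norm_le_one (hK0 t ht).1 (hK0 t ht).2
  have hVn : φ.source ∩ U ∈ 𝓝 (ι p) :=
    inter_mem (φ.open_source.mem_nhds hpφ) (hψ.mem_nhds p)
  filter_upwards [hψ.eventually_forall_mem hK hKR hVn, hψ.mem_nhds p] with a ha haU t ht
  have ht' : t ∈ Metric.sphere (0 : ℂ) 1 := by simpa using ht
  have h1 : (1 : ℂ) ∈ Metric.sphere (0 : ℂ) 1 := by simp
  have hconn : IsPreconnected (Metric.sphere (0 : ℂ) 1) :=
    isPreconnected_sphere (by simp [Complex.rank_real_complex]) _ _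
  have hcont : ContinuousOn (fun t => (φ (ψ t a)).1) (Metric.sphere (0 : ℂ) 1) := by
    intro s hs
    have h2 : ContinuousAt (fun t => ψ t a) s :=
      (hψ.continuousAt (hKR hs) haU).comp (f := fun t => (t, a)) (by fun_prop)
    have h3 := (φ.continuousAt (ha s hs).1).comp (f := fun t => ψ t a) h2
    exact (continuousAt_fst.comp h3).continuousWithinAt
  -- The circle keeps `a` in its leaf, which meets countably many levels of the coordinate;
  -- connectedness then makes the coordinate equal to its value at `t = 1`.
  have hcount : ((fun t => (φ (ψ t a)).1) '' Metric.sphere (0 : ℂ) 1).Countable := by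
    refine (F.countable_image_leaf a hφ).mono ?_
    rintro _ ⟨s, hs, rfl⟩
    exact ⟨ψ s a, ⟨hψ.mem_leaf hF haU (hK0 s hs).1 (hK0 s hs).2 (ha s hs).2, (ha s hs).1⟩, rfl⟩
  have := hconn.eqOn_of_countable_image hcont hcount ht' h1
  simpa only [hψ.map_one a haU] using this

end IsTransverseActionOn

/-! ### Averages over the circle -/

section CircleAverage

open Real Metric

theorem circleMap_zero_one_mem (θ : ℝ) : circleMap 0 1 θ ∈ sphere (0 : ℂ) 1 :=
  circleMap_mem_sphere 0 zero_le_one θ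

theorem circleAverage_mul_right {E : Type*} [NormedAddCommGroup E] [NormedSpace ℝ E] (g : ℂ → E)
    {s : ℂ} (hs : ‖s‖ = 1) :
    circleAverage (fun t => g (t * s)) 0 1 = circleAverage g 0 1 := by
  rw [circleAverage_eq_integral_add (f := g) s.arg, circleAverage]
  have h : ∀ θ : ℝ, circleMap 0 1 θ * s = circleMap 0 1 (θ + s.arg) := by
    intro θ
    have : s = Complex.exp (s.arg * Complex.I) := by
      conv_lhs => rw [← Complex.norm_mul_exp_arg_mul_I s, hs]
      simp
    conv_lhs => rw [this]
    simp [circleMap, add_mul, Complex.exp_add]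
  simp only [h]

/-- Differentiation under the integral sign. Class `C¹` over `ℂ` is enough, since only complex
differentiability is needed afterwards. In the second part the derivative of the average is the
average of the constant `L`. -/
theorem contDiffAt_circleAverage {E : Type*} [NormedAddCommGroup E] [NormedSpace ℂ E]
    {g : ℂ × E → ℂ} {w₀ : E} (hg : ∀ t ∈ sphere (0 : ℂ) 1, ContDiffAt ℂ 1 g (t, w₀)) :
    ContDiffAt ℂ 1 (fun w => circleAverage (fun t => g (t, w)) 0 1) w₀ ∧
      ∀ L : E →L[ℂ] ℂ, (∀ t ∈ sphere (0 : ℂ) 1, HasFDerivAt (fun w => g (t, w)) L w₀) →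
        HasFDerivAt (fun w => circleAverage (fun t => g (t, w)) 0 1) L w₀ := by
  have hK : IsCompact (sphere (0 : ℂ) 1) := isCompact_sphere _ _
  set D : E → ℂ → E →L[ℂ] ℂ := fun w t =>
    (fderiv ℂ g (t, w)).comp (ContinuousLinearMap.inr ℂ ℂ E) with hD
  have hDc : ∀ t w, ContDiffAt ℂ 1 g (t, w) → ContinuousAt (fun z : ℂ × E => D z.2 z.1) (t, w) := by
    intro t w h
    have h1 : ContinuousAt (fderiv ℂ g) (t, w) :=
      (h.fderiv_right (m := 0) (by simp)).continuousAt
    exact h1.clm_comp continuousAt_const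
  have hDd : ∀ t w, ContDiffAt ℂ 1 g (t, w) → HasFDerivAt (fun w => g (t, w)) (D w t) w := by
    intro t w h
    have h1 := (h.differentiableAt (by simp)).hasFDerivAt
    exact h1.comp w (hasFDerivAt_prodMk_right t w)
  have ev1 : ∀ᶠ w in 𝓝 w₀, ∀ t ∈ sphere (0 : ℂ) 1, ContDiffAt ℂ 1 g (t, w) := by
    refine hK.eventually_forall_of_forall_eventually fun t ht => ?_
    have h := (hg t ht).eventually (by simp)
    exact (continuous_swap.tendsto (w₀, t)).eventually h
  obtain ⟨C, hC⟩ : ∃ C, ∀ t ∈ sphere (0 : ℂ) 1, ‖D w₀ t‖ ≤ C := by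
    refine hK.exists_bound_of_continuousOn fun t ht => ?_
    exact ((hDc t w₀ (hg t ht)).comp (f := fun t => (t, w₀)) (by fun_prop)).continuousWithinAt
  -- The slack `1` turns the bound at `w₀` into an open condition, hence into a bound uniform over
  -- the circle for `w` near `w₀`; it is the dominating function below.
  have ev2 : ∀ᶠ w in 𝓝 w₀, ∀ t ∈ sphere (0 : ℂ) 1, ‖D w t‖ ≤ C + 1 := by
    refine hK.eventually_forall_of_forall_eventually fun t ht => ?_
    have h := (hDc t w₀ (hg t ht)).norm.eventually_lt_const
      (show ‖D w₀ t‖ < C + 1 by linarith [hC t ht])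
    exact ((continuous_swap.tendsto (w₀, t)).eventually h).mono fun _ h => h.le
  have hgcont : ∀ w, (∀ t ∈ sphere (0 : ℂ) 1, ContDiffAt ℂ 1 g (t, w)) →
      Continuous fun θ : ℝ => g (circleMap 0 1 θ, w) := by
    intro w h
    refine continuous_iff_continuousAt.2 fun θ => ?_
    exact (h _ (circleMap_zero_one_mem θ)).continuousAt.comp (f := fun θ => (circleMap 0 1 θ, w))
      (by fun_prop)
  have hDcont : ∀ w, (∀ t ∈ sphere (0 : ℂ) 1, ContDiffAt ℂ 1 g (t, w)) →
      Continuous fun θ : ℝ => D w (circleMap 0 1 θ) := by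
    intro w h
    refine continuous_iff_continuousAt.2 fun θ => ?_
    exact (hDc _ w (h _ (circleMap_zero_one_mem θ))).comp (f := fun θ => (circleMap 0 1 θ, w))
      (by fun_prop)
  have hder : ∀ᶠ w in 𝓝 w₀, HasFDerivAt (fun w => circleAverage (fun t => g (t, w)) 0 1)
      (circleAverage (D w) 0 1) w := by
    filter_upwards [ev1.eventually_nhds, ev2.eventually_nhds] with w h1 h2
    refine HasFDerivAt.const_smul ?_ ((2 * π)⁻¹ : ℝ)
    refine intervalIntegral.hasFDerivAt_integral_of_dominated_of_fderiv_le
      (F := fun w θ => g (circleMap 0 1 θ, w)) (F' := fun w θ => D w (circleMap 0 1 θ))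
      (bound := fun _ => C + 1) (h1.and h2) ?_ ?_ ?_ ?_ ?_ ?_
    · exact h1.mono fun w h => (hgcont w h).aestronglyMeasurable
    · exact (hgcont w h1.self_of_nhds).intervalIntegrable _ _
    · exact (hDcont w h1.self_of_nhds).aestronglyMeasurable
    · exact Eventually.of_forall fun θ _ w hw => hw.2 _ (circleMap_zero_one_mem θ)
    · exact intervalIntegrable_const
    · exact Eventually.of_forall fun θ _ w hw => hDd _ w (hw.1 _ (circleMap_zero_one_mem θ))
  refine ⟨contDiffAt_one_iff.2 ⟨_, _, hder.and (ev1.eventually_nhds.and ev2.eventually_nhds),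
    ?_, fun w hw => hw.1⟩, ?_⟩
  · rintro w ⟨-, h1, h2⟩
    refine ContinuousAt.continuousWithinAt ?_
    refine ContinuousAt.const_smul ?_ ((2 * π)⁻¹ : ℝ)
    refine intervalIntegral.continuousAt_of_dominated_interval
      (F := fun w θ => D w (circleMap 0 1 θ)) (bound := fun _ => C + 1) ?_ ?_ ?_ ?_
    · exact h1.mono fun w h => (hDcont w h).aestronglyMeasurable
    · exact h2.mono fun w h => Eventually.of_forall fun θ _ => h _ (circleMap_zero_one_mem θ)
    · exact intervalIntegrable_const
    · refine Eventually.of_forall fun θ _ => ?_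
      exact (hDc _ w (h1.self_of_nhds _ (circleMap_zero_one_mem θ))).comp
        (f := fun w => (circleMap 0 1 θ, w)) (by fun_prop)
  · intro L hL
    have h := hder.self_of_nhds
    have : circleAverage (D w₀) 0 1 = L := by
      rw [circleAverage_congr_sphere (f₂ := fun _ => L)]
      · exact circleAverage_const _ _ _
      · intro t ht
        rw [abs_one] at ht
        exact (hDd t w₀ (hg t ht)).unique (hL t ht)
    rwa [this] at h

/-- A character of the circle which is differentiable at `1` is a power. -/
theorem exists_eq_zpow_of_mul {χ : ℂ → ℂ} (h1 : χ 1 = 1) (hd : DifferentiableAt ℂ χ 1)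
    (hmul : ∀ s t : ℂ, ‖s‖ = 1 → ‖t‖ = 1 → χ (s * t) = χ s * χ t) :
    ∃ q : ℤ, ∀ t : ℂ, ‖t‖ = 1 → χ t = t ^ q := by
  set L : ℝ → ℂ := fun θ => χ (Complex.exp (θ * Complex.I)) with hL
  have hexp : ∀ θ : ℝ, HasDerivAt (fun θ : ℝ => Complex.exp (θ * Complex.I))
      (Complex.exp (θ * Complex.I) * Complex.I) θ := by
    intro θ
    have h := ((hasDerivAt_id (θ : ℂ)).mul_const Complex.I).cexp.comp_ofReal
    simpa using h
  have hL0 : HasDerivAt L (deriv χ 1 * Complex.I) 0 := by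
    have hd' : HasDerivAt χ (deriv χ 1) (Complex.exp ((0 : ℝ) * Complex.I)) := by
      simpa using hd.hasDerivAt
    have := hd'.comp (0 : ℝ) (hexp 0)
    simpa [Function.comp_def] using this
  set k := deriv χ 1 * Complex.I with hk
  have hLadd : ∀ x y, L (x + y) = L x * L y := by
    intro x y
    simp only [hL, Complex.ofReal_add, add_mul, Complex.exp_add]
    exact hmul _ _ (Complex.norm_exp_ofReal_mul_I x) (Complex.norm_exp_ofReal_mul_I y)
  -- Translation by `θ` reduces the derivative at `θ` to the derivative at `0`, so `L` solves `L' =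
  -- k L` and is an exponential.
  have hLd : ∀ θ, HasDerivAt L (L θ * k) θ := by
    intro θ
    have h : L = fun x => L θ * L (x - θ) := by
      funext x
      rw [← hLadd, add_sub_cancel]
    have h0 : HasDerivAt L k (θ - θ) := by rwa [sub_self]
    have h2 := (h0.comp_sub_const θ θ).const_mul (L θ)
    rw [← h] at h2
    exact h2
  have hconst : ∀ θ : ℝ, L θ * Complex.exp (-(θ * k)) = L 0 * Complex.exp (-((0 : ℝ) * k)) := by
    intro θ
    have hM : ∀ θ : ℝ, HasDerivAt (fun θ : ℝ => L θ * Complex.exp (-(θ * k))) 0 θ := by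
      intro θ
      have h : HasDerivAt (fun θ : ℝ => Complex.exp (-(θ * k))) (Complex.exp (-(θ * k)) * -k) θ := by
        have := (((hasDerivAt_id (θ : ℂ)).mul_const k).neg.cexp).comp_ofReal
        rw [one_mul] at this
        exact this
      have h' := (hLd θ).mul h
      have he : L θ * k * Complex.exp (-(θ * k)) + L θ * (Complex.exp (-(θ * k)) * -k) = 0 := by
        ring
      rw [he] at h'
      exact h'
    exact is_const_of_deriv_eq_zero (fun θ => (hM θ).differentiableAt) (fun θ => (hM θ).deriv) θ 0
  have hLexp : ∀ θ : ℝ, L θ = Complex.exp (θ * k) := by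
    intro θ
    have h := hconst θ
    have h0 : L 0 = 1 := by simp [hL, h1]
    rw [h0, Complex.exp_neg] at h
    have hne := Complex.exp_ne_zero (θ * k)
    field_simp at h
    simpa using h
  -- Periodicity under `2π` makes the exponent an integer multiple of `I`.
  have h2π : Complex.exp ((2 * π : ℝ) * k) = 1 := by
    rw [← hLexp]
    simp [hL, h1]
  obtain ⟨q, hq⟩ := Complex.exp_eq_one_iff.1 h2π
  have hkq : k = q * Complex.I := by
    have : (2 * π : ℂ) ≠ 0 := by simp [pi_ne_zero]
    apply mul_left_cancel₀ this
    push_cast at hq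
    rw [hq]; ring
  refine ⟨q, fun t ht => ?_⟩
  have htexp : t = Complex.exp (t.arg * Complex.I) := by
    conv_lhs => rw [← Complex.norm_mul_exp_arg_mul_I t, ht]
    simp
  have h := hLexp t.arg
  simp only [hL] at h
  rw [← htexp] at h
  rw [h, hkq]
  conv_rhs => rw [htexp]
  rw [← Complex.exp_int_mul]
  ring_nf

end CircleAverage

/-! ### Linearization of a family of germs over the circle -/

/-- The average which linearizes an action of the circle in one complex variable. -/
noncomputable def linearizer (q : ℤ) (f : ℂ → ℂ × ℂ → ℂ) (w : ℂ × ℂ) : ℂ :=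
  Real.circleAverage (fun t => t ^ (-q) * f t w) 0 1

/-- The fibre derivatives of `f t` at the fixed point form a character `t ^ q` of the circle, by the
chain rule. After division by `t ^ q` all derivatives equal the second projection, and so does the
derivative of the average. Equivariance is the invariance of the average under rotation. -/
theorem exists_linearizer {f : ℂ → ℂ × ℂ → ℂ} {ζ₀ : ℂ}
    (hf : ∀ t : ℂ, ‖t‖ = 1 → ContDiffAt ℂ ω (fun z : ℂ × (ℂ × ℂ) => f z.1 z.2) (t, (ζ₀, 0)))
    (h0 : ∀ᶠ ζ in 𝓝 ζ₀, ∀ t : ℂ, ‖t‖ = 1 → f t (ζ, 0) = 0)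
    (h1 : ∀ᶠ w in 𝓝 (ζ₀, (0 : ℂ)), f 1 w = w.2)
    (hmul : ∀ᶠ w in 𝓝 (ζ₀, (0 : ℂ)), ∀ s t : ℂ, ‖s‖ = 1 → ‖t‖ = 1 →
      f (s * t) w = f s (w.1, f t w)) :
    ∃ q : ℤ, ContDiffAt ℂ 1 (linearizer q f) (ζ₀, 0) ∧
      HasFDerivAt (linearizer q f) (ContinuousLinearMap.snd ℂ ℂ ℂ) (ζ₀, 0) ∧
      ∀ᶠ w in 𝓝 (ζ₀, (0 : ℂ)), ∀ s : ℂ, ‖s‖ = 1 →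
        linearizer q f (w.1, f s w) = s ^ q * linearizer q f w := by
  set w₀ : ℂ × ℂ := (ζ₀, 0) with hw₀
  set D : ℂ → ℂ × ℂ →L[ℂ] ℂ := fun t =>
    (fderiv ℂ (fun z : ℂ × (ℂ × ℂ) => f z.1 z.2) (t, w₀)).comp
      (ContinuousLinearMap.inr ℂ ℂ (ℂ × ℂ)) with hD
  have hDd : ∀ t : ℂ, ‖t‖ = 1 → HasFDerivAt (f t) (D t) w₀ := by
    intro t ht
    have h := ((hf t ht).differentiableAt (by simp)).hasFDerivAt
    exact h.comp w₀ (hasFDerivAt_prodMk_right t w₀)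
  have hf0 : ∀ t : ℂ, ‖t‖ = 1 → f t w₀ = 0 := h0.self_of_nhds
  -- `f t` vanishes along the axis `y = 0`, so its derivative has no component in that direction.
  have hDfst : ∀ t : ℂ, ‖t‖ = 1 → D t (1, 0) = 0 := by
    intro t ht
    have hc : HasFDerivAt (fun ζ : ℂ => (ζ, (0 : ℂ))) (ContinuousLinearMap.inl ℂ ℂ ℂ) ζ₀ :=
      hasFDerivAt_prodMk_left ζ₀ 0
    have h := (hDd t ht).comp ζ₀ hc
    have h' : HasFDerivAt (f t ∘ fun ζ : ℂ => (ζ, (0 : ℂ))) (0 : ℂ →L[ℂ] ℂ) ζ₀ :=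
      (hasFDerivAt_const (0 : ℂ) ζ₀).congr_of_eventuallyEq
        (h0.mono fun ζ hζ => hζ t ht)
    simpa using congrArg (fun A : ℂ →L[ℂ] ℂ => A 1) (h.unique h')
  have hDsnd : ∀ t : ℂ, ‖t‖ = 1 → D t = D t (0, 1) • ContinuousLinearMap.snd ℂ ℂ ℂ := by
    intro t ht
    refine ContinuousLinearMap.ext fun v => ?_
    have hv : v = v.1 • ((1, 0) : ℂ × ℂ) + v.2 • ((0, 1) : ℂ × ℂ) := by simp
    conv_lhs => rw [hv, map_add, map_smul, map_smul, hDfst t ht]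
    simp [mul_comm]
  obtain ⟨q, hq⟩ : ∃ q : ℤ, ∀ t : ℂ, ‖t‖ = 1 → D t (0, 1) = t ^ q := by
    refine exists_eq_zpow_of_mul (χ := fun t => D t (0, 1)) ?_ ?_ ?_
    · have h : HasFDerivAt (f 1) (ContinuousLinearMap.snd ℂ ℂ ℂ) w₀ :=
        (ContinuousLinearMap.snd ℂ ℂ ℂ).hasFDerivAt.congr_of_eventuallyEq h1
      simp only [(hDd 1 norm_one).unique h]
      rfl
    -- The family is holomorphic in `t` as well, so the character is differentiable at `1`.
    · have h : DifferentiableAt ℂ (fderiv ℂ (fun z : ℂ × (ℂ × ℂ) => f z.1 z.2)) (1, w₀) :=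
        ((hf 1 norm_one).fderiv_right (m := 1) (by simp)).differentiableAt (by simp)
      have h2 : DifferentiableAt ℂ (fun t : ℂ => (t, w₀)) 1 := by fun_prop
      have h3 := DifferentiableAt.comp (1 : ℂ) (f := fun t : ℂ => (t, w₀)) h h2
      exact h3.clm_apply (differentiableAt_const ((0 : ℂ), ((0 : ℂ), (1 : ℂ))))
    · intro s t hs ht
      have hst : ‖s * t‖ = 1 := by rw [norm_mul, hs, ht, mul_one]
      have hin : HasFDerivAt (fun w : ℂ × ℂ => (w.1, f t w))
          ((ContinuousLinearMap.fst ℂ ℂ ℂ).prod (D t)) w₀ :=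
        (ContinuousLinearMap.fst ℂ ℂ ℂ).hasFDerivAt.prodMk (hDd t ht)
      have hpt : ((w₀.1, f t w₀) : ℂ × ℂ) = w₀ := by rw [hf0 t ht]
      have hout : HasFDerivAt (f s) (D s) (w₀.1, f t w₀) := by rw [hpt]; exact hDd s hs
      have h := (HasFDerivAt.comp w₀ (f := fun w : ℂ × ℂ => (w.1, f t w)) hout hin).congr_of_eventuallyEq
        (f₁ := f (s * t)) (hmul.mono fun w hw => hw s t hs ht)
      rw [(hDd (s * t) hst).unique h]
      rw [hDsnd s hs]
      simp
  have hzpow : ∀ t : ℂ, ‖t‖ = 1 → ContDiffAt ℂ 1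
      (fun z : ℂ × (ℂ × ℂ) => z.1 ^ (-q) * f z.1 z.2) (t, w₀) := by
    intro t ht
    have ht0 : t ≠ 0 := by rw [← norm_pos_iff, ht]; exact one_pos
    have h2 : AnalyticAt ℂ (fun z : ℂ × (ℂ × ℂ) => z.1) (t, w₀) := analyticAt_fst
    exact ((h2.zpow ht0 (n := -q)).contDiffAt).mul ((hf t ht).of_le (by simp))
  obtain ⟨hC, hL⟩ := contDiffAt_circleAverage
    (g := fun z : ℂ × (ℂ × ℂ) => z.1 ^ (-q) * f z.1 z.2) (w₀ := w₀)
    (fun t ht => hzpow t (by simpa using ht))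
  refine ⟨q, hC, hL _ fun t ht => ?_, ?_⟩
  · have ht : ‖t‖ = 1 := by simpa using ht
    have ht0 : t ≠ 0 := by rw [← norm_pos_iff, ht]; exact one_pos
    have h := (hDd t ht).const_mul (t ^ (-q))
    rw [hDsnd t ht, hq t ht, smul_smul, zpow_neg, inv_mul_cancel₀ (zpow_ne_zero _ ht0),
      one_smul] at h
    simpa only [zpow_neg] using h
  -- Replacing `t` by `t * s` in the average produces the factor `s ^ q`.
  · filter_upwards [hmul] with w hw s hs
    have hs0 : s ≠ 0 := by rw [← norm_pos_iff, hs]; exact one_pos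
    unfold linearizer
    rw [← circleAverage_mul_right (fun t => t ^ (-q) * f t w) hs, ← smul_eq_mul,
      ← Real.circleAverage_fun_smul]
    refine Real.circleAverage_congr_sphere fun t ht => ?_
    have ht : ‖t‖ = 1 := by simpa using ht
    simp only [smul_eq_mul]
    rw [hw t s ht hs, mul_zpow, zpow_neg s]
    have := zpow_ne_zero q hs0
    field_simp

/-! ### Local coordinates -/

/-- The inverse function theorem, where finite dimension makes injectivity of the derivative
sufficient. The source is shrunk to points where `f` is of class `C^n` with invertible derivative,
so that the inverse is of class `C^n` on the whole target. For `n = ∞`, being of class `C^n` at a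
point need not persist nearby. -/
theorem exists_openPartialHomeomorph_of_fderiv_injective {E : Type*} [NormedAddCommGroup E]
    [NormedSpace ℂ E] [FiniteDimensional ℂ E] {n : ℕ∞ω} (hn : n ≠ 0) (hn' : n ≠ ∞) {f : E → E}
    {w₀ : E} (hf : ContDiffAt ℂ n f w₀) (hinj : ∀ v, fderiv ℂ f w₀ v = 0 → v = 0) :
    ∃ e : OpenPartialHomeomorph E E, w₀ ∈ e.source ∧ ⇑e = f ∧
      ContDiffOn ℂ n e e.source ∧ ContDiffOn ℂ n e.symm e.target := by
  have : CompleteSpace E := FiniteDimensional.complete ℂ E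
  have hinj' : Function.Injective (fderiv ℂ f w₀ : E →ₗ[ℂ] E) := by
    rw [← LinearMap.ker_eq_bot, LinearMap.ker_eq_bot']
    exact hinj
  set A : E ≃L[ℂ] E := (LinearEquiv.ofInjectiveEndo _ hinj').toContinuousLinearEquiv with hA
  have hAf : (A : E →L[ℂ] E) = fderiv ℂ f w₀ := ContinuousLinearMap.ext fun v => rfl
  have hd : HasFDerivAt f (A : E →L[ℂ] E) w₀ := by
    rw [hAf]; exact (hf.differentiableAt hn).hasFDerivAt
  set e₀ := hf.toOpenPartialHomeomorph f hd hn with he₀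
  have h1n : (1 : ℕ∞ω) ≤ n := ENat.one_le_iff_ne_zero_withTop.2 hn
  have hev : ∀ᶠ w in 𝓝 w₀, ContDiffAt ℂ n f w ∧
      fderiv ℂ f w ∈ range ((↑) : (E ≃L[ℂ] E) → E →L[ℂ] E) := by
    refine (hf.eventually hn').and ?_
    have hc : ContinuousAt (fderiv ℂ f) w₀ :=
      ((hf.of_le h1n).fderiv_right (m := 0) (by simp)).continuousAt
    exact hc (by rw [← hAf]; exact A.nhds)
  obtain ⟨V, hV, hVo, hwV⟩ := eventually_nhds_iff.1 hev
  refine ⟨e₀.restrOpen V hVo, ⟨hf.mem_toOpenPartialHomeomorph_source hd hn, hwV⟩, rfl,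
    fun w hw => (hV w hw.2).1.contDiffWithinAt, fun w hw => ?_⟩
  obtain ⟨hc, ⟨B, hB⟩⟩ := hV _ ((e₀.restrOpen V hVo).map_target hw).2
  refine (OpenPartialHomeomorph.contDiffAt_symm (e₀.restrOpen V hVo) hw (f₀' := B) ?_ hc).contDiffWithinAt
  rw [hB]
  exact (hc.differentiableAt hn).hasFDerivAt

namespace HolEmbedding

variable {σ S : Type*} [TopologicalSpace σ] [ChartedSpace ℂ σ]
  [TopologicalSpace S] [ChartedSpace (ℂ × ℂ) S]

/-- The embedding in the charts at `p` and `ι p`. -/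
noncomputable def localMap (ι : HolEmbedding σ S) (p : σ) (ζ : ℂ) : ℂ × ℂ :=
  chartAt (ℂ × ℂ) (ι p) (ι ((chartAt ℂ p).symm ζ))

theorem continuous (ι : HolEmbedding σ S) : Continuous ι :=
  ι.isSmoothEmbedding.contMDiff.continuous

variable [IsManifold 𝓘(ℂ, ℂ) ω σ] [IsManifold 𝓘(ℂ, ℂ × ℂ) ω S]

theorem mem_normalBase_iff (ι : HolEmbedding σ S) (p z : σ) :
    z ∈ ι.normalBase p ↔
      z ∈ (chartAt ℂ p).source ∧ ι z ∈ (chartAt (ℂ × ℂ) (ι p)).source := Iff.rfl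

theorem contDiffAt_localMap (ι : HolEmbedding σ S) {p z : σ} (hz : z ∈ ι.normalBase p) :
    ContDiffAt ℂ ω (ι.localMap p) (chartAt ℂ p z) := by
  rw [mem_normalBase_iff] at hz
  rw [← contMDiffAt_iff_contDiffAt]
  have h1 : ContMDiffAt 𝓘(ℂ, ℂ) 𝓘(ℂ, ℂ) ω (chartAt ℂ p).symm (chartAt ℂ p z) :=
    contMDiffAt_symm_of_mem_maximalAtlas (IsManifold.chart_mem_maximalAtlas p)
      ((chartAt ℂ p).map_source hz.1)
  have h2 : ContMDiffAt 𝓘(ℂ, ℂ × ℂ) 𝓘(ℂ, ℂ × ℂ) ω (chartAt (ℂ × ℂ) (ι p)) (ι z) :=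
    contMDiffAt_of_mem_maximalAtlas (IsManifold.chart_mem_maximalAtlas _) hz.2
  have h3 : ContMDiffAt 𝓘(ℂ, ℂ) 𝓘(ℂ, ℂ × ℂ) ω ι ((chartAt ℂ p).symm (chartAt ℂ p z)) :=
    ι.isSmoothEmbedding.contMDiff _
  have h4 := h3.comp _ h1
  refine ContMDiffAt.comp _ ?_ h4
  simpa only [Function.comp_apply, (chartAt ℂ p).left_inv hz.1] using h2

/-- This links the frame used to trivialise the normal bundle with ordinary calculus in charts; in
particular the frame depends holomorphically on the point. -/
theorem tangentVec_eq_deriv (ι : HolEmbedding σ S) {p z : σ} (hz : z ∈ ι.normalBase p) :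
    ι.tangentVec p z = deriv (ι.localMap p) (chartAt ℂ p z) := by
  rw [mem_normalBase_iff] at hz
  unfold tangentVec trivS trivσ
  rw [TangentBundle.continuousLinearMapAt_trivializationAt hz.2,
    TangentBundle.symmL_trivializationAt hz.1]
  have h1 : MDifferentiableAt 𝓘(ℂ, ℂ) 𝓘(ℂ, ℂ) (chartAt ℂ p).symm (chartAt ℂ p z) :=
    mdifferentiableAt_symm_of_mem_maximalAtlas
      (IsManifold.maximalAtlas_subset_of_le (n := ω) (by simp) (IsManifold.chart_mem_maximalAtlas p))
      ((chartAt ℂ p).map_source hz.1)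
  have h2 : MDifferentiableAt 𝓘(ℂ, ℂ × ℂ) 𝓘(ℂ, ℂ × ℂ) (chartAt (ℂ × ℂ) (ι p)) (ι z) :=
    mdifferentiableAt_of_mem_maximalAtlas
      (IsManifold.maximalAtlas_subset_of_le (n := ω) (by simp) (IsManifold.chart_mem_maximalAtlas _)) hz.2
  have h3 : MDifferentiableAt 𝓘(ℂ, ℂ) 𝓘(ℂ, ℂ × ℂ) ι z :=
    (ι.isSmoothEmbedding.contMDiff z).mdifferentiableAt (by simp)
  have hl := (chartAt ℂ p).left_inv hz.1
  have h4 : HasMFDerivAt 𝓘(ℂ, ℂ) 𝓘(ℂ, ℂ × ℂ) (ι ∘ (chartAt ℂ p).symm) (chartAt ℂ p z)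
      ((mfderiv 𝓘(ℂ, ℂ) 𝓘(ℂ, ℂ × ℂ) ι z).comp
        (mfderiv 𝓘(ℂ, ℂ) 𝓘(ℂ, ℂ) (chartAt ℂ p).symm (chartAt ℂ p z))) := by
    refine HasMFDerivAt.comp _ ?_ h1.hasMFDerivAt
    rw [hl]; exact h3.hasMFDerivAt
  have h5 : HasMFDerivAt 𝓘(ℂ, ℂ) 𝓘(ℂ, ℂ × ℂ) (ι.localMap p) (chartAt ℂ p z)
      ((mfderiv 𝓘(ℂ, ℂ × ℂ) 𝓘(ℂ, ℂ × ℂ) (chartAt (ℂ × ℂ) (ι p)) (ι z)).comp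
        ((mfderiv 𝓘(ℂ, ℂ) 𝓘(ℂ, ℂ × ℂ) ι z).comp
        (mfderiv 𝓘(ℂ, ℂ) 𝓘(ℂ, ℂ) (chartAt ℂ p).symm (chartAt ℂ p z)))) := by
    refine HasMFDerivAt.comp _ ?_ h4
    rw [hl]; exact h2.hasMFDerivAt
  rw [← fderiv_apply_one_eq_deriv, ← mfderiv_eq_fderiv, h5.mfderiv]
  simp only [extChartAt, OpenPartialHomeomorph.extend, modelWithCornersSelf_partialEquiv,
    modelWithCornersSelf_coe, range_id, mfderivWithin_univ]
  rfl

end HolEmbedding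

/-! ### Charts adapted to the leaves and to the normal bundle -/

namespace IsTransverseActionOn

variable {σ S : Type*} [TopologicalSpace σ] [ChartedSpace ℂ σ]
  [TopologicalSpace S] [ChartedSpace (ℂ × ℂ) S]
  [IsManifold 𝓘(ℂ, ℂ) ω σ]
  {ι : HolEmbedding σ S} {ψ : ℂ → S → S} {R : ℝ} {U : Set S}

/-- The projection along the leaves, in a chart of the Riemann surface. -/
theorem exists_retraction [SecondCountableTopology S] (hψ : IsTransverseActionOn ι ψ R U) (p : σ) :
    ∃ X : S → ℂ, ContMDiffAt 𝓘(ℂ, ℂ × ℂ) 𝓘(ℂ, ℂ) ω X (ι p) ∧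
      (∀ᶠ z in 𝓝 p, X (ι z) = chartAt ℂ p z) ∧
      ∀ᶠ a in 𝓝 (ι p), ∀ t : ℂ, ‖t‖ = 1 → X (ψ t a) = X a := by
  obtain ⟨φ, hφ, hpφ, htr, hinv⟩ := hψ.exists_transverse_coord p
  have hps := mem_chart_source ℂ p
  set d := chartAt ℂ p with hd
  set ζ₀ := d p with hζ₀
  have hx : ContMDiffAt 𝓘(ℂ, ℂ × ℂ) 𝓘(ℂ, ℂ) ω (fun a => (φ a).1) (ι p) :=
    (contDiffAt_fst (𝕜 := ℂ) (E := ℂ) (F := ℂ)).contMDiffAt.comp (ι p)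
      (contMDiffAt_of_mem_maximalAtlas hφ hpφ)
  have hxι : ContMDiffAt 𝓘(ℂ, ℂ) 𝓘(ℂ, ℂ) ω (fun z => (φ (ι z)).1) p :=
    hx.comp p (ι.isSmoothEmbedding.contMDiff p)
  have hds : ContMDiffAt 𝓘(ℂ, ℂ) 𝓘(ℂ, ℂ) ω d.symm ζ₀ :=
    contMDiffAt_symm_of_mem_maximalAtlas (IsManifold.chart_mem_maximalAtlas p) (d.map_source hps)
  have hleft : d.symm ζ₀ = p := d.left_inv hps
  set k : ℂ → ℂ := fun ζ => (φ (ι (d.symm ζ))).1 with hk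
  have hkM : ContMDiffAt 𝓘(ℂ, ℂ) 𝓘(ℂ, ℂ) ω k ζ₀ := by
    refine ContMDiffAt.comp ζ₀ (g := fun z => (φ (ι z)).1) ?_ hds
    rw [hleft]; exact hxι
  have hkC : ContDiffAt ℂ ω k ζ₀ := contMDiffAt_iff_contDiffAt.1 hkM
  -- Transversality says that the leaf coordinate restricted to `σ` is a local biholomorphism;
  -- composing with its inverse normalises the projection to be the given chart on `σ`.
  have hder : ∀ v, fderiv ℂ k ζ₀ v = 0 → v = 0 := by
    intro v hv
    by_contra hv0
    have hk0 : HasMFDerivAt 𝓘(ℂ, ℂ) 𝓘(ℂ, ℂ) k ζ₀ (0 : ℂ →L[ℂ] ℂ) := by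
      have h0 : fderiv ℂ k ζ₀ = 0 := by
        ext
        have : v * fderiv ℂ k ζ₀ 1 = 0 := by
          rw [← smul_eq_mul, ← map_smul, smul_eq_mul, mul_one, hv]
        simpa using (mul_eq_zero.1 this).resolve_left hv0
      rw [← h0]
      exact (hkC.differentiableAt (by simp)).hasFDerivAt.hasMFDerivAt
    have hdm : MDifferentiableAt 𝓘(ℂ, ℂ) 𝓘(ℂ, ℂ) d p :=
      (contMDiffAt_of_mem_maximalAtlas (n := ω) (IsManifold.chart_mem_maximalAtlas p) hps).mdifferentiableAt
        (by simp)
    have hcomp := HasMFDerivAt.comp p hk0 hdm.hasMFDerivAt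
    have heq : (fun z => (φ (ι z)).1) =ᶠ[𝓝 p] k ∘ d := by
      filter_upwards [d.open_source.mem_nhds hps] with z hz
      simp only [hk, Function.comp_apply, d.left_inv hz]
    refine htr ((hcomp.congr_of_eventuallyEq heq).mfderiv.trans ?_)
    exact ContinuousLinearMap.zero_comp _
  obtain ⟨e, he0, hek, -, hesymm⟩ :=
    exists_openPartialHomeomorph_of_fderiv_injective (by simp) (by simp) hkC hder
  have hxp : (φ (ι p)).1 = e ζ₀ := by rw [hek, hk]; simp only [hleft]
  refine ⟨fun a => e.symm (φ a).1, ?_, ?_, ?_⟩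
  · refine ContMDiffAt.comp (ι p) (g := e.symm) ?_ hx
    rw [hxp]
    exact (hesymm.contDiffAt (e.open_target.mem_nhds (e.map_source he0))).contMDiffAt
  · filter_upwards [d.open_source.mem_nhds hps, (d.continuousAt hps) (e.open_source.mem_nhds he0)]
      with z hz hz'
    have : (φ (ι z)).1 = e (d z) := by rw [hek, hk]; simp only [d.left_inv hz]
    rw [this, e.left_inv hz']
  · filter_upwards [hinv] with a ha t ht
    rw [ha t ht]

variable [IsManifold 𝓘(ℂ, ℂ × ℂ) ω S]

/-- The transverse coordinate `Y` adapted to the trivialization of the normal bundle at `p` and to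
the projection `X` on the Riemann surface. -/
noncomputable def transverseCoord (ι : HolEmbedding σ S) (p : σ) (ζ : ℂ) (a : S) : ℂ :=
  HolEmbedding.detForm (ι.tangentVec p ((chartAt ℂ p).symm ζ))
    (chartAt (ℂ × ℂ) (ι p) a - ι.localMap p ζ)

/-- The pair `(X, Y)` is a chart at `ι p`: with `T` the tangent vector of `σ`, one has `dX T = 1`,
and on the kernel of `dX` the form `dY` is `det (T, ·)`, whose kernel is spanned by `T`. -/
theorem exists_adapted_chart [SecondCountableTopology S] (hψ : IsTransverseActionOn ι ψ R U)
    (p : σ) :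
    ∃ Φ : OpenPartialHomeomorph S (ℂ × ℂ), ι p ∈ Φ.source ∧
      Φ.source ⊆ (chartAt (ℂ × ℂ) (ι p)).source ∧
      ContMDiffOn 𝓘(ℂ, ℂ × ℂ) 𝓘(ℂ, ℂ × ℂ) ω Φ Φ.source ∧
      ContMDiffOn 𝓘(ℂ, ℂ × ℂ) 𝓘(ℂ, ℂ × ℂ) ω Φ.symm Φ.target ∧
      (∀ a ∈ Φ.source, (Φ a).1 ∈ (chartAt ℂ p).target ∧
        (chartAt ℂ p).symm (Φ a).1 ∈ ι.normalBase p ∧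
        (Φ a).2 = transverseCoord ι p (Φ a).1 a) ∧
      (∀ᶠ z in 𝓝 p, Φ (ι z) = (chartAt ℂ p z, 0)) ∧
      ∀ᶠ a in 𝓝 (ι p), ∀ t : ℂ, ‖t‖ = 1 → ψ t a ∈ Φ.source ∧ (Φ (ψ t a)).1 = (Φ a).1 := by
  obtain ⟨X, hX, hXι, hXψ⟩ := hψ.exists_retraction p
  have hps := mem_chart_source ℂ p
  have hcs := mem_chart_source (ℂ × ℂ) (ι p)
  set d := chartAt ℂ p with hd
  set c := chartAt (ℂ × ℂ) (ι p) with hc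
  set ζ₀ := d p with hζ₀
  set w₀ := c (ι p) with hw₀
  have hleft : d.symm ζ₀ = p := d.left_inv hps
  have hcleft : c.symm w₀ = ι p := c.left_inv hcs
  have hXp : X (ι p) = ζ₀ := hXι.self_of_nhds
  set Xc : ℂ × ℂ → ℂ := fun w => X (c.symm w) with hXc
  have hXcp : Xc w₀ = ζ₀ := by rw [hXc]; simp only [hcleft, hXp]
  have hcsymm : ContMDiffAt 𝓘(ℂ, ℂ × ℂ) 𝓘(ℂ, ℂ × ℂ) ω c.symm w₀ :=
    contMDiffAt_symm_of_mem_maximalAtlas (IsManifold.chart_mem_maximalAtlas _) (c.map_source hcs)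
  have hXcC : ContDiffAt ℂ ω Xc w₀ := by
    rw [← contMDiffAt_iff_contDiffAt]
    refine ContMDiffAt.comp w₀ (g := X) ?_ hcsymm
    rw [hcleft]; exact hX
  set I := ι.localMap p with hI
  have hIC : ContDiffAt ℂ ω I ζ₀ := ι.contDiffAt_localMap (ι.mem_normalBase p)
  have hIp : I ζ₀ = w₀ := by
    rw [hI, HolEmbedding.localMap, ← hd, hleft]
  set T := deriv I with hT
  have hTC : ContDiffAt ℂ ω T ζ₀ := by
    have h := hIC.fderiv_right (m := ω) (by simp)
    exact h.clm_apply contDiffAt_const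
  set Y : ℂ × ℂ → ℂ := fun w => HolEmbedding.detForm (T (Xc w)) (w - I (Xc w)) with hY
  have hTX : ContDiffAt ℂ ω (fun w => T (Xc w)) w₀ :=
    ContDiffAt.comp w₀ (g := T) (by rw [hXcp]; exact hTC) hXcC
  have hIX : ContDiffAt ℂ ω (fun w => I (Xc w)) w₀ :=
    ContDiffAt.comp w₀ (g := I) (by rw [hXcp]; exact hIC) hXcC
  have hYC : ContDiffAt ℂ ω Y w₀ := by
    simp only [hY, HolEmbedding.detForm_apply]
    have h1 := hTX.fst
    have h2 := hTX.snd
    have h3 := (contDiffAt_id (𝕜 := ℂ) (n := ω) (x := w₀)).sub hIX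
    exact (h1.mul h3.snd).sub (h2.mul h3.fst)
  -- the derivatives at the base point
  have hXd := (hXcC.differentiableAt (by simp)).hasFDerivAt
  have hId : HasFDerivAt I (ContinuousLinearMap.toSpanSingleton ℂ (T ζ₀)) ζ₀ :=
    (hIC.differentiableAt (by simp)).hasDerivAt.hasFDerivAt
  have hXT : fderiv ℂ Xc w₀ (T ζ₀) = 1 := by
    have hXd' : HasFDerivAt Xc (fderiv ℂ Xc w₀) (I ζ₀) := by rw [hIp]; exact hXd
    have h1 := hXd'.comp ζ₀ hId
    have h2 : HasFDerivAt (Xc ∘ I) (ContinuousLinearMap.id ℂ ℂ) ζ₀ := by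
      refine (hasFDerivAt_id ζ₀).congr_of_eventuallyEq ?_
      have hds : ContinuousAt d.symm ζ₀ := d.continuousAt_symm (d.map_source hps)
      have hιp : ∀ᶠ z in 𝓝 p, ι z ∈ c.source :=
        ι.continuous.continuousAt (c.open_source.mem_nhds hcs)
      have hds' : Tendsto d.symm (𝓝 ζ₀) (𝓝 p) := by
        have := hds.tendsto; rwa [hleft] at this
      filter_upwards [hds'.eventually hXι, hds'.eventually hιp,
        d.open_target.mem_nhds (d.map_source hps)] with ζ h1 h2 h3
      simp only [hXc, hI, HolEmbedding.localMap, Function.comp_apply, id]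
      rw [← hd, ← hc, c.left_inv h2, h1, d.right_inv h3]
    have h3 := congrArg (fun A : ℂ →L[ℂ] ℂ => A 1) (h1.unique h2)
    simpa using h3
  -- The variation of `T (Xc w)` does not contribute, since it is paired with `w₀ - I ζ₀ = 0`; the
  -- variation of `I (Xc w)` vanishes on the kernel of `dX`.
  have hYd : ∀ v, fderiv ℂ Xc w₀ v = 0 → fderiv ℂ Y w₀ v = HolEmbedding.detForm (T ζ₀) v := by
    intro v hv
    have hTd := (hTX.differentiableAt (by simp)).hasFDerivAt
    have hsub : HasFDerivAt (fun w => w - I (Xc w))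
        (ContinuousLinearMap.id ℂ (ℂ × ℂ) -
          (ContinuousLinearMap.toSpanSingleton ℂ (T ζ₀)).comp (fderiv ℂ Xc w₀)) w₀ := by
      refine (hasFDerivAt_id w₀).sub (HasFDerivAt.comp w₀ (g := I) ?_ hXd)
      rw [hXcp]; exact hId
    have h := (hTd.fst.mul hsub.snd).sub (hTd.snd.mul hsub.fst)
    have hYe : Y =ᶠ[𝓝 w₀] _ := Eventually.of_forall fun w => HolEmbedding.detForm_apply _ _
    rw [(h.congr_of_eventuallyEq hYe).fderiv]
    simp [hv, hXcp, hIp, HolEmbedding.detForm_apply]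
  have hinj : ∀ v, fderiv ℂ (fun w => (Xc w, Y w)) w₀ v = 0 → v = 0 := by
    intro v hv
    rw [((hXd).prodMk (hYC.differentiableAt (by simp)).hasFDerivAt).fderiv] at hv
    have hv1 : fderiv ℂ Xc w₀ v = 0 := congrArg Prod.fst hv
    have hv2 : fderiv ℂ Y w₀ v = 0 := congrArg Prod.snd hv
    rw [hYd v hv1] at hv2
    have hT0 : T ζ₀ ≠ 0 := by
      intro h; rw [h, map_zero] at hXT; exact zero_ne_one hXT
    obtain ⟨s, rfl⟩ := HolEmbedding.exists_of_detForm_eq_zero hT0 hv2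
    rw [map_smul, hXT, smul_eq_mul, mul_one] at hv1
    rw [hv1, zero_smul]
  obtain ⟨e, he0, hef, heC, heC'⟩ := exists_openPartialHomeomorph_of_fderiv_injective (by simp)
    (by simp) (hXcC.prodMk hYC) hinj
  -- the domain of the chart
  have hdom : ∀ᶠ a in 𝓝 (ι p), X a ∈ d.target ∧ d.symm (X a) ∈ ι.normalBase p := by
    have h1 : ∀ᶠ ζ in 𝓝 ζ₀, ζ ∈ d.target ∧ d.symm ζ ∈ ι.normalBase p := by
      have hds : ContinuousAt d.symm ζ₀ := d.continuousAt_symm (d.map_source hps)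
      refine Eventually.and (show ∀ᶠ ζ in 𝓝 ζ₀, ζ ∈ d.target from
        d.open_target.mem_nhds (d.map_source hps)) ?_
      refine hds ((ι.isOpen_normalBase p).mem_nhds ?_)
      rw [hleft]; exact ι.mem_normalBase p
    have h2 := hX.continuousAt.tendsto
    rw [hXp] at h2
    exact h2.eventually h1
  obtain ⟨V, hV, hVo, hpV⟩ := eventually_nhds_iff.1 hdom
  have hΦ : ∀ a ∈ c.source, (e (c a)) = (X a, Y (c a)) := by
    intro a ha
    rw [hef, hXc]
    simp only [c.left_inv ha]
  have hYa : ∀ a ∈ c.source, a ∈ V → Y (c a) = transverseCoord ι p (X a) a := by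
    intro a ha haV
    have h1 := hV a haV
    rw [transverseCoord, ι.tangentVec_eq_deriv h1.2, ← hd, ← hc, d.right_inv h1.1]
    simp only [hY, hXc, c.left_inv ha, hT, hI]
  set Φ := (c.trans e).restrOpen V hVo with hΦdef
  have hΦa : ∀ a, Φ a = e (c a) := fun a => rfl
  have hsrc : ∀ a, a ∈ Φ.source ↔ (a ∈ c.source ∧ c a ∈ e.source) ∧ a ∈ V := by
    intro a
    rw [hΦdef, OpenPartialHomeomorph.restrOpen_source, OpenPartialHomeomorph.trans_source]
    rfl
  have hpΦ : ι p ∈ Φ.source := (hsrc _).2 ⟨⟨hcs, he0⟩, hpV⟩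
  refine ⟨Φ, hpΦ, fun a ha => ((hsrc a).1 ha).1.1, ?_, ?_, ?_, ?_, ?_⟩
  · intro a ha
    have ha' := (hsrc a).1 ha
    have h1 : ContMDiffAt 𝓘(ℂ, ℂ × ℂ) 𝓘(ℂ, ℂ × ℂ) ω c a :=
      contMDiffAt_of_mem_maximalAtlas (IsManifold.chart_mem_maximalAtlas _) ha'.1.1
    have h2 : ContMDiffAt 𝓘(ℂ, ℂ × ℂ) 𝓘(ℂ, ℂ × ℂ) ω e (c a) :=
      (heC.contDiffAt (e.open_source.mem_nhds ha'.1.2)).contMDiffAt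
    exact (h2.comp a h1).contMDiffWithinAt
  · intro w hw
    have hw' := (hsrc _).1 (Φ.map_target hw)
    have hwe : w ∈ e.target := by
      have := hw
      rw [hΦdef, OpenPartialHomeomorph.restrOpen_toPartialEquiv, PartialEquiv.restr_target] at this
      exact this.1.1
    have hwc : e.symm w ∈ c.target := by
      have := hw
      rw [hΦdef, OpenPartialHomeomorph.restrOpen_toPartialEquiv, PartialEquiv.restr_target] at this
      exact this.1.2
    have h1 : ContMDiffAt 𝓘(ℂ, ℂ × ℂ) 𝓘(ℂ, ℂ × ℂ) ω e.symm w :=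
      (heC'.contDiffAt (e.open_target.mem_nhds hwe)).contMDiffAt
    have h2 : ContMDiffAt 𝓘(ℂ, ℂ × ℂ) 𝓘(ℂ, ℂ × ℂ) ω c.symm (e.symm w) :=
      contMDiffAt_symm_of_mem_maximalAtlas (IsManifold.chart_mem_maximalAtlas _) hwc
    exact (h2.comp w h1).contMDiffWithinAt
  · intro a ha
    have ha' := (hsrc a).1 ha
    rw [hΦa, hΦ a ha'.1.1]
    exact ⟨(hV a ha'.2).1, (hV a ha'.2).2, hYa a ha'.1.1 ha'.2⟩
  · filter_upwards [hXι, ι.continuous.continuousAt (Φ.open_source.mem_nhds hpΦ),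
      d.open_source.mem_nhds hps] with z hz hzΦ hzd
    have ha' := (hsrc _).1 hzΦ
    rw [hΦa, hΦ _ ha'.1.1, hYa _ ha'.1.1 ha'.2, hz, transverseCoord, HolEmbedding.localMap,
      ← hd, d.left_inv hzd, sub_self, map_zero]
  · have hK0 : ∀ t ∈ Metric.sphere (0 : ℂ) 1, t ∈ puncturedDisc R := by
      intro t ht
      have : ‖t‖ = 1 := by simpa using ht
      exact hψ.mem_of_norm_le_one (by rw [← norm_pos_iff, this]; exact one_pos) this.le
    filter_upwards [hXψ, hψ.eventually_forall_mem (isCompact_sphere (0 : ℂ) 1) hK0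
      (Φ.open_source.mem_nhds hpΦ), Φ.open_source.mem_nhds hpΦ] with a h1 h2 h3 t ht
    have h4 := h2 t (by simpa using ht)
    refine ⟨h4, ?_⟩
    rw [hΦa, hΦa, hΦ _ ((hsrc _).1 h4).1.1, hΦ _ ((hsrc _).1 h3).1.1]
    exact h1 t ht

end IsTransverseActionOn

/-! ### Linearization near a point of the Riemann surface -/

namespace IsTransverseActionOn

variable {σ S : Type*} [TopologicalSpace σ] [ChartedSpace ℂ σ]
  [TopologicalSpace S] [ChartedSpace (ℂ × ℂ) S]
  {ι : HolEmbedding σ S} {ψ : ℂ → S → S} {R : ℝ} {U : Set S}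

/-- An action which is linear over the circle in a chart is linear over an annulus. -/
theorem exists_annulus_linear (hψ : IsTransverseActionOn ι ψ R U) {p : σ} {q : ℤ}
    {Φ : OpenPartialHomeomorph S (ℂ × ℂ)} (hp : ι p ∈ Φ.source)
    (hΦ : MDifferentiableOn 𝓘(ℂ, ℂ × ℂ) 𝓘(ℂ, ℂ × ℂ) Φ Φ.source)
    (hlin : ∀ᶠ a in 𝓝 (ι p), ∀ s : ℂ, ‖s‖ = 1 → Φ (ψ s a) = ((Φ a).1, s ^ q * (Φ a).2)) :
    ∃ ρ : ℝ, 1 < ρ ∧ ρ < R ∧ ∀ᶠ a in 𝓝 (ι p), ∀ s : ℂ, ρ⁻¹ < ‖s‖ → ‖s‖ < ρ →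
      ψ s a ∈ Φ.source ∧ Φ (ψ s a) = ((Φ a).1, s ^ q * (Φ a).2) := by
  obtain ⟨ρ, hρ1, hρR⟩ := exists_between hψ.one_lt
  have hρ0 : 0 < ρ := one_pos.trans hρ1
  refine ⟨ρ, hρ1, hρR, ?_⟩
  set K : Set ℂ := {s | ρ⁻¹ ≤ ‖s‖ ∧ ‖s‖ ≤ ρ} with hKdef
  have hKcl : IsClosed K :=
    (isClosed_le continuous_const continuous_norm).inter
      (isClosed_le continuous_norm continuous_const)
  have hK : IsCompact K := (isCompact_closedBall (0 : ℂ) ρ).of_isClosed_subset hKcl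
    fun s hs => by simpa using hs.2
  have hKR : K ⊆ puncturedDisc R := fun s hs =>
    ⟨norm_pos_iff.1 ((inv_pos.2 hρ0).trans_le hs.1), hs.2.trans_lt hρR⟩
  filter_upwards [hlin, hψ.mem_nhds p, hψ.eventually_forall_mem hK hKR
    (Φ.open_source.mem_nhds hp)] with a h1 haU h2 s hs1 hs2
  refine ⟨h2 s ⟨hs1.le, hs2.le⟩, ?_⟩
  -- The logarithm replaces the annulus by a vertical strip, which is convex; the circle becomes the
  -- imaginary axis, on which equality is known and which accumulates at `0`.
  set D : Set ℂ := {z | -Real.log ρ < z.re} ∩ {z | z.re < Real.log ρ} with hD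
  have hDo : IsOpen D := (isOpen_lt continuous_const Complex.continuous_re).inter
    (isOpen_lt Complex.continuous_re continuous_const)
  have hDc : IsPreconnected D :=
    ((convex_halfSpace_re_gt _).inter (convex_halfSpace_re_lt _)).isPreconnected
  have hDK : ∀ z ∈ D, Complex.exp z ∈ K := by
    rintro z ⟨hz1, hz2⟩
    rw [hKdef, mem_ofPred_eq, Complex.norm_exp]
    constructor
    · have h3 := (Real.exp_lt_exp.2 hz1).le
      rwa [Real.exp_neg, Real.exp_log hρ0] at h3
    · have h3 := (Real.exp_lt_exp.2 hz2).le
      rwa [Real.exp_log hρ0] at h3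
  have hlogρ : 0 < Real.log ρ := Real.log_pos hρ1
  have h0D : (0 : ℂ) ∈ D := by constructor <;> simp [hlogρ]
  have hF : DifferentiableOn ℂ (fun z => Φ (ψ (Complex.exp z) a)) D := by
    intro z hz
    have h3 := hψ.mdifferentiableAt_orbit (hKR (hDK z hz)) haU
    have h4 : MDifferentiableAt 𝓘(ℂ, ℂ) 𝓘(ℂ, ℂ) Complex.exp z :=
      Complex.differentiable_exp.differentiableAt.mdifferentiableAt
    have h5 : MDifferentiableAt 𝓘(ℂ, ℂ) 𝓘(ℂ, ℂ × ℂ) (fun z => ψ (Complex.exp z) a) z :=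
      MDifferentiableAt.comp z (g := fun t => ψ t a) h3 h4
    have h6 := (hΦ _ (h2 _ (hDK z hz))).mdifferentiableAt
      (Φ.open_source.mem_nhds (h2 _ (hDK z hz)))
    exact (MDifferentiableAt.comp z (g := Φ) h6 h5).differentiableAt.differentiableWithinAt
  have hG : DifferentiableOn ℂ (fun z => ((Φ a).1, Complex.exp z ^ q * (Φ a).2)) D := by
    simp only [← Complex.exp_int_mul]
    fun_prop
  have heq := (hF.analyticOnNhd hDo).eqOn_of_preconnected_of_frequently_eq
    (hG.analyticOnNhd hDo) hDc h0D (by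
      have ht : Tendsto (fun θ : ℝ => (θ * Complex.I : ℂ)) (𝓝[≠] 0) (𝓝[≠] 0) := by
        refine tendsto_nhdsWithin_iff.2 ⟨?_, ?_⟩
        · have : ContinuousAt (fun θ : ℝ => (θ * Complex.I : ℂ)) 0 := by fun_prop
          simpa [ContinuousAt] using this.tendsto.mono_left nhdsWithin_le_nhds
        · filter_upwards [self_mem_nhdsWithin] with θ hθ
          simpa using hθ
      refine ht.frequently (Eventually.frequently (Eventually.of_forall fun θ => ?_))
      exact h1 _ (Complex.norm_exp_ofReal_mul_I θ))
  have hs0 : s ≠ 0 := norm_pos_iff.1 ((inv_pos.2 hρ0).trans hs1)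
  have hsD : Complex.log s ∈ D := by
    constructor
    · rw [mem_ofPred_eq, Complex.log_re, ← Real.log_inv]
      exact Real.log_lt_log (inv_pos.2 hρ0) hs1
    · rw [mem_ofPred_eq, Complex.log_re]
      exact Real.log_lt_log (norm_pos_iff.2 hs0) hs2
  have := heq hsD
  simpa only [Complex.exp_log hs0] using this

variable [IsManifold 𝓘(ℂ, ℂ) ω σ] [IsManifold 𝓘(ℂ, ℂ × ℂ) ω S]

/-- The fibre coordinate of an adapted chart is replaced by its linearizer, which preserves `X` and
has invertible derivative. The formula of the last clause is kept because it later identifies the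
new coordinate with one of the normal bundle. -/
theorem exists_circle_linear_chart [SecondCountableTopology S] (hψ : IsTransverseActionOn ι ψ R U)
    (p : σ) :
    ∃ (q : ℤ) (Φ : OpenPartialHomeomorph S (ℂ × ℂ)), ι p ∈ Φ.source ∧
      Φ.source ⊆ (chartAt (ℂ × ℂ) (ι p)).source ∧
      MDifferentiableOn 𝓘(ℂ, ℂ × ℂ) 𝓘(ℂ, ℂ × ℂ) Φ Φ.source ∧
      MDifferentiableOn 𝓘(ℂ, ℂ × ℂ) 𝓘(ℂ, ℂ × ℂ) Φ.symm Φ.target ∧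
      (∀ a ∈ Φ.source, (Φ a).1 ∈ (chartAt ℂ p).target ∧
        (chartAt ℂ p).symm (Φ a).1 ∈ ι.normalBase p) ∧
      (∀ᶠ z in 𝓝 p, Φ (ι z) = (chartAt ℂ p z, 0)) ∧
      (∀ᶠ a in 𝓝 (ι p), ∀ s : ℂ, ‖s‖ = 1 → Φ (ψ s a) = ((Φ a).1, s ^ q * (Φ a).2)) ∧
      ∀ᶠ a in 𝓝 (ι p), (Φ a).2 = Real.circleAverage
        (fun t => t ^ (-q) * transverseCoord ι p (Φ a).1 (ψ t a)) 0 1 := by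
  obtain ⟨Φ, hp, hsub, hΦ, hΦ', hbase, hι, hcirc⟩ := hψ.exists_adapted_chart p
  have hps := mem_chart_source ℂ p
  have hpU : ι p ∈ U := hψ.range_subset (mem_range_self p)
  set d := chartAt ℂ p with hd
  set ζ₀ := d p with hζ₀
  have hΦp : Φ (ι p) = (ζ₀, 0) := hι.self_of_nhds
  have hΦs : Φ.symm (ζ₀, 0) = ι p := by rw [← hΦp, Φ.left_inv hp]
  have hcirc_mem : ∀ t : ℂ, ‖t‖ = 1 → t ∈ puncturedDisc R := fun t ht =>
    hψ.mem_of_norm_le_one (by rw [← norm_pos_iff, ht]; exact one_pos) ht.le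
  have hw₀ : (ζ₀, (0 : ℂ)) ∈ Φ.target := by rw [← hΦp]; exact Φ.map_source hp
  have hsymm : Tendsto Φ.symm (𝓝 (ζ₀, 0)) (𝓝 (ι p)) := by
    have := (Φ.continuousAt_symm hw₀).tendsto
    rwa [hΦs] at this
  set f : ℂ → ℂ × ℂ → ℂ := fun t w => (Φ (ψ t (Φ.symm w))).2 with hf
  have hfΦ : ∀ a ∈ Φ.source, ∀ t, f t (Φ a) = (Φ (ψ t a)).2 := by
    intro a ha t
    simp only [hf, Φ.left_inv ha]
  obtain ⟨q, hC, hD, hlin⟩ := exists_linearizer (f := f) (ζ₀ := ζ₀) (by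
    intro t ht
    rw [← contMDiffAt_iff_contDiffAt]
    have h1 : ContMDiffAt 𝓘(ℂ, ℂ × (ℂ × ℂ)) (𝓘(ℂ, ℂ).prod 𝓘(ℂ, ℂ × ℂ)) ω
        (fun z : ℂ × (ℂ × ℂ) => (z.1, Φ.symm z.2)) (t, (ζ₀, 0)) := by
      refine (contDiffAt_fst (𝕜 := ℂ) (E := ℂ) (F := ℂ × ℂ)).contMDiffAt.prodMk ?_
      exact ContMDiffAt.comp (t, (ζ₀, (0 : ℂ))) (g := Φ.symm)
        (hΦ'.contMDiffAt (Φ.open_target.mem_nhds hw₀))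
        (contDiffAt_snd (𝕜 := ℂ) (E := ℂ) (F := ℂ × ℂ)).contMDiffAt
    have h2 : ContMDiffAt 𝓘(ℂ, ℂ × (ℂ × ℂ)) 𝓘(ℂ, ℂ × ℂ) ω
        (fun z : ℂ × (ℂ × ℂ) => ψ z.1 (Φ.symm z.2)) (t, (ζ₀, 0)) := by
      refine ContMDiffAt.comp (t, (ζ₀, (0 : ℂ))) (g := fun z : ℂ × S => ψ z.1 z.2) ?_ h1
      simp only [hΦs]
      exact hψ.contMDiffAt (hcirc_mem t ht) hpU
    have h3 : ContMDiffAt 𝓘(ℂ, ℂ × (ℂ × ℂ)) 𝓘(ℂ, ℂ × ℂ) ω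
        (fun z : ℂ × (ℂ × ℂ) => Φ (ψ z.1 (Φ.symm z.2))) (t, (ζ₀, 0)) := by
      refine ContMDiffAt.comp (t, (ζ₀, (0 : ℂ))) (g := Φ) ?_ h2
      simp only [hΦs, hψ.map_fixed t (hcirc_mem t ht) p]
      exact hΦ.contMDiffAt (Φ.open_source.mem_nhds hp)
    exact (contDiffAt_snd (𝕜 := ℂ) (E := ℂ) (F := ℂ)).contMDiffAt.comp _ h3) (by
    have hds : Tendsto d.symm (𝓝 ζ₀) (𝓝 p) := by
      have := (d.continuousAt_symm (d.map_source hps)).tendsto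
      rwa [← hζ₀, d.left_inv hps] at this
    filter_upwards [hds.eventually hι, d.open_target.mem_nhds (d.map_source hps),
      hds.eventually (ι.continuous.continuousAt (Φ.open_source.mem_nhds hp))] with ζ h1 h2 h3 t ht
    rw [d.right_inv h2] at h1
    simp only [hf]
    rw [← h1, Φ.left_inv h3, hψ.map_fixed t (hcirc_mem t ht), h1]) (by
    filter_upwards [hsymm.eventually (hψ.mem_nhds p), Φ.open_target.mem_nhds hw₀] with w h1 h2
    simp only [hf]
    rw [hψ.map_one _ h1, Φ.right_inv h2]) (by
    have hU := hψ.eventually_forall_mem (isCompact_sphere (0 : ℂ) 1)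
      (fun t ht => hcirc_mem t (by simpa using ht)) (hψ.mem_nhds p)
    filter_upwards [hsymm.eventually hcirc, hsymm.eventually hU, Φ.open_target.mem_nhds hw₀,
      hsymm.eventually (hψ.mem_nhds p)] with w h1 h2 h3 h4 s t hs ht
    have hst : ‖s * t‖ = 1 := by rw [norm_mul, hs, ht, mul_one]
    obtain ⟨h5, h6⟩ := h1 t ht
    -- The circle preserves the first coordinate, so following the second one suffices to compose
    -- two times.
    have h7 : ((w.1, f t w) : ℂ × ℂ) = Φ (ψ t (Φ.symm w)) := by
      rw [Φ.right_inv h3] at h6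
      exact Prod.ext h6.symm rfl
    rw [h7]
    simp only [hf]
    rw [Φ.left_inv h5, hψ.map_mul s (hcirc_mem s hs) t (hcirc_mem t ht) (hcirc_mem _ hst) _ h4
      (h2 t (by simpa using ht))])
  set H := linearizer q f with hH
  obtain ⟨e, he0, hee, heC, heC'⟩ := exists_openPartialHomeomorph_of_fderiv_injective (n := 1)
    (by simp) (by simp) (contDiffAt_fst.prodMk hC) (by
      intro v hv
      rw [(hasFDerivAt_fst.prodMk hD).fderiv] at hv
      exact hv)
  have heΦ : ∀ a, (Φ.trans e) a = ((Φ a).1, H (Φ a)) := by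
    intro a
    rw [OpenPartialHomeomorph.coe_trans, Function.comp_apply, hee]
  have hΦc : Tendsto Φ (𝓝 (ι p)) (𝓝 (ζ₀, 0)) := by
    have := (Φ.continuousAt hp).tendsto
    rwa [hΦp] at this
  refine ⟨q, Φ.trans e, ?_, ?_, ?_, ?_, ?_, ?_, ?_, ?_⟩
  · rw [OpenPartialHomeomorph.trans_source]
    exact ⟨hp, by rw [mem_preimage, hΦp]; exact he0⟩
  · intro a ha
    rw [OpenPartialHomeomorph.trans_source] at ha
    exact hsub ha.1
  · intro a ha
    rw [OpenPartialHomeomorph.trans_source] at ha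
    have h1 := ((hΦ.contMDiffAt (Φ.open_source.mem_nhds ha.1))).mdifferentiableAt (by simp)
    have h2 : MDifferentiableAt 𝓘(ℂ, ℂ × ℂ) 𝓘(ℂ, ℂ × ℂ) e (Φ a) :=
      ((heC.contDiffAt (e.open_source.mem_nhds ha.2)).differentiableAt
        (by simp)).mdifferentiableAt
    exact (h2.comp a h1).mdifferentiableWithinAt
  · intro w hw
    rw [OpenPartialHomeomorph.trans_target] at hw
    have h1 : MDifferentiableAt 𝓘(ℂ, ℂ × ℂ) 𝓘(ℂ, ℂ × ℂ) e.symm w :=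
      ((heC'.contDiffAt (e.open_target.mem_nhds hw.1)).differentiableAt
        (by simp)).mdifferentiableAt
    have h2 : MDifferentiableAt 𝓘(ℂ, ℂ × ℂ) 𝓘(ℂ, ℂ × ℂ) Φ.symm (e.symm w) :=
      (hΦ'.contMDiffAt (Φ.open_target.mem_nhds hw.2)).mdifferentiableAt (by simp)
    exact (h2.comp w h1).mdifferentiableWithinAt
  · intro a ha
    rw [OpenPartialHomeomorph.trans_source] at ha
    rw [heΦ]
    exact ⟨(hbase a ha.1).1, (hbase a ha.1).2.1⟩
  · filter_upwards [hι, ι.continuous.continuousAt (Φ.open_source.mem_nhds hp)] with z hz hz'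
    rw [heΦ, hz]
    refine Prod.ext rfl ?_
    simp only [hH, linearizer]
    rw [Real.circleAverage_congr_sphere (f₂ := fun _ => 0), Real.circleAverage_const]
    intro t ht
    have ht : ‖t‖ = 1 := by simpa using ht
    change t ^ (-q) * f t (d z, 0) = 0
    rw [← hz, hfΦ _ hz', hψ.map_fixed t (hcirc_mem t ht), hz, mul_zero]
  · filter_upwards [hΦc.eventually hlin, hcirc, Φ.open_source.mem_nhds hp] with a h1 h2 h3 s hs
    have h4 : Φ (ψ s a) = ((Φ a).1, f s (Φ a)) := Prod.ext (h2 s hs).2 (hfΦ a h3 s).symm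
    rw [heΦ, heΦ, h4, h1 s hs]
  · filter_upwards [hcirc, Φ.open_source.mem_nhds hp] with a h2 h3
    rw [heΦ]
    simp only [hH, linearizer]
    refine Real.circleAverage_congr_sphere fun t ht => ?_
    have ht : ‖t‖ = 1 := by simpa using ht
    change t ^ (-q) * f t (Φ a) = t ^ (-q) * transverseCoord ι p (Φ a).1 (ψ t a)
    rw [hfΦ a h3, (hbase _ (h2 t ht).1).2.2, (h2 t ht).2]

end IsTransverseActionOn

/-! ### Invariant boxes -/

section Box

variable {σ S : Type*} [TopologicalSpace σ] [ChartedSpace ℂ σ]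
  [TopologicalSpace S] [ChartedSpace (ℂ × ℂ) S]
  [IsManifold 𝓘(ℂ, ℂ) ω σ] [IsManifold 𝓘(ℂ, ℂ × ℂ) ω S]

open IsTransverseActionOn in
/-- A chart of `S` at `ι p`, onto a product of two discs, which is compatible with the chart at `p`
and in which the restriction of `ψ` to the punctured closed unit disc is linear. -/
structure IsLinearChart (ι : HolEmbedding σ S) (ψ : ℂ → S → S) (U : Set S) (p : σ) (q : ℕ)
    (Φ : OpenPartialHomeomorph S (ℂ × ℂ)) (r : ℝ) : Prop where
  pos : 0 < r
  mem_source : ι p ∈ Φ.source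
  subset : Φ.source ⊆ U
  source_subset : Φ.source ⊆ (chartAt (ℂ × ℂ) (ι p)).source
  target_eq : Φ.target = Metric.ball (chartAt ℂ p p) r ×ˢ Metric.ball 0 r
  mdifferentiable : Φ.MDifferentiable 𝓘(ℂ, ℂ × ℂ) 𝓘(ℂ, ℂ × ℂ)
  base : ∀ a ∈ Φ.source, (Φ a).1 ∈ (chartAt ℂ p).target ∧
    (chartAt ℂ p).symm (Φ a).1 ∈ ι.normalBase p
  symm_zero : ∀ ζ ∈ Metric.ball (chartAt ℂ p p) r, Φ.symm (ζ, 0) = ι ((chartAt ℂ p).symm ζ)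
  snd_eq : ∀ a ∈ Φ.source, (Φ a).2 = Real.circleAverage
    (fun t => t ^ (-q : ℤ) * transverseCoord ι p (Φ a).1 (ψ t a)) 0 1
  action : ∀ a ∈ Φ.source, ∀ s : ℂ, s ≠ 0 → ‖s‖ ≤ 1 →
    ψ s a ∈ Φ.source ∧ Φ (ψ s a) = ((Φ a).1, s ^ q * (Φ a).2)

end Box

namespace IsTransverseActionOn

variable {σ S : Type*} [TopologicalSpace σ] [ChartedSpace ℂ σ]
  [TopologicalSpace S] [ChartedSpace (ℂ × ℂ) S]
  {ι : HolEmbedding σ S} {ψ : ℂ → S → S} {R : ℝ} {U : Set S}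

/-- Suppose `q ≤ 0` and let `ψ t a` approach `ι p` with `t → 0` and `a` off `σ`. Going back from `ψ
t a` to `a` uses multipliers of modulus at least `1`, which do not increase the fibre coordinate, so
the way back stays in the chart. Then `Φ a` has fibre coordinate `t ^ (-q)` times one tending to
`0`, and `a = ι p` in the limit. -/
theorem exponent_pos [T2Space S] [IsManifold 𝓘(ℂ, ℂ × ℂ) ω S]
    (hψ : IsTransverseActionOn ι ψ R U) {p : σ} {q : ℤ}
    {Φ : OpenPartialHomeomorph S (ℂ × ℂ)} {ρ : ℝ} (hp : ι p ∈ Φ.source) (hΦp : (Φ (ι p)).2 = 0)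
    (hU : Φ.source ⊆ U) (hρ1 : 1 < ρ) (hρR : ρ < R)
    (hann : ∀ a ∈ Φ.source, ∀ s : ℂ, ρ⁻¹ < ‖s‖ → ‖s‖ < ρ → ‖s ^ q‖ ≤ 1 →
      ψ s a ∈ Φ.source ∧ Φ (ψ s a) = ((Φ a).1, s ^ q * (Φ a).2)) : 0 < q := by
  by_contra hq
  push Not at hq
  obtain ⟨a, ha, u, hu, hlim⟩ := hψ.exists_tendsto p
  obtain ⟨ρ₁, hρ₁, hρ₁ρ⟩ := exists_between hρ1
  have hρ₁0 : 0 < ρ₁ := one_pos.trans hρ₁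
  have hann' : ∀ b ∈ Φ.source, ∀ s : ℂ, 1 ≤ ‖s‖ → ‖s‖ ≤ ρ₁ →
      ψ s b ∈ Φ.source ∧ Φ (ψ s b) = ((Φ b).1, s ^ q * (Φ b).2) := by
    intro b hb s hs hs'
    refine hann b hb s ((inv_lt_one_of_one_lt₀ hρ1).trans_le hs) (hs'.trans_lt hρ₁ρ) ?_
    rw [norm_zpow]
    exact zpow_le_one_of_nonpos₀ hs hq
  have hback : ∀ t : ℂ, t ≠ 0 → ‖t‖ ≤ 1 → 1 < ρ₁ * ‖t‖ → ψ t a ∈ Φ.source →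
      a ∈ Φ.source ∧ Φ a = ((Φ (ψ t a)).1, t ^ (-q) * (Φ (ψ t a)).2) := by
    intro t ht0 ht1 ht ha'
    have htp : 0 < ‖t‖ := norm_pos_iff.2 ht0
    have h1 : 1 ≤ ‖t⁻¹‖ := by rw [norm_inv]; exact (one_le_inv₀ htp).2 ht1
    have h2 : ‖t⁻¹‖ ≤ ρ₁ := by
      rw [norm_inv, inv_le_iff_one_le_mul₀ htp]; exact ht.le
    have h3 := hann' _ ha' t⁻¹ h1 h2
    have h4 : ψ t⁻¹ (ψ t a) = a := by
      rw [← hψ.map_mul t⁻¹ ⟨inv_ne_zero ht0, h2.trans_lt (hρ₁ρ.trans hρR)⟩ t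
        (hψ.mem_of_norm_le_one ht0 ht1) (by
          rw [inv_mul_cancel₀ ht0]; exact hψ.mem_of_norm_le_one one_ne_zero norm_one.le) a ha.1
        (hU ha'), inv_mul_cancel₀ ht0, hψ.map_one a ha.1]
    rw [h4, inv_zpow'] at h3
    exact h3
  -- The way back is cut into multiplications of the time by `ρ₁`, and a last step by `t⁻¹` when `ρ₁
  -- * |t| > 1`; `n` bounds their number.
  have hpow : ∀ n : ℕ, ∀ t : ℂ, t ≠ 0 → ‖t‖ ≤ 1 → 1 < ρ₁ ^ n * ‖t‖ → ψ t a ∈ Φ.source →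
      a ∈ Φ.source ∧ Φ a = ((Φ (ψ t a)).1, t ^ (-q) * (Φ (ψ t a)).2) := by
    intro n
    induction n with
    | zero =>
      intro t _ ht1 ht
      rw [pow_zero, one_mul] at ht
      exact absurd ht1 (not_le.2 ht)
    | succ n ih =>
      intro t ht0 ht1 ht ha'
      by_cases hcase : 1 < ρ₁ * ‖t‖
      · exact hback t ht0 ht1 hcase ha'
      have hs : ‖(ρ₁ : ℂ)‖ = ρ₁ := by rw [Complex.norm_real, Real.norm_of_nonneg hρ₁0.le]
      have hs0 : (ρ₁ : ℂ) ≠ 0 := by exact_mod_cast hρ₁0.ne'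
      have hst : ‖(ρ₁ : ℂ) * t‖ = ρ₁ * ‖t‖ := by rw [norm_mul, hs]
      have h1 := hann' _ ha' ρ₁ (by rw [hs]; exact hρ₁.le) hs.le
      have hst1 : ‖(ρ₁ : ℂ) * t‖ ≤ 1 := by rw [hst]; exact not_lt.1 hcase
      have h2 : ψ (ρ₁ * t) a = ψ ρ₁ (ψ t a) :=
        hψ.map_mul _ ⟨hs0, by rw [hs]; exact hρ₁ρ.trans hρR⟩ t (hψ.mem_of_norm_le_one ht0 ht1)
          (hψ.mem_of_norm_le_one (mul_ne_zero hs0 ht0) hst1) a ha.1 (hU ha')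
      rw [← h2] at h1
      have h3 := ih (ρ₁ * t) (mul_ne_zero hs0 ht0) hst1 (by rw [hst, ← mul_assoc, ← pow_succ]; exact ht) h1.1
      refine ⟨h3.1, h3.2.trans ?_⟩
      rw [h1.2]
      refine Prod.ext rfl ?_
      change (ρ₁ * t : ℂ) ^ (-q) * (ρ₁ ^ q * _) = _
      rw [mul_zpow, zpow_neg (ρ₁ : ℂ)]
      have := zpow_ne_zero q hs0
      field_simp
  have hev : ∀ᶠ t in (u : Filter ℂ), t ≠ 0 ∧ ‖t‖ ≤ 1 := by
    refine hu ?_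
    filter_upwards [self_mem_nhdsWithin,
      mem_nhdsWithin_of_mem_nhds (Metric.closedBall_mem_nhds (0 : ℂ) one_pos)] with t h1 h2
    exact ⟨h1, by simpa using h2⟩
  have hmain : ∀ᶠ t in (u : Filter ℂ), a ∈ Φ.source ∧
      Φ a = ((Φ (ψ t a)).1, t ^ (-q) * (Φ (ψ t a)).2) := by
    filter_upwards [hev, hlim.eventually (Φ.open_source.mem_nhds hp)] with t ht ha'
    obtain ⟨n, hn⟩ := pow_unbounded_of_one_lt ‖t‖⁻¹ hρ₁
    refine hpow n t ht.1 ht.2 ?_ ha'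
    rwa [← inv_lt_iff_one_lt_mul₀ (norm_pos_iff.2 ht.1)]
  have hΦlim : Tendsto (fun t => Φ (ψ t a)) u (𝓝 (Φ (ι p))) :=
    (Φ.continuousAt hp).tendsto.comp hlim
  have h1 : Tendsto (fun t => (Φ (ψ t a)).1) u (𝓝 (Φ (ι p)).1) :=
    (continuous_fst.tendsto _).comp hΦlim
  have h2 : Tendsto (fun t => (Φ (ψ t a)).2) u (𝓝 0) := by
    rw [← hΦp]; exact (continuous_snd.tendsto _).comp hΦlim
  have h3 : Tendsto (fun t => t ^ (-q) * (Φ (ψ t a)).2) u (𝓝 0) := by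
    refine squeeze_zero_norm' ?_ (tendsto_zero_iff_norm_tendsto_zero.1 h2)
    filter_upwards [hev] with t ht
    rw [norm_mul, norm_zpow]
    refine mul_le_of_le_one_left (norm_nonneg _) ?_
    obtain ⟨k, hk⟩ := Int.eq_ofNat_of_zero_le (neg_nonneg.2 hq)
    rw [hk, zpow_natCast]
    exact pow_le_one₀ (norm_nonneg _) ht.2
  have h4 : Φ a = Φ (ι p) := by
    refine tendsto_nhds_unique (tendsto_const_nhds.congr' ?_)
      ((h1.prodMk_nhds h3).trans_eq ?_)
    · exact hmain.mono fun t ht => ht.2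
    · rw [← hΦp]
  obtain ⟨t, ht⟩ := hmain.exists
  exact ha.2 ⟨p, (Φ.injOn ht.1 hp h4).symm⟩

variable [IsManifold 𝓘(ℂ, ℂ) ω σ] [IsManifold 𝓘(ℂ, ℂ × ℂ) ω S]

/-- The circle-linear chart is cut down to a bidisc. Contracting multipliers preserve the bidisc, so
linearity over the annulus can be iterated down to all times of modulus at most one. -/
theorem exists_isLinearChart [T2Space S] [SecondCountableTopology S]
    (hψ : IsTransverseActionOn ι ψ R U) (p : σ) :
    ∃ (q : ℕ) (Φ : OpenPartialHomeomorph S (ℂ × ℂ)) (r : ℝ), 0 < q ∧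
      IsLinearChart ι ψ U p q Φ r := by
  obtain ⟨q, Φ, hp, hsub, hΦ, hΦ', hbase, hι, hcirc, havg⟩ := hψ.exists_circle_linear_chart p
  obtain ⟨ρ, hρ1, hρR, hann⟩ := hψ.exists_annulus_linear hp hΦ hcirc
  have hps := mem_chart_source ℂ p
  set d := chartAt ℂ p with hd
  set ζ₀ := d p with hζ₀
  have hΦp : Φ (ι p) = (ζ₀, 0) := hι.self_of_nhds
  have hΦs : Φ.symm (ζ₀, 0) = ι p := by rw [← hΦp, Φ.left_inv hp]
  have hw₀ : (ζ₀, (0 : ℂ)) ∈ Φ.target := by rw [← hΦp]; exact Φ.map_source hp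
  have hsymm : Tendsto Φ.symm (𝓝 (ζ₀, 0)) (𝓝 (ι p)) := by
    have := (Φ.continuousAt_symm hw₀).tendsto
    rwa [hΦs] at this
  have hzero : ∀ᶠ ζ in 𝓝 ζ₀, Φ.symm (ζ, 0) = ι (d.symm ζ) := by
    have hds : Tendsto d.symm (𝓝 ζ₀) (𝓝 p) := by
      have := (d.continuousAt_symm (d.map_source hps)).tendsto
      rwa [← hζ₀, d.left_inv hps] at this
    filter_upwards [hds.eventually hι, d.open_target.mem_nhds (d.map_source hps),
      hds.eventually (ι.continuous.continuousAt (Φ.open_source.mem_nhds hp))] with ζ h1 h2 h3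
    rw [d.right_inv h2] at h1
    rw [← h1, Φ.left_inv h3]
  -- The two placeholders stand for the averaging formula `havg` and the annulus formula `hann`; a
  -- ball for the sup norm on which all hold is a product of discs.
  have hgood : ∀ᶠ w in 𝓝 (ζ₀, (0 : ℂ)), w ∈ Φ.target ∧ Φ.symm (w.1, 0) = ι (d.symm w.1) ∧
      Φ.symm w ∈ U ∧ _ ∧ _ :=
    (show ∀ᶠ w in 𝓝 (ζ₀, (0 : ℂ)), w ∈ Φ.target from Φ.open_target.mem_nhds hw₀).and
      ((((continuous_fst.tendsto (ζ₀, (0 : ℂ))).eventually hzero)).and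
        ((hsymm.eventually (hψ.mem_nhds p)).and ((hsymm.eventually havg).and
          (hsymm.eventually hann))))
  obtain ⟨r, hr, hball⟩ := Metric.eventually_nhds_iff_ball.1 hgood
  have hopen : IsOpen (Φ.source ∩ Φ ⁻¹' Metric.ball (ζ₀, 0) r) :=
    Φ.isOpen_inter_preimage Metric.isOpen_ball
  set Ψ := Φ.restrOpen _ hopen with hΨ
  have hsrc : ∀ a, a ∈ Ψ.source ↔ a ∈ Φ.source ∧ Φ a ∈ Metric.ball (ζ₀, (0 : ℂ)) r := by
    intro a
    rw [hΨ, OpenPartialHomeomorph.restrOpen_source]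
    exact ⟨fun h => h.2, fun h => ⟨h.1, h⟩⟩
  have htgt : Ψ.target = Metric.ball (ζ₀, (0 : ℂ)) r := by
    ext w
    rw [hΨ, OpenPartialHomeomorph.restrOpen_toPartialEquiv, PartialEquiv.restr_target]
    constructor
    · rintro ⟨h1, h2⟩
      have := h2.2
      rw [mem_preimage] at this
      erw [Φ.right_inv h1] at this
      exact this
    · intro hw
      have h1 := (hball w hw).1
      refine ⟨h1, Φ.map_target h1, ?_⟩
      rw [mem_preimage]
      erw [Φ.right_inv h1]
      exact hw
  have hΨΦ : ∀ a, Ψ a = Φ a := fun a => rfl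
  have hgood' : ∀ a ∈ Ψ.source, a ∈ U ∧ (Φ a).2 = Real.circleAverage
        (fun t => t ^ (-q) * transverseCoord ι p (Φ a).1 (ψ t a)) 0 1 ∧
      ∀ s : ℂ, ρ⁻¹ < ‖s‖ → ‖s‖ < ρ →
        ψ s a ∈ Φ.source ∧ Φ (ψ s a) = ((Φ a).1, s ^ q * (Φ a).2) := by
    intro a ha
    obtain ⟨h1, h2⟩ := (hsrc a).1 ha
    obtain ⟨-, -, h3, h4, h5⟩ := hball _ h2
    rw [Φ.left_inv h1] at h3 h4 h5
    exact ⟨h3, h4, h5⟩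
  have hpΨ : ι p ∈ Ψ.source := (hsrc _).2 ⟨hp, by rw [hΦp]; exact Metric.mem_ball_self hr⟩
  -- The sign of `q` is still unknown, so invariance is stated for the times whose multiplier is
  -- contracting.
  have hann' : ∀ a ∈ Ψ.source, ∀ s : ℂ, ρ⁻¹ < ‖s‖ → ‖s‖ < ρ → ‖s ^ q‖ ≤ 1 →
      ψ s a ∈ Ψ.source ∧ Ψ (ψ s a) = ((Ψ a).1, s ^ q * (Ψ a).2) := by
    intro a ha s h1 h2 h3
    obtain ⟨h4, h5⟩ := (hgood' a ha).2.2 s h1 h2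
    refine ⟨(hsrc _).2 ⟨h4, ?_⟩, h5⟩
    have h6 := ((hsrc a).1 ha).2
    rw [← ball_prod_same] at h6 ⊢
    rw [h5]
    refine ⟨h6.1, ?_⟩
    have h7 := h6.2
    rw [mem_ball_zero_iff] at h7 ⊢
    rw [norm_mul]
    exact (mul_le_of_le_one_left (norm_nonneg _) h3).trans_lt h7
  have hUΨ : Ψ.source ⊆ U := fun a ha => (hgood' a ha).1
  have hq : 0 < q := hψ.exponent_pos hpΨ (by rw [hΨΦ, hΦp]) hUΨ hρ1 hρR hann'
  obtain ⟨m, rfl⟩ := Int.eq_ofNat_of_zero_le hq.le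
  refine ⟨m, Ψ, r, by exact_mod_cast hq, hr, hpΨ, hUΨ,
    fun a ha => hsub ((hsrc a).1 ha).1, ?_, ?_, ?_, ?_, ?_, ?_⟩
  · rw [htgt, ball_prod_same]
  · refine ⟨hΦ.mono fun a ha => ((hsrc a).1 ha).1, hΦ'.mono ?_⟩
    rw [htgt]
    exact fun w hw => (hball w hw).1
  · exact fun a ha => hbase a ((hsrc a).1 ha).1
  · intro ζ hζ
    refine (hball (ζ, 0) ?_).2.1
    rw [← ball_prod_same]
    exact ⟨hζ, Metric.mem_ball_self hr⟩
  · exact fun a ha => (hgood' a ha).2.1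
  · obtain ⟨ρ₁, hρ₁, hρ₁ρ⟩ := exists_between hρ1
    have hρ₁0 : 0 < ρ₁ := one_pos.trans hρ₁
    have hρ0 : 0 < ρ := one_pos.trans hρ1
    have hann₁ : ∀ a ∈ Ψ.source, ∀ s : ℂ, ρ₁⁻¹ ≤ ‖s‖ → ‖s‖ ≤ 1 →
        ψ s a ∈ Ψ.source ∧ Ψ (ψ s a) = ((Ψ a).1, s ^ m * (Ψ a).2) := by
      intro a ha s h1 h2
      have := hann' a ha s (((inv_lt_inv₀ hρ0 hρ₁0).2 hρ₁ρ).trans_le h1) (h2.trans_lt hρ1) (by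
        rw [zpow_natCast, norm_pow]; exact pow_le_one₀ (norm_nonneg _) h2)
      simpa only [zpow_natCast] using this
    -- A time too small for the annulus is written as `ρ₁⁻¹ * (ρ₁ * s)`, with `ρ₁⁻¹` in the annulus
    -- and `ρ₁ * s` treated by induction.
    have hpow : ∀ n : ℕ, ∀ a ∈ Ψ.source, ∀ s : ℂ, s ≠ 0 → ‖s‖ ≤ 1 → 1 ≤ ρ₁ ^ n * ‖s‖ →
        ψ s a ∈ Ψ.source ∧ Ψ (ψ s a) = ((Ψ a).1, s ^ m * (Ψ a).2) := by
      intro n a ha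
      induction n with
      | zero =>
        intro s hs0 hs1 hs
        rw [pow_zero, one_mul] at hs
        exact hann₁ a ha s ((inv_lt_one_of_one_lt₀ hρ₁).le.trans hs) hs1
      | succ n ih =>
        intro s hs0 hs1 hs
        by_cases hcase : 1 ≤ ρ₁ * ‖s‖
        · exact hann₁ a ha s (by rwa [inv_le_iff_one_le_mul₀' hρ₁0]) hs1
        have hρc : ‖(ρ₁ : ℂ)‖ = ρ₁ := by rw [Complex.norm_real, Real.norm_of_nonneg hρ₁0.le]
        have hρc0 : (ρ₁ : ℂ) ≠ 0 := by exact_mod_cast hρ₁0.ne'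
        have hst : ‖(ρ₁ : ℂ) * s‖ = ρ₁ * ‖s‖ := by rw [norm_mul, hρc]
        have hs'0 := mul_ne_zero hρc0 hs0
        have hs'1 : ‖(ρ₁ : ℂ) * s‖ ≤ 1 := by rw [hst]; exact (not_le.1 hcase).le
        obtain ⟨h1, h2⟩ := ih (ρ₁ * s) hs'0 hs'1 (by rw [hst, ← mul_assoc, ← pow_succ]; exact hs)
        have hinv1 : ‖(ρ₁ : ℂ)⁻¹‖ = ρ₁⁻¹ := by rw [norm_inv, hρc]
        have hinv : ‖(ρ₁ : ℂ)⁻¹‖ ≤ 1 := by rw [hinv1]; exact (inv_lt_one_of_one_lt₀ hρ₁).le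
        obtain ⟨h3, h4⟩ := hann₁ _ h1 (ρ₁ : ℂ)⁻¹ hinv1.ge hinv
        have h5 : ψ s a = ψ (ρ₁ : ℂ)⁻¹ (ψ (ρ₁ * s) a) := by
          rw [← hψ.map_mul _ (hψ.mem_of_norm_le_one (inv_ne_zero hρc0) hinv) _
            (hψ.mem_of_norm_le_one hs'0 hs'1) (by
              rw [inv_mul_cancel_left₀ hρc0]; exact hψ.mem_of_norm_le_one hs0 hs1) a (hUΨ ha)
            (hUΨ h1), inv_mul_cancel_left₀ hρc0]
        rw [h5]
        refine ⟨h3, h4.trans ?_⟩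
        rw [h2]
        refine Prod.ext rfl ?_
        change (ρ₁ : ℂ)⁻¹ ^ m * ((ρ₁ * s) ^ m * _) = _
        rw [← mul_assoc, ← mul_pow, inv_mul_cancel_left₀ hρc0]
    intro a ha s hs0 hs1
    obtain ⟨n, hn⟩ := pow_unbounded_of_one_lt ‖s‖⁻¹ hρ₁
    refine hpow n a ha s hs0 hs1 ?_
    rw [← inv_le_iff_one_le_mul₀ (norm_pos_iff.2 hs0)]
    exact hn.le

end IsTransverseActionOn

/-! ### Leading terms of orbits -/

theorem HasDerivAt.tendsto_pow_inv_mul {E : ℂ → ℂ} {e : ℂ} (hE : HasDerivAt E e 0) (h0 : E 0 = 0)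
    {q : ℕ} (hq : 0 < q) (y : ℂ) :
    Tendsto (fun t : ℂ => (t ^ q)⁻¹ * E (t ^ q * y)) (𝓝[≠] 0) (𝓝 (y * e)) := by
  have h1 : HasDerivAt (fun u : ℂ => E (u * y)) (e * y) 0 := by
    have hE' : HasDerivAt E e ((0 : ℂ) * y) := by rwa [zero_mul]
    have h2 : HasDerivAt (fun u : ℂ => u * y) y 0 := by
      simpa using (hasDerivAt_id (0 : ℂ)).mul_const y
    exact hE'.comp (0 : ℂ) h2
  have h2 := h1.tendsto_slope_zero
  have h3 : Tendsto (fun t : ℂ => t ^ q) (𝓝[≠] 0) (𝓝[≠] 0) := by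
    refine tendsto_nhdsWithin_iff.2 ⟨?_, ?_⟩
    · have : Continuous fun t : ℂ => t ^ q := by fun_prop
      simpa [hq.ne'] using (this.tendsto 0).mono_left nhdsWithin_le_nhds
    · filter_upwards [self_mem_nhdsWithin] with t ht
      exact pow_ne_zero q ht
  have h4 := h2.comp h3
  simpa [Function.comp_def, h0, mul_comm e y] using h4

/-- The integrand is `y * dslope E 0 (t ^ q * y)` on the circle. This is holomorphic in the disc, so
its average is its value at `t = 0`, where `q > 0` makes the argument vanish. -/
theorem circleAverage_pow_inv_mul {E : ℂ → ℂ} {r : ℝ} (hE : DifferentiableOn ℂ E (Metric.ball 0 r))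
    (h0 : E 0 = 0) {q : ℕ} (hq : 0 < q) {y : ℂ} (hy : ‖y‖ < r) :
    Real.circleAverage (fun t => t ^ (-q : ℤ) * E (t ^ q * y)) 0 1 = y * deriv E 0 := by
  have hr : 0 < r := (norm_nonneg y).trans_lt hy
  have hg : DifferentiableOn ℂ (dslope E 0) (Metric.ball 0 r) :=
    (Complex.differentiableOn_dslope (Metric.ball_mem_nhds 0 hr)).2 hE
  have hmem : ∀ t ∈ Metric.closedBall (0 : ℂ) 1, t ^ q * y ∈ Metric.ball (0 : ℂ) r := by
    intro t ht
    rw [mem_closedBall_zero_iff] at ht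
    rw [mem_ball_zero_iff, norm_mul, norm_pow]
    exact (mul_le_of_le_one_left (norm_nonneg _) (pow_le_one₀ (norm_nonneg _) ht)).trans_lt hy
  have hk : ∀ t ∈ Metric.closedBall (0 : ℂ) |1|,
      DifferentiableAt ℂ (fun t => y * dslope E 0 (t ^ q * y)) t := by
    intro t ht
    rw [abs_one] at ht
    have h1 := hg.differentiableAt (Metric.isOpen_ball.mem_nhds (hmem t ht))
    have h2 : DifferentiableAt ℂ (fun t : ℂ => t ^ q * y) t := by fun_prop
    exact (DifferentiableAt.comp t (g := dslope E 0) h1 h2).const_mul y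
  have hmean := circleAverage_of_differentiable_on_off_countable (f := fun t =>
    y * dslope E 0 (t ^ q * y)) (c := 0) (R := 1) countable_empty
    (fun t ht => (hk t ht).continuousAt.continuousWithinAt)
    (fun t ht => hk t (Metric.ball_subset_closedBall ht.1))
  rw [zero_pow hq.ne', zero_mul, dslope_same] at hmean
  rw [← hmean]
  refine Real.circleAverage_congr_sphere fun t ht => ?_
  have ht1 : ‖t‖ = 1 := by simpa using ht
  have ht0 : t ≠ 0 := by rw [← norm_pos_iff, ht1]; exact one_pos
  have h1 := sub_smul_dslope E 0 (t ^ q * y)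
  rw [h0, sub_zero, sub_zero, smul_eq_mul] at h1
  change t ^ (-q : ℤ) * E (t ^ q * y) = y * dslope E 0 (t ^ q * y)
  rw [← h1, zpow_neg, zpow_natCast]
  have := pow_ne_zero q ht0
  field_simp

section LeadingTerm

variable {σ S : Type*} [TopologicalSpace σ] [ChartedSpace ℂ σ]
  [TopologicalSpace S] [ChartedSpace (ℂ × ℂ) S]

theorem HolEmbedding.injective (ι : HolEmbedding σ S) : Function.Injective ι :=
  ι.isSmoothEmbedding.isEmbedding.injective

variable [IsManifold 𝓘(ℂ, ℂ) ω σ] [IsManifold 𝓘(ℂ, ℂ × ℂ) ω S]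
  {ι : HolEmbedding σ S} {ψ : ℂ → S → S} {R : ℝ} {U : Set S}

/-- The normal vector `n` is the leading coefficient, of order `q`, of the orbit of `a` when the
time tends to `0`. -/
structure IsLeadingTerm (ι : HolEmbedding σ S) (ψ : ℂ → S → S) (q : ℕ) (a : S)
    (n : TotalSpace ℂ ι.NormalSpace) : Prop where
  tendsto_orbit : Tendsto (fun t => ψ t a) (𝓝[≠] 0) (𝓝 (ι n.proj))
  tendsto_coord : ∀ b, n.proj ∈ ι.normalBase b →
    Tendsto (fun t => (t ^ q)⁻¹ * HolEmbedding.detForm (ι.tangentVec b n.proj)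
      (chartAt (ℂ × ℂ) (ι b) (ψ t a) - chartAt (ℂ × ℂ) (ι b) (ι n.proj))) (𝓝[≠] 0)
      (𝓝 (ι.normalCoord b n.proj n.2))

namespace IsLeadingTerm

theorem unique [T2Space S] {q : ℕ} {a : S} {n n' : TotalSpace ℂ ι.NormalSpace}
    (h : IsLeadingTerm ι ψ q a n) (h' : IsLeadingTerm ι ψ q a n') : n = n' := by
  obtain ⟨x, m⟩ := n
  obtain ⟨x', m'⟩ := n'
  obtain rfl : x = x' := ι.injective (tendsto_nhds_unique h.tendsto_orbit h'.tendsto_orbit)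
  have hx := ι.mem_normalBase x
  have := tendsto_nhds_unique (h.tendsto_coord x hx) (h'.tendsto_coord x hx)
  obtain rfl : m = m' := (ι.normalCoord_bijective x x hx).1 this
  rfl

/-- If `q < q'`, a finite limit at order `q'` forces the limit at order `q` to be zero. -/
theorem order_le [T2Space S] {q q' : ℕ} {a : S} {n n' : TotalSpace ℂ ι.NormalSpace}
    (h : IsLeadingTerm ι ψ q a n) (h' : IsLeadingTerm ι ψ q' a n') (hn : n.2 ≠ 0) : q' ≤ q := by
  by_contra hlt
  push Not at hlt
  obtain ⟨x, m⟩ := n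
  obtain ⟨x', m'⟩ := n'
  obtain rfl : x = x' := ι.injective (tendsto_nhds_unique h.tendsto_orbit h'.tendsto_orbit)
  have hx := ι.mem_normalBase x
  have h1 : Tendsto (fun t : ℂ => t ^ (q' - q)) (𝓝[≠] 0) (𝓝 0) := by
    have : Continuous fun t : ℂ => t ^ (q' - q) := by fun_prop
    simpa [(Nat.sub_pos_of_lt hlt).ne'] using (this.tendsto 0).mono_left nhdsWithin_le_nhds
  have h2 := h1.mul (h'.tendsto_coord x hx)
  rw [zero_mul] at h2
  have h3 : ι.normalCoord x x m = 0 := by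
    refine tendsto_nhds_unique (h.tendsto_coord x hx) (h2.congr' ?_)
    filter_upwards [self_mem_nhdsWithin] with t ht
    have ht0 : t ≠ 0 := ht
    rw [← mul_assoc]
    congr 1
    rw [pow_sub₀ t ht0 hlt.le]
    have := pow_ne_zero q' ht0
    field_simp
  exact hn ((ι.normalCoord_bijective x x hx).1 (h3.trans (map_zero _).symm))

/-- The orbit of `ψ s a` at time `t` is that of `a` at time `t * s`, and `(t * s) ^ q` releases the
factor `s ^ q`. This is the equivariance of the linearization. -/
theorem normalSMul (hψ : IsTransverseActionOn ι ψ R U) {q : ℕ} {a : S}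
    {n : TotalSpace ℂ ι.NormalSpace} (h : IsLeadingTerm ι ψ q a n) (ha : a ∈ U) {s : ℂ}
    (hs : s ∈ puncturedDisc R) (hsa : ψ s a ∈ U) :
    IsLeadingTerm ι ψ q (ψ s a) (ι.normalSMul (s ^ q) n) := by
  have hR : 0 < R := one_pos.trans hψ.one_lt
  have hts : Tendsto (fun t : ℂ => t * s) (𝓝[≠] 0) (𝓝[≠] 0) := by
    refine tendsto_nhdsWithin_iff.2 ⟨?_, ?_⟩
    · have : Continuous fun t : ℂ => t * s := by fun_prop
      simpa using (this.tendsto 0).mono_left nhdsWithin_le_nhds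
    · filter_upwards [self_mem_nhdsWithin] with t ht
      exact mul_ne_zero ht hs.1
  have hsmall : ∀ᶠ t : ℂ in 𝓝[≠] 0, t ∈ puncturedDisc R := by
    filter_upwards [self_mem_nhdsWithin, mem_nhdsWithin_of_mem_nhds (Metric.ball_mem_nhds 0 hR)]
      with t h1 h2
    exact ⟨h1, by simpa using h2⟩
  have hact : ∀ᶠ t : ℂ in 𝓝[≠] 0, ψ (t * s) a = ψ t (ψ s a) := by
    filter_upwards [hsmall, hts.eventually hsmall] with t h1 h2
    exact hψ.map_mul t h1 s hs h2 a ha hsa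
  constructor
  · exact (h.tendsto_orbit.comp hts).congr' hact
  · intro b hb
    have h1 := ((h.tendsto_coord b hb).comp hts).const_mul (s ^ q)
    change Tendsto _ _ (𝓝 (ι.normalCoord b n.proj (s ^ q • n.2)))
    rw [map_smul, smul_eq_mul]
    refine h1.congr' ?_
    filter_upwards [hact] with t ht
    simp only [Function.comp_apply]
    rw [ht, ← mul_assoc]
    congr 1
    rw [mul_pow]
    have := pow_ne_zero q hs.1
    by_cases ht0 : t ^ q = 0
    · simp [ht0]
    · field_simp

theorem normalZero (hψ : IsTransverseActionOn ι ψ R U) (q : ℕ) (p : σ) :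
    IsLeadingTerm ι ψ q (ι p) (ι.normalZero p) := by
  have hR : 0 < R := one_pos.trans hψ.one_lt
  have hfix : ∀ᶠ t : ℂ in 𝓝[≠] 0, ψ t (ι p) = ι p := by
    filter_upwards [self_mem_nhdsWithin, mem_nhdsWithin_of_mem_nhds (Metric.ball_mem_nhds 0 hR)]
      with t h1 h2
    exact hψ.map_fixed t ⟨h1, by simpa using h2⟩ p
  constructor
  · exact tendsto_const_nhds.congr' (hfix.mono fun t ht => ht.symm)
  · intro b _
    change Tendsto _ _ (𝓝 (ι.normalCoord b p 0))
    rw [map_zero]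
    refine tendsto_const_nhds.congr' (hfix.mono fun t ht => ?_)
    change 0 = (t ^ q)⁻¹ * HolEmbedding.detForm (ι.tangentVec b p)
      (chartAt (ℂ × ℂ) (ι b) (ψ t (ι p)) - chartAt (ℂ × ℂ) (ι b) (ι p))
    rw [ht, sub_self, map_zero, mul_zero]

end IsLeadingTerm

namespace IsLinearChart

variable {p : σ} {q : ℕ} {Φ : OpenPartialHomeomorph S (ℂ × ℂ)} {r : ℝ}

/-- In the chart the orbit is `t ↦ γ (t ^ q * y)`, with `γ` the fibre through `a`, so its leading
term is the class of `y` times the velocity of `γ` at `0`. -/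
theorem exists_isLeadingTerm (hΦ : IsLinearChart ι ψ U p q Φ r) (hq : 0 < q) {a : S}
    (ha : a ∈ Φ.source) :
    ∃ n : TotalSpace ℂ ι.NormalSpace, IsLeadingTerm ι ψ q a n ∧
      n.proj = (chartAt ℂ p).symm (Φ a).1 ∧ ι.normalCoord p n.proj n.2 = (Φ a).2 := by
  set ζ := (Φ a).1 with hζ
  set y := (Φ a).2 with hy
  set z := (chartAt ℂ p).symm ζ with hz
  have hmem : ζ ∈ Metric.ball (chartAt ℂ p p) r ∧ y ∈ Metric.ball (0 : ℂ) r := by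
    have := Φ.map_source ha
    rwa [hΦ.target_eq] at this
  have hbase := hΦ.base a ha
  set γ : ℂ → S := fun w => Φ.symm (ζ, w) with hγ
  have hγ0 : γ 0 = ι z := hΦ.symm_zero ζ hmem.1
  have hγt : ∀ w ∈ Metric.ball (0 : ℂ) r, (ζ, w) ∈ Φ.target := by
    intro w hw
    rw [hΦ.target_eq]; exact ⟨hmem.1, hw⟩
  have hγd : ∀ w ∈ Metric.ball (0 : ℂ) r, MDifferentiableAt 𝓘(ℂ, ℂ) 𝓘(ℂ, ℂ × ℂ) γ w := by
    intro w hw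
    have h1 := hΦ.mdifferentiable.mdifferentiableAt_symm (hγt w hw)
    have h2 : MDifferentiableAt 𝓘(ℂ, ℂ) 𝓘(ℂ, ℂ × ℂ) (fun w : ℂ => (ζ, w)) w := by
      have : DifferentiableAt ℂ (fun w : ℂ => (ζ, w)) w := by fun_prop
      exact this.mdifferentiableAt
    exact MDifferentiableAt.comp w (g := Φ.symm) h1 h2
  have horbit : ∀ t : ℂ, t ≠ 0 → ‖t‖ ≤ 1 → ψ t a = γ (t ^ q * y) := by
    intro t h0 h1
    obtain ⟨h2, h3⟩ := hΦ.action a ha t h0 h1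
    rw [hγ, ← Φ.left_inv h2, h3]
  have hsmall : ∀ᶠ t : ℂ in 𝓝[≠] 0, ψ t a = γ (t ^ q * y) := by
    filter_upwards [self_mem_nhdsWithin,
      mem_nhdsWithin_of_mem_nhds (Metric.closedBall_mem_nhds (0 : ℂ) one_pos)] with t h1 h2
    exact horbit t h1 (by simpa using h2)
  -- The velocity lives at `γ 0`, which equals `ι z` only propositionally; the ascription reads it
  -- as a tangent vector at `ι z`.
  set v : TangentSpace 𝓘(ℂ, ℂ × ℂ) (ι z) :=
    (show ℂ × ℂ from mfderiv 𝓘(ℂ, ℂ) 𝓘(ℂ, ℂ × ℂ) γ 0 (1 : ℂ)) with hv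
  set E : σ → ℂ → ℂ := fun b w => HolEmbedding.detForm (ι.tangentVec b z)
    (chartAt (ℂ × ℂ) (ι b) (γ w) - chartAt (ℂ × ℂ) (ι b) (ι z)) with hE
  have hE0 : ∀ b, E b 0 = 0 := by
    intro b
    simp only [hE, hγ0, sub_self, map_zero]
  have h0r : (0 : ℂ) ∈ Metric.ball (0 : ℂ) r := Metric.mem_ball_self hΦ.pos
  have hEd : ∀ b, z ∈ ι.normalBase b →
      HasDerivAt (E b) (ι.normalCoord b z (ι.normalMk z v)) 0 := by
    intro b hb
    have hb' := (ι.mem_normalBase_iff b z).1 hb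
    rw [HolEmbedding.normalCoord_mk _ _ _ hb]
    unfold HolEmbedding.trivS
    rw [TangentBundle.continuousLinearMapAt_trivializationAt hb'.2]
    have h1 : MDifferentiableAt 𝓘(ℂ, ℂ × ℂ) 𝓘(ℂ, ℂ × ℂ) (chartAt (ℂ × ℂ) (ι b)) (γ 0) :=
      mdifferentiableAt_of_mem_maximalAtlas
        (IsManifold.maximalAtlas_subset_of_le (n := ω) (by simp)
          (IsManifold.chart_mem_maximalAtlas _)) (by rw [hγ0]; exact hb'.2)
    have h2 := HasMFDerivAt.comp (0 : ℂ) h1.hasMFDerivAt (hγd 0 h0r).hasMFDerivAt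
    set L : ℂ →L[ℂ] ℂ × ℂ :=
      (mfderiv 𝓘(ℂ, ℂ × ℂ) 𝓘(ℂ, ℂ × ℂ) (chartAt (ℂ × ℂ) (ι b)) (γ 0)).comp
        (mfderiv 𝓘(ℂ, ℂ) 𝓘(ℂ, ℂ × ℂ) γ 0) with hL
    have h3 : HasFDerivAt (fun w => chartAt (ℂ × ℂ) (ι b) (γ w)) L (0 : ℂ) := h2.hasFDerivAt
    have h4 : HasDerivAt (fun w => chartAt (ℂ × ℂ) (ι b) (γ w))
        (mfderiv 𝓘(ℂ, ℂ × ℂ) 𝓘(ℂ, ℂ × ℂ) (extChartAt 𝓘(ℂ, ℂ × ℂ) (ι b)) (ι z) v : ℂ × ℂ) 0 := by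
      rw [← hγ0]
      simp only [extChartAt, OpenPartialHomeomorph.extend, modelWithCornersSelf_partialEquiv]
      exact h3.hasDerivAt
    exact (HolEmbedding.detForm (ι.tangentVec b z)).hasFDerivAt.comp_hasDerivAt (0 : ℂ)
      (h4.sub_const _)
  refine ⟨⟨z, ι.normalMk z (y • v)⟩, ⟨?_, ?_⟩, rfl, ?_⟩
  · have hc : ContinuousAt γ 0 := (hγd 0 h0r).continuousAt
    have h1 : Tendsto (fun t : ℂ => t ^ q * y) (𝓝[≠] 0) (𝓝 0) := by
      have : Continuous fun t : ℂ => t ^ q * y := by fun_prop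
      simpa [hq.ne'] using (this.tendsto 0).mono_left nhdsWithin_le_nhds
    have h2 := hc.tendsto.comp h1
    rw [hγ0] at h2
    exact h2.congr' (hsmall.mono fun t ht => ht.symm)
  · intro b hb
    have h1 := (hEd b hb).tendsto_pow_inv_mul (hE0 b) hq y
    change Tendsto _ _ (𝓝 (ι.normalCoord b z (ι.normalMk z (y • v))))
    rw [map_smul, map_smul, smul_eq_mul]
    refine h1.congr' (hsmall.mono fun t ht => ?_)
    change (t ^ q)⁻¹ * E b (t ^ q * y) = (t ^ q)⁻¹ * HolEmbedding.detForm (ι.tangentVec b z)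
      (chartAt (ℂ × ℂ) (ι b) (ψ t a) - chartAt (ℂ × ℂ) (ι b) (ι z))
    rw [ht]
  · change ι.normalCoord p z (ι.normalMk z (y • v)) = y
    rw [map_smul, map_smul, smul_eq_mul]
    have hdiff : DifferentiableOn ℂ (E p) (Metric.ball 0 r) := by
      intro w hw
      have h1 : MDifferentiableAt 𝓘(ℂ, ℂ × ℂ) 𝓘(ℂ, ℂ × ℂ) (chartAt (ℂ × ℂ) (ι p)) (γ w) :=
        mdifferentiableAt_of_mem_maximalAtlas
          (IsManifold.maximalAtlas_subset_of_le (n := ω) (by simp)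
            (IsManifold.chart_mem_maximalAtlas _))
          (hΦ.source_subset (Φ.map_target (hγt w hw)))
      have h2 : DifferentiableAt ℂ (fun w => chartAt (ℂ × ℂ) (ι p) (γ w)) w :=
        (h1.comp w (hγd w hw)).differentiableAt
      exact ((HolEmbedding.detForm (ι.tangentVec p z)).differentiableAt.comp w
        (h2.sub_const _)).differentiableWithinAt
    -- The averaging formula for the fibre coordinate and the mean value property together give
    -- exactly `y`, with no extra factor depending on `z`.
    have h1 := circleAverage_pow_inv_mul hdiff (hE0 p) hq (y := y) (by simpa using hmem.2)
    rw [(hEd p hbase.2).deriv] at h1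
    rw [← h1]
    refine Eq.trans ?_ (hΦ.snd_eq a ha).symm
    refine Real.circleAverage_congr_sphere fun t ht => ?_
    have ht1 : ‖t‖ = 1 := by simpa using ht
    have ht0 : t ≠ 0 := by rw [← norm_pos_iff, ht1]; exact one_pos
    change t ^ (-q : ℤ) * E p (t ^ q * y) = t ^ (-q : ℤ) * IsTransverseActionOn.transverseCoord ι p ζ (ψ t a)
    rw [horbit t ht0 ht1.le]
    rfl

/-- A point of the Riemann surface has vanishing fibre coordinate, and conversely. -/
theorem snd_eq_zero_iff (hψ : IsTransverseActionOn ι ψ R U) (hΦ : IsLinearChart ι ψ U p q Φ r)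
    (hq : 0 < q) {a : S} (ha : a ∈ Φ.source) : (Φ a).2 = 0 ↔ a ∈ range ι := by
  constructor
  · intro h
    have hmem := Φ.map_source ha
    rw [hΦ.target_eq] at hmem
    refine ⟨_, (hΦ.symm_zero _ hmem.1).symm.trans ?_⟩
    rw [← h]
    exact Φ.left_inv ha
  · rintro ⟨x, rfl⟩
    -- The time `1/2` fixes `ι x` but multiplies its fibre coordinate by `2⁻¹ ^ q ≠ 1`.
    have h2 : ‖(2 : ℂ)⁻¹‖ ≤ 1 := by rw [norm_inv]; norm_num
    have h20 : (2 : ℂ)⁻¹ ≠ 0 := by norm_num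
    have h1 := (hΦ.action _ ha _ h20 h2).2
    rw [hψ.map_fixed _ (hψ.mem_of_norm_le_one h20 h2) x] at h1
    have h3 := congrArg Prod.snd h1
    simp only at h3
    have h4 : (2 : ℂ)⁻¹ ^ q ≠ 1 := by
      intro h
      have h5 := congrArg norm h
      rw [norm_pow, norm_inv, norm_one] at h5
      have h6 : ‖(2 : ℂ)‖⁻¹ ^ q < 1 := pow_lt_one₀ (by positivity) (by norm_num) hq.ne'
      exact h6.ne h5
    by_contra h5
    exact h4 (mul_right_cancel₀ h5 (by rw [one_mul]; exact h3.symm))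

/-- A point off `σ` common to both charts has a nonzero leading term of order `q` and one of order
`q'`, and the order of a nonzero leading term is determined by the orbit. -/
theorem order_eq [T2Space S] (hψ : IsTransverseActionOn ι ψ R U)
    (hΦ : IsLinearChart ι ψ U p q Φ r) (hq : 0 < q) {p' : σ} {q' : ℕ}
    {Φ' : OpenPartialHomeomorph S (ℂ × ℂ)} {r' : ℝ} (hΦ' : IsLinearChart ι ψ U p' q' Φ' r')
    (hq' : 0 < q') {x : σ} (hx : ι x ∈ Φ.source) (hx' : ι x ∈ Φ'.source) : q = q' := by
  obtain ⟨a, ha, ha', haι⟩ : ∃ a, a ∈ Φ.source ∧ a ∈ Φ'.source ∧ a ∉ range ι := by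
    set ζ := (Φ (ι x)).1 with hζ
    have hΦx : Φ (ι x) = (ζ, 0) :=
      Prod.ext rfl ((hΦ.snd_eq_zero_iff hψ hq hx).2 (mem_range_self x))
    have hmem := Φ.map_source hx
    rw [hΦx] at hmem
    have hlim : Tendsto (fun w : ℂ => (ζ, w)) (𝓝[≠] 0) (𝓝 (ζ, 0)) := by
      have : Continuous fun w : ℂ => (ζ, w) := by fun_prop
      exact (this.tendsto 0).mono_left nhdsWithin_le_nhds
    have hlim2 := (Φ.continuousAt_symm hmem).tendsto.comp hlim
    rw [← hΦx, Φ.left_inv hx] at hlim2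
    have hev := (hlim.eventually (Φ.open_target.mem_nhds hmem)).and
      ((hlim2.eventually (Φ'.open_source.mem_nhds hx')).and
        (self_mem_nhdsWithin : ∀ᶠ w : ℂ in 𝓝[≠] 0, w ∈ ({0}ᶜ : Set ℂ)))
    obtain ⟨w, h1, h2, h3⟩ := hev.exists
    have h4 := Φ.map_target h1
    refine ⟨Φ.symm (ζ, w), h4, h2, fun h5 => ?_⟩
    rw [← hΦ.snd_eq_zero_iff hψ hq h4, Φ.right_inv h1] at h5
    exact h3 h5
  obtain ⟨n, hn, -, hn2⟩ := hΦ.exists_isLeadingTerm hq ha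
  obtain ⟨n', hn', -, hn2'⟩ := hΦ'.exists_isLeadingTerm hq' ha'
  have hne : n.2 ≠ 0 := by
    intro h
    rw [h, map_zero, eq_comm, hΦ.snd_eq_zero_iff hψ hq ha] at hn2
    exact haι hn2
  have hne' : n'.2 ≠ 0 := by
    intro h
    rw [h, map_zero, eq_comm, hΦ'.snd_eq_zero_iff hψ hq' ha'] at hn2'
    exact haι hn2'
  exact le_antisymm (hn'.order_le hn hne') (hn.order_le hn' hne)

end IsLinearChart

end LeadingTerm

/-! ### The linearization -/

section Linearization

/-- Charts of `S` take values in `ℂ × ℂ` and charts of the normal bundle in `ModelProd ℂ ℂ`; the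
identity passes between the two models. -/
theorem mdifferentiableAt_id_modelProd (z : ℂ × ℂ) :
    MDifferentiableAt (M := ℂ × ℂ) (M' := ModelProd ℂ ℂ) 𝓘(ℂ, ℂ × ℂ) (𝓘(ℂ, ℂ).prod 𝓘(ℂ, ℂ))
      id z := by
  rw [modelWithCornersSelf_prod]
  exact mdifferentiableAt_id

theorem mdifferentiableAt_id_modelProd_symm (z : ModelProd ℂ ℂ) :
    MDifferentiableAt (M := ModelProd ℂ ℂ) (M' := ℂ × ℂ) (𝓘(ℂ, ℂ).prod 𝓘(ℂ, ℂ)) 𝓘(ℂ, ℂ × ℂ)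
      id z := by
  rw [modelWithCornersSelf_prod]
  exact mdifferentiableAt_id

variable {σ S : Type*} [TopologicalSpace σ] [ChartedSpace ℂ σ]
  [TopologicalSpace S] [ChartedSpace (ℂ × ℂ) S]
  [IsManifold 𝓘(ℂ, ℂ × ℂ) ω S] {ι : HolEmbedding σ S} {ψ : ℂ → S → S} {R : ℝ} {U : Set S}

/-- The time `0` is outside the pseudo-group, so the identity theorem is started at a nearby nonzero
time. -/
theorem IsTransverseActionOn.eq_of_eventuallyEq_zero [T2Space S]
    (hψ : IsTransverseActionOn ι ψ R U) {a b : S} (ha : a ∈ U) (hb : b ∈ U)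
    (h : ∀ᶠ t in 𝓝[≠] (0 : ℂ), ψ t a = ψ t b) : a = b := by
  have hR : 0 < R := one_pos.trans hψ.one_lt
  have hsmall : ∀ᶠ t : ℂ in 𝓝[≠] 0, t ∈ puncturedDisc R := by
    filter_upwards [self_mem_nhdsWithin, mem_nhdsWithin_of_mem_nhds (Metric.ball_mem_nhds 0 hR)]
      with t h1 h2
    exact ⟨h1, by simpa using h2⟩
  obtain ⟨t, h1, h2⟩ := ((eventually_eventually_nhdsWithin.2 h).and hsmall).exists
  rw [isOpen_compl_singleton.nhdsWithin_eq h2.1] at h1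
  exact hψ.eq_of_eventuallyEq ha hb h2 h1

variable [IsManifold 𝓘(ℂ, ℂ) ω σ]

namespace HolEmbedding

theorem mem_chartAt_normalZero_source (ι : HolEmbedding σ S) (p : σ)
    (n : TotalSpace ℂ ι.NormalSpace) :
    n ∈ (chartAt (ModelProd ℂ ℂ) (ι.normalZero p)).source ↔ n.proj ∈ ι.normalBase p := by
  rw [FiberBundle.chartedSpace_chartAt]
  simp only [OpenPartialHomeomorph.trans_source, OpenPartialHomeomorph.prod_source,
    OpenPartialHomeomorph.refl_source]
  constructor
  · exact fun h => h.1
  · exact fun h => ⟨h, h.1, mem_univ _⟩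

theorem chartAt_normalZero_apply (ι : HolEmbedding σ S) (p : σ) (n : TotalSpace ℂ ι.NormalSpace) :
    chartAt (ModelProd ℂ ℂ) (ι.normalZero p) n =
      (chartAt ℂ p n.proj, ι.normalCoord p n.proj n.2) := by
  rw [FiberBundle.chartedSpace_chartAt]
  rfl

end HolEmbedding

theorem IsTransverseActionOn.exists_order [T2Space S] [SecondCountableTopology S]
    [ConnectedSpace σ] (hψ : IsTransverseActionOn ι ψ R U) :
    ∃ q : ℕ, 0 < q ∧ ∀ p : σ, ∃ Φ r, IsLinearChart ι ψ U p q Φ r := by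
  choose q Φ r hq hΦ using hψ.exists_isLinearChart
  have hloc : IsLocallyConstant q := by
    rw [IsLocallyConstant.iff_eventually_eq]
    intro p
    filter_upwards [ι.continuous.continuousAt ((Φ p).open_source.mem_nhds (hΦ p).mem_source)]
      with x hx
    exact (hΦ x).order_eq hψ (hq x) (hΦ p) (hq p) (hΦ x).mem_source hx
  obtain ⟨p₀⟩ : Nonempty σ := inferInstance
  refine ⟨q p₀, hq p₀, fun p => ⟨Φ p, r p, ?_⟩⟩
  rw [hloc.apply_eq_of_preconnectedSpace p₀ p]
  exact hΦ p

end Linearization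

/-! ### Gluing the leading terms into the linearization -/

theorem theorem4 {σ S : Type*}
    [TopologicalSpace σ] [ChartedSpace ℂ σ] [IsManifold 𝓘(ℂ, ℂ) ω σ] [ConnectedSpace σ]
    [TopologicalSpace S] [ChartedSpace (ℂ × ℂ) S] [IsManifold 𝓘(ℂ, ℂ × ℂ) ω S]
    [T2Space S] [SecondCountableTopology S]
    (ι : HolEmbedding σ S) (ψ : ℂ → S → S) (hψ : IsTransverseAction ι ψ) :
    ∃ (h : OpenPartialHomeomorph S (Bundle.TotalSpace ℂ ι.NormalSpace)) (q : ℕ),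
      0 < q ∧
      range ι ⊆ h.source ∧
      (∀ p : σ, h (ι p) = ι.normalZero p) ∧
      h.MDifferentiable 𝓘(ℂ, ℂ × ℂ) (𝓘(ℂ, ℂ).prod 𝓘(ℂ, ℂ)) ∧
      ∀ᶠ z : ℂ × S in 𝓝ˢ (Metric.closedBall (0 : ℂ) 1 ×ˢ range ι), z.1 ≠ 0 →
        z.2 ∈ h.source ∧ ψ z.1 z.2 ∈ h.source ∧
          h (ψ z.1 z.2) = ι.normalSMul (z.1 ^ q) (h z.2) := by
  obtain ⟨R, U, hψ⟩ := hψ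
  obtain ⟨q, hq, hex⟩ := hψ.exists_order
  choose Φ r hΦ using hex
  obtain ⟨p₀⟩ : Nonempty σ := inferInstance
  have : Nonempty S := ⟨ι p₀⟩
  have : Nonempty (TotalSpace ℂ ι.NormalSpace) := ⟨ι.normalZero p₀⟩
  set W : Set S := ⋃ p, (Φ p).source with hW
  have hWo : IsOpen W := isOpen_iUnion fun p => (Φ p).open_source
  have hWU : W ⊆ U := iUnion_subset fun p => (hΦ p).subset
  have hιW : ∀ p, ι p ∈ W := fun p => mem_iUnion.2 ⟨p, (hΦ p).mem_source⟩
  have hleadex : ∀ a : S, ∃ n : TotalSpace ℂ ι.NormalSpace, a ∈ W → IsLeadingTerm ι ψ q a n := by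
    intro a
    by_cases ha : a ∈ W
    · obtain ⟨p, hp⟩ := mem_iUnion.1 ha
      obtain ⟨n, hn, -⟩ := (hΦ p).exists_isLeadingTerm hq hp
      exact ⟨n, fun _ => hn⟩
    -- An arbitrary value outside `W`, which is the source of the final map.
    · exact ⟨ι.normalZero p₀, fun h => absurd h ha⟩
  choose h hlead using hleadex
  -- the expression of the linearization in the charts
  have hchart : ∀ p, ∀ a ∈ (Φ p).source,
      h a ∈ (chartAt (ModelProd ℂ ℂ) (ι.normalZero p)).source ∧
        chartAt (ModelProd ℂ ℂ) (ι.normalZero p) (h a) = Φ p a := by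
    intro p a ha
    obtain ⟨n, hn, hn1, hn2⟩ := (hΦ p).exists_isLeadingTerm hq ha
    rw [(hlead a (mem_iUnion.2 ⟨p, ha⟩)).unique hn]
    have hb := (hΦ p).base a ha
    refine ⟨(ι.mem_chartAt_normalZero_source p n).2 (by rw [hn1]; exact hb.2), ?_⟩
    rw [ι.chartAt_normalZero_apply, hn2]
    refine Prod.ext ?_ rfl
    change chartAt ℂ p n.proj = _
    rw [hn1, (chartAt ℂ p).right_inv hb.1]
  have hsmul : ∀ a ∈ W, ∀ s ∈ puncturedDisc R, ψ s a ∈ W →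
      h (ψ s a) = ι.normalSMul (s ^ q) (h a) := by
    intro a ha s hs hsa
    exact (hlead _ hsa).unique ((hlead a ha).normalSMul hψ (hWU ha) hs (hWU hsa))
  -- Equal leading terms have the same limit point `ι z`. For small `t` both orbits lie in the chart
  -- at `z`, where `h` is read as `Φ z`, and equivariance gives them the same image.
  have hinj : InjOn h W := by
    intro a ha b hb hab
    set z := (h a).proj with hz
    have hza := (hlead a ha).tendsto_orbit.eventually
      ((Φ z).open_source.mem_nhds (hΦ z).mem_source)
    have hzb := (hlead b hb).tendsto_orbit
    rw [← hab] at hzb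
    have hzb := hzb.eventually ((Φ z).open_source.mem_nhds (hΦ z).mem_source)
    refine hψ.eq_of_eventuallyEq_zero (hWU ha) (hWU hb) ?_
    filter_upwards [hza, hzb, self_mem_nhdsWithin,
      mem_nhdsWithin_of_mem_nhds (Metric.closedBall_mem_nhds (0 : ℂ) one_pos)] with t h1 h2 h3 h4
    have htR := hψ.mem_of_norm_le_one h3 (by simpa using h4)
    refine (Φ z).injOn h1 h2 ?_
    rw [← (hchart z _ h1).2, ← (hchart z _ h2).2,
      hsmul a ha t htR (mem_iUnion.2 ⟨z, h1⟩), hsmul b hb t htR (mem_iUnion.2 ⟨z, h2⟩), hab]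
  have hloc : ∀ p, ∀ a ∈ (Φ p).source,
      h a = (chartAt (ModelProd ℂ ℂ) (ι.normalZero p)).symm (Φ p a) := by
    intro p a ha
    rw [← (hchart p a ha).2, (chartAt (ModelProd ℂ ℂ) (ι.normalZero p)).left_inv (hchart p a ha).1]
  have htarget : ∀ p, ∀ a ∈ (Φ p).source,
      Φ p a ∈ (chartAt (ModelProd ℂ ℂ) (ι.normalZero p)).target := by
    intro p a ha
    rw [← (hchart p a ha).2]
    exact (chartAt (ModelProd ℂ ℂ) (ι.normalZero p)).map_source (hchart p a ha).1
  -- Locally `h` is a composition of local homeomorphisms; this yields continuity and openness at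
  -- once.
  have hmap : ∀ a ∈ W, map h (𝓝 a) = 𝓝 (h a) := by
    intro a ha
    obtain ⟨p, hp⟩ := mem_iUnion.1 ha
    have h1 : h =ᶠ[𝓝 a] (chartAt (ModelProd ℂ ℂ) (ι.normalZero p)).symm ∘ Φ p := by
      filter_upwards [(Φ p).open_source.mem_nhds hp] with b hb using hloc p b hb
    rw [map_congr h1, ← map_map, (Φ p).map_nhds_eq hp,
      (chartAt (ModelProd ℂ ℂ) (ι.normalZero p)).symm.map_nhds_eq (htarget p a hp), ← hloc p a hp]
  have hcont : ∀ a ∈ W, ContinuousAt h a := fun a ha => (hmap a ha).le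
  set H : OpenPartialHomeomorph S (TotalSpace ℂ ι.NormalSpace) :=
    OpenPartialHomeomorph.ofContinuousOpenRestrict hinj.toPartialEquiv
      (fun a ha => (hcont a ha).continuousWithinAt) (by
        rw [isOpenMap_iff_nhds_le]
        rintro ⟨a, ha⟩
        have ha' : a ∈ W := ha
        change 𝓝 (h a) ≤ map (h ∘ Subtype.val) (𝓝 ⟨a, ha⟩)
        rw [← map_map, map_nhds_subtype_val]
        change 𝓝 (h a) ≤ map h (𝓝[W] a)
        rw [hWo.nhdsWithin_eq ha', hmap a ha']) hWo
  have hHa : ∀ a, H a = h a := fun a => rfl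
  refine ⟨H, q, hq, range_subset_iff.2 hιW, fun p => ?_, ⟨?_, ?_⟩, ?_⟩
  · exact (hlead _ (hιW p)).unique (IsLeadingTerm.normalZero hψ q p)
  · intro a ha
    obtain ⟨p, hp⟩ := mem_iUnion.1 ha
    have h1 : MDifferentiableAt (M' := ModelProd ℂ ℂ) 𝓘(ℂ, ℂ × ℂ) (𝓘(ℂ, ℂ).prod 𝓘(ℂ, ℂ))
        (Φ p) a :=
      (mdifferentiableAt_id_modelProd _).comp a ((hΦ p).mdifferentiable.mdifferentiableAt hp)
    have h2 : MDifferentiableAt (𝓘(ℂ, ℂ).prod 𝓘(ℂ, ℂ)) (𝓘(ℂ, ℂ).prod 𝓘(ℂ, ℂ))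
        (chartAt (ModelProd ℂ ℂ) (ι.normalZero p)).symm (Φ p a) :=
      (mdifferentiable_chart (ι.normalZero p)).mdifferentiableAt_symm (htarget p a hp)
    refine ((h2.comp a h1).congr_of_eventuallyEq ?_).mdifferentiableWithinAt
    filter_upwards [(Φ p).open_source.mem_nhds hp] with b hb using hloc p b hb
  · intro y hy
    obtain ⟨a, ha, rfl⟩ : ∃ a ∈ W, h a = y := hy
    obtain ⟨p, hp⟩ := mem_iUnion.1 ha
    obtain ⟨hs, hc⟩ := hchart p a hp
    set κ := chartAt (ModelProd ℂ ℂ) (ι.normalZero p) with hκ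
    have hΦt : κ (h a) ∈ (Φ p).target := by rw [hc]; exact (Φ p).map_source hp
    have h1 : MDifferentiableAt (M' := ℂ × ℂ) (𝓘(ℂ, ℂ).prod 𝓘(ℂ, ℂ)) 𝓘(ℂ, ℂ × ℂ)
        κ (h a) :=
      (mdifferentiableAt_id_modelProd_symm _).comp (h a)
        ((mdifferentiable_chart (ι.normalZero p)).mdifferentiableAt hs)
    have h2 : MDifferentiableAt 𝓘(ℂ, ℂ × ℂ) 𝓘(ℂ, ℂ × ℂ) (Φ p).symm (κ (h a)) :=
      (hΦ p).mdifferentiable.mdifferentiableAt_symm hΦt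
    refine (MDifferentiableAt.congr_of_eventuallyEq
      (f := (Φ p).symm ∘ κ)
      (MDifferentiableAt.comp (h a) h2 h1) ?_).mdifferentiableWithinAt
    filter_upwards [κ.open_source.mem_nhds hs,
      (κ.continuousAt hs).preimage_mem_nhds ((Φ p).open_target.mem_nhds hΦt)] with y h3 h4
    have hb := (Φ p).map_target h4
    have hby : H ((Φ p).symm (κ y)) = y := by
      rw [hHa, hloc p _ hb, (Φ p).right_inv h4, ← hκ, κ.left_inv h3]
    have hbW : (Φ p).symm (κ y) ∈ H.source := mem_iUnion.2 ⟨p, hb⟩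
    change H.symm y = (Φ p).symm (κ y)
    rw [← H.left_inv hbW, hby]
  · rw [eventually_nhdsSet_iff_forall]
    rintro ⟨t₀, b⟩ ⟨ht₀, p, rfl⟩
    have ht₀' : ‖t₀‖ ≤ 1 := by simpa using ht₀
    have hfst : Tendsto (fun z : ℂ × S => z.1) (𝓝 (t₀, ι p)) (𝓝 t₀) := continuous_fst.tendsto _
    have hsnd : Tendsto (fun z : ℂ × S => z.2) (𝓝 (t₀, ι p)) (𝓝 (ι p)) := continuous_snd.tendsto _
    -- Nothing is known of `ψ` at time `0`, so near `t₀ = 0` the invariance of the box under the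
    -- punctured closed disc keeps `ψ z.1 z.2` in `W`. For `t₀ ≠ 0`, continuity at the fixed point
    -- `ι p` suffices, including times of modulus slightly above `1`.
    by_cases h0 : t₀ = 0
    · subst h0
      filter_upwards [hfst.eventually (Metric.closedBall_mem_nhds (0 : ℂ) one_pos),
        hsnd.eventually ((Φ p).open_source.mem_nhds (hΦ p).mem_source)] with z h1 h2 h3
      have h1' : ‖z.1‖ ≤ 1 := by simpa using h1
      have h4 : z.2 ∈ W := mem_iUnion.2 ⟨p, h2⟩
      have h5 : ψ z.1 z.2 ∈ W := mem_iUnion.2 ⟨p, ((hΦ p).action z.2 h2 z.1 h3 h1').1⟩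
      exact ⟨h4, h5, hsmul z.2 h4 z.1 (hψ.mem_of_norm_le_one h3 h1') h5⟩
    · have ht₀R := hψ.mem_of_norm_le_one h0 ht₀'
      have hc := (hψ.continuousAt ht₀R (hψ.range_subset (mem_range_self p))).tendsto
      simp only [hψ.map_fixed t₀ ht₀R p] at hc
      filter_upwards [hc.eventually (hWo.mem_nhds (hιW p)), hsnd.eventually (hWo.mem_nhds (hιW p)),
        hfst.eventually ((isOpen_puncturedDisc R).mem_nhds ht₀R)] with z h1 h2 h3 _
      exact ⟨h2, h1, hsmul z.2 h2 z.1 h3 h1⟩
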